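/- Let $(\Sigma^n,g)$ be a smooth Riemannian manifold with (possibly empty) boundary and let $f:\Sigma\to\mathbb R$ be smooth. Write $d\mathrm{Vol}_f=e^{-f}d\mathrm{Vol}$, $\Delta_f u=e^{f}\,\mathrm{div}(e^{-f}\nabla u)$, and let $\mathcal R_f=\mathcal R_f(g)=R+2\Delta f-|\nabla f|^2$ be the Perelman scalar curvature, where $R$ is the scalar curvature of $g$. Let $\delta_h\mathcal R_f(g)=\frac{d}{dt}\big|_{t=0}\mathcal R_f(g+th)$ be the linearization of $g\mapsto\mathcal R_f(g)$ (with $f$ fixed), and let $(\delta\mathcal R_f)^*$ be its formal $L^2(d\mathrm{Vol}_f)$-adjoint, acting on smooth functions that vanish on $\partial\Sigma$ (if $\partial\Sigma\neq\emptyset$). Thus $u\in\mathrm{Ker}(\delta\mathcal R_f)^*$ means that $u$ is smooth, $u|_{\partial\Sigma}=0$, and $\int_\Sigma u\,\delta_h\mathcal R_f(g)\,d\mathrm{Vol}_f=0$ for all smooth symmetric $(0,2)$-tensors $h$ with compact support in the interior of $\Sigma$. Let $u\in\mathrm{Ker}(\delta\mathcal R_f)^*$. Then $\mathcal R_f$ is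 smooth and $$\tfrac12\,u\,d\mathcal R_f=\Delta_f u\,df\quad\text{on }\Sigma .$$ If moreover $n\ge 2$ and $u$ does not vanish identically on any connected component of $\Sigma$ (for connected $\Sigma$: $u\not\equiv 0$), then there is a smooth function $\sigma:\Sigma\to\mathbb R$ with $$d\mathcal R_f=-2\sigma\,df\quad\text{and}\quad \Delta_f u=-\sigma\,u\quad\text{on }\Sigma .$$ -/

import Mathlib

open Set MeasureTheory Manifold
open scoped ContDiff Bundle

noncomputable section

namespace Perelman

/-! ### Riemannian geometry in coordinates

`G : ℝⁿ → Matrix` is the matrix field `(g_ij)` of a metric in some coordinates, `S ⊆ ℝⁿ` is the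
range of the model (the whole space or a half-space); derivatives are taken within `S`, so that
they are one-sided at boundary points. -/

section Coordinates

variable {n : ℕ}

/-- The partial derivative `∂ᵢ F`. -/
def pd (S : Set (EuclideanSpace ℝ (Fin n))) (i : Fin n) (F : EuclideanSpace ℝ (Fin n) → ℝ)
    (y : EuclideanSpace ℝ (Fin n)) : ℝ :=
  fderivWithin ℝ F S y (EuclideanSpace.single i 1)

/-- The Christoffel symbols
`Γᵏᵢⱼ = ½ gᵏˡ (∂ᵢ gⱼₗ + ∂ⱼ gᵢₗ - ∂ₗ gᵢⱼ)` of the Levi-Civita connection. -/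
def christoffel (S : Set (EuclideanSpace ℝ (Fin n)))
    (G : EuclideanSpace ℝ (Fin n) → Matrix (Fin n) (Fin n) ℝ) (k i j : Fin n)
    (y : EuclideanSpace ℝ (Fin n)) : ℝ :=
  1 / 2 * ∑ l, (G y)⁻¹ k l *
    (pd S i (fun z => G z j l) y + pd S j (fun z => G z i l) y - pd S l (fun z => G z i j) y)

/-- The Ricci tensor
`Ricⱼₖ = ∂ᵢ Γⁱⱼₖ - ∂ⱼ Γⁱᵢₖ + Γⁱᵢₗ Γˡⱼₖ - Γⁱⱼₗ Γˡᵢₖ` (positive on round spheres). -/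
def ricci (S : Set (EuclideanSpace ℝ (Fin n)))
    (G : EuclideanSpace ℝ (Fin n) → Matrix (Fin n) (Fin n) ℝ) (j k : Fin n)
    (y : EuclideanSpace ℝ (Fin n)) : ℝ :=
  ∑ i, (pd S i (christoffel S G i j k) y - pd S j (christoffel S G i i k) y +
    ∑ l, (christoffel S G i i l y * christoffel S G l j k y -
      christoffel S G i j l y * christoffel S G l i k y))

/-- The scalar curvature `R = gʲᵏ Ricⱼₖ`. -/
def scal (S : Set (EuclideanSpace ℝ (Fin n)))
    (G : EuclideanSpace ℝ (Fin n) → Matrix (Fin n) (Fin n) ℝ)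
    (y : EuclideanSpace ℝ (Fin n)) : ℝ :=
  ∑ j, ∑ k, (G y)⁻¹ j k * ricci S G j k y

/-- The components `(∇u)ᵏ = gᵏˡ ∂ₗ u` of the gradient. -/
def grad (S : Set (EuclideanSpace ℝ (Fin n)))
    (G : EuclideanSpace ℝ (Fin n) → Matrix (Fin n) (Fin n) ℝ)
    (u : EuclideanSpace ℝ (Fin n) → ℝ) (k : Fin n) (y : EuclideanSpace ℝ (Fin n)) : ℝ :=
  ∑ l, (G y)⁻¹ k l * pd S l u y

/-- The divergence `div X = ∂ₖ Xᵏ + Γᵏₖᵢ Xⁱ` of a vector field with components `X`. -/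
def divg (S : Set (EuclideanSpace ℝ (Fin n)))
    (G : EuclideanSpace ℝ (Fin n) → Matrix (Fin n) (Fin n) ℝ)
    (X : Fin n → EuclideanSpace ℝ (Fin n) → ℝ) (y : EuclideanSpace ℝ (Fin n)) : ℝ :=
  ∑ k, (pd S k (X k) y + ∑ i, christoffel S G k k i y * X i y)

/-- The Laplacian `Δ u = div ∇u`. -/
def lap (S : Set (EuclideanSpace ℝ (Fin n)))
    (G : EuclideanSpace ℝ (Fin n) → Matrix (Fin n) (Fin n) ℝ)
    (u : EuclideanSpace ℝ (Fin n) → ℝ) (y : EuclideanSpace ℝ (Fin n)) : ℝ :=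
  divg S G (grad S G u) y

/-- The drift Laplacian `Δ_f u = e^f div (e^{-f} ∇u)`. -/
def driftLap (S : Set (EuclideanSpace ℝ (Fin n)))
    (G : EuclideanSpace ℝ (Fin n) → Matrix (Fin n) (Fin n) ℝ)
    (f u : EuclideanSpace ℝ (Fin n) → ℝ) (y : EuclideanSpace ℝ (Fin n)) : ℝ :=
  Real.exp (f y) * divg S G (fun k z => Real.exp (-f z) * grad S G u k z) y

/-- The squared norm of the gradient, `|∇u|² = gₖₗ (∇u)ᵏ (∇u)ˡ`. -/
def gradSq (S : Set (EuclideanSpace ℝ (Fin n)))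
    (G : EuclideanSpace ℝ (Fin n) → Matrix (Fin n) (Fin n) ℝ)
    (u : EuclideanSpace ℝ (Fin n) → ℝ) (y : EuclideanSpace ℝ (Fin n)) : ℝ :=
  ∑ k, ∑ l, G y k l * grad S G u k y * grad S G u l y

end Coordinates

/-! ### Smooth metric measure spaces -/

section Manifold

variable {n : ℕ} {H : Type*} [TopologicalSpace H]
  (I : ModelWithCorners ℝ (EuclideanSpace ℝ (Fin n)) H)
  {M : Type*} [TopologicalSpace M] [ChartedSpace H M]

/-- The model `I` is the one of manifolds with (possibly empty) boundary and without corners: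
its image in `ℝⁿ` is the whole space or a closed half-space. -/
def IsBoundaryModel : Prop :=
  range I = univ ∨
    ∃ ℓ : EuclideanSpace ℝ (Fin n) →L[ℝ] ℝ, ℓ ≠ 0 ∧ range I = {y | 0 ≤ ℓ y}

/-- The components `B(∂ᵢ, ∂ⱼ)` of a field of bilinear forms in the chart around `x`, as functions
on `ℝⁿ`. -/
def gram (B : ∀ p : M, TangentSpace I p →L[ℝ] TangentSpace I p →L[ℝ] ℝ) (x : M)
    (y : EuclideanSpace ℝ (Fin n)) : Matrix (Fin n) (Fin n) ℝ :=
  Matrix.of fun i j =>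
    B ((extChartAt I x).symm y)
      (mfderivWithin 𝓘(ℝ, EuclideanSpace ℝ (Fin n)) I (extChartAt I x).symm (range I) y
        (EuclideanSpace.single i (1 : ℝ)))
      (mfderivWithin 𝓘(ℝ, EuclideanSpace ℝ (Fin n)) I (extChartAt I x).symm (range I) y
        (EuclideanSpace.single j (1 : ℝ)))

/-- The Perelman scalar curvature `𝓡_f = R + 2 Δf - |∇f|²` of the metric `B`, at `p`, computed in
the chart around `p`. (`B` is allowed to be any field of bilinear forms, since the linearization
evaluates this at `g + t h`; the value is meaningful where `B` is a metric near `p`.) -/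
def perelmanScal (B : ∀ p : M, TangentSpace I p →L[ℝ] TangentSpace I p →L[ℝ] ℝ)
    (f : M → ℝ) (p : M) : ℝ :=
  scal (range I) (gram I B p) (extChartAt I p p) +
    2 * lap (range I) (gram I B p) (f ∘ (extChartAt I p).symm) (extChartAt I p p) -
    gradSq (range I) (gram I B p) (f ∘ (extChartAt I p).symm) (extChartAt I p p)

/-- The drift Laplacian `Δ_f u = e^f div (e^{-f} ∇u)` on the manifold. -/
def driftLaplacian (B : ∀ p : M, TangentSpace I p →L[ℝ] TangentSpace I p →L[ℝ] ℝ)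
    (f u : M → ℝ) (p : M) : ℝ :=
  driftLap (range I) (gram I B p) (f ∘ (extChartAt I p).symm) (u ∘ (extChartAt I p).symm)
    (extChartAt I p p)

/-- The linearization `δ_h 𝓡_f (g) = d/dt 𝓡_f (g + t h)` at `t = 0`, with `f` fixed. -/
def linPerelmanScal (B h : ∀ p : M, TangentSpace I p →L[ℝ] TangentSpace I p →L[ℝ] ℝ)
    (f : M → ℝ) (p : M) : ℝ :=
  deriv (fun t : ℝ => perelmanScal I (fun q => B q + t • h q) f p) 0

/-- The integral `∫ F dVol_f = ∫ F e^{-f} dVol` of a function `F` which vanishes outside the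
domain of the chart around `x`; in this chart `dVol = √(det g_ij) dy`. -/
def chartIntegral (B : ∀ p : M, TangentSpace I p →L[ℝ] TangentSpace I p →L[ℝ] ℝ)
    (f : M → ℝ) (x : M) (F : M → ℝ) : ℝ :=
  ∫ y in (extChartAt I x).target,
    F ((extChartAt I x).symm y) * Real.exp (-f ((extChartAt I x).symm y)) *
      Real.sqrt (gram I B x y).det

variable [IsManifold I ∞ M]

/-- `h` is a smooth symmetric `(0,2)`-tensor field. -/
structure IsSymTensor (h : ∀ p : M, TangentSpace I p →L[ℝ] TangentSpace I p →L[ℝ] ℝ) :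
    Prop where
  symm : ∀ (p : M) (v w : TangentSpace I p), h p v w = h p w v
  smooth : ContMDiff I (I.prod 𝓘(ℝ, EuclideanSpace ℝ (Fin n) →L[ℝ]
      EuclideanSpace ℝ (Fin n) →L[ℝ] ℝ)) ∞
    (fun p => Bundle.TotalSpace.mk' (EuclideanSpace ℝ (Fin n) →L[ℝ]
      EuclideanSpace ℝ (Fin n) →L[ℝ] ℝ)
      (E := fun p : M => TangentSpace I p →L[ℝ] TangentSpace I p →L[ℝ] ℝ) p (h p))

/-- `u ∈ Ker (δ𝓡_f(g))^*`: `u` is smooth, vanishes on the boundary (if there is any), and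
`∫ u δ_h 𝓡_f(g) dVol_f = 0` for the test tensors `h`, that is, the formal `L²_f`-adjoint of the
linearization `h ↦ δ_h 𝓡_f(g)` annihilates `u`. The test tensors are the smooth symmetric
`(0,2)`-tensors with compact support in the interior of the manifold and in one chart domain;
by a partition of unity and linearity in `h`, this amounts to testing with all smooth symmetric
tensors compactly supported in the interior. -/
structure IsInKerAdjoint
    (g : Bundle.ContMDiffRiemannianMetric I ∞ (EuclideanSpace ℝ (Fin n))
      (fun p : M => TangentSpace I p))
    (f u : M → ℝ) : Prop where
  smooth : ContMDiff I 𝓘(ℝ, ℝ) ∞ u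
  boundary : ∀ p ∈ I.boundary M, u p = 0
  adjoint : ∀ (x : M) (h : ∀ p : M, TangentSpace I p →L[ℝ] TangentSpace I p →L[ℝ] ℝ),
    IsSymTensor I h →
    (∃ K : Set M, IsCompact K ∧ K ⊆ (chartAt H x).source ∩ I.interior M ∧
      ∀ p, p ∉ K → h p = 0) →
    chartIntegral I g.inner f x (fun p => u p * linPerelmanScal I g.inner h f p) = 0

end Manifold

end Perelman

end

noncomputable section

namespace Perelman

section

/-! The first identity is diffeomorphism invariance. Let `X` be a vector field with compact support
in the interior. Moving both `g` and `f` along `X` transports `𝓡_f`, and the variation of `f` alone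
contributes `2 Δ_f(Xf)`, so `δ_{L_X g} 𝓡_f = X 𝓡_f - 2 Δ_f (X f)`. Pairing with `u` kills the left
side, and integration by parts leaves `∫ u X(𝓡_f) dVol_f = 2 ∫ (Δ_f u) (X f) dVol_f`. Since `X` is
arbitrary, `u d𝓡_f = 2 Δ_f u df` in the interior, and up to the boundary by continuity. In
coordinates `X = η ∂ₘ`, and the flow is replaced by the map `z ↦ z + s η(z) eₘ`, which agrees with
it to first order. The steps are `IsIsom.coordScal_eq` (invariance of `𝓡_f` under isometries),
`lin_lieMetric` and `IsKer.mul_pd_coordScal`. The weight is absorbed by working with `v = e^{-f} u`.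

For the second part it must be shown that `Δ_f u / u` extends smoothly across the zeros of `u`.
Three facts give this.

(a) `Δ_f u = 0` wherever `u = 0` (`IsKer.driftLap_eq_zero`). At such a point the first identity
reads `Δ_f u df = 0`. If `df = 0` there, testing the kernel condition with conformal variations `h =
η g` gives `(n - 1) Δv = 0`, and hence again `Δ_f u = 0`.

(b) `u` and `du` have no common zero unless `u` vanishes on a whole component. The adjoint equation
(`IsKer.adjoint_eq`) has principal part `⟨s - (tr s) g, ∇²v⟩` for `h = η s`. As `s ↦ s - (tr s) g`
is invertible when `n ≥ 2`, the Hessian of `v` is a linear expression in `v` and `dv`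
(`IsKer.isFirstOrder_hess`). Along segments this is a linear ODE for the 1-jet, so a vanishing 1-jet
at a point forces `v = 0` nearby (`IsKer.eventually_eq_zero`). The set where `u` vanishes locally is
therefore clopen.

(c) Hadamard's lemma (`exists_eq_mul_of_eq_zero`) now divides. Near an interior zero, `u` can be
made a linear coordinate because `du ≠ 0`. Near a boundary point both `u` and `Δ_f u` are divisible
by the boundary defining function, and the quotient for `u` is nonzero at that point if `u` has
nonzero differential there.

The local quotients agree where `u ≠ 0`, which is dense, and glue to `-σ`. The formula for `d𝓡_f`
follows from the first identity off the zero set, and everywhere by density. -/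

/-- The coordinate space `ℝⁿ`. -/
abbrev Eu (n : ℕ) : Type := EuclideanSpace ℝ (Fin n)

variable {n : ℕ} {S t : Set (Eu n)} {y : Eu n}

/-! ### Calculus with partial derivatives -/

/-- `t` is a relatively open subset of a set `S` of unique differentiability. -/
structure RelOpen (S t : Set (Eu n)) : Prop where
  uniq : UniqueDiffOn ℝ S
  sub : t ⊆ S
  nhds : ∀ y ∈ t, t ∈ nhdsWithin y S

theorem RelOpen.uniqueDiffWithinAt (h : RelOpen S t) (hy : y ∈ t) : UniqueDiffWithinAt ℝ S y :=
  h.uniq y (h.sub hy)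

theorem RelOpen.uniqueDiffOn (h : RelOpen S t) : UniqueDiffOn ℝ t := fun y hy =>
  (h.uniqueDiffWithinAt hy).mono_nhds (nhdsWithin_le_iff.2 (h.nhds y hy))

theorem RelOpen.diff (h : RelOpen S t) {F : Eu n → ℝ} (hF : ContDiffOn ℝ ∞ F t) (hy : y ∈ t) :
    DifferentiableWithinAt ℝ F S y :=
  ((hF y hy).differentiableWithinAt (by simp)).mono_of_mem_nhdsWithin (h.nhds y hy)

theorem RelOpen.pd (h : RelOpen S t) {F : Eu n → ℝ} (hF : ContDiffOn ℝ ∞ F t) (i : Fin n) :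
    ContDiffOn ℝ ∞ (pd S i F) t := by
  have h1 : ContDiffOn ℝ ∞ (fun y => fderivWithin ℝ F t y (EuclideanSpace.single i 1)) t :=
    (hF.fderivWithin h.uniqueDiffOn (by simp)).clm_apply contDiffOn_const
  refine h1.congr fun y hy => ?_
  rw [Perelman.pd, fderivWithin_of_mem_nhdsWithin (h.nhds y hy) (h.uniqueDiffWithinAt hy)
    ((hF y hy).differentiableWithinAt (by simp))]

theorem RelOpen.inter {O : Set (Eu n)} (h : RelOpen S t) (hO : IsOpen O) : RelOpen S (t ∩ O) where
  uniq := h.uniq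
  sub := inter_subset_left.trans h.sub
  nhds y hy := Filter.inter_mem (h.nhds y hy.1) (mem_nhdsWithin_of_mem_nhds (hO.mem_nhds hy.2))

theorem RelOpen.of_isOpen (hS : UniqueDiffOn ℝ S) (ht : IsOpen t) (hts : t ⊆ S) : RelOpen S t where
  uniq := hS
  sub := hts
  nhds _ hy := mem_nhdsWithin_of_mem_nhds (ht.mem_nhds hy)

theorem pd_congr_of_eventuallyEq {F F' : Eu n → ℝ} (h : F =ᶠ[nhdsWithin y S] F') (hy : y ∈ S)
    (i : Fin n) : pd S i F y = pd S i F' y := by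
  rw [pd, pd, h.fderivWithin_eq (h.eq_of_nhdsWithin hy)]

theorem RelOpen.pd_congr (h : RelOpen S t) {F F' : Eu n → ℝ} (hF : EqOn F F' t) (hy : y ∈ t)
    (i : Fin n) : Perelman.pd S i F y = Perelman.pd S i F' y :=
  pd_congr_of_eventuallyEq (hF.eventuallyEq_of_mem (h.nhds y hy)) (h.sub hy) i

theorem pd_eq_fderiv {F : Eu n → ℝ} (hS : S ∈ nhds y) (i : Fin n) :
    pd S i F y = fderiv ℝ F y (EuclideanSpace.single i 1) := by
  rw [pd, fderivWithin_of_mem_nhds hS]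

@[simp] theorem pd_const (c : ℝ) (i : Fin n) : pd S i (fun _ => c) y = 0 := by
  simp [pd]


theorem pd_add {F F' : Eu n → ℝ} (hy : UniqueDiffWithinAt ℝ S y)
    (hF : DifferentiableWithinAt ℝ F S y) (hF' : DifferentiableWithinAt ℝ F' S y) (i : Fin n) :
    pd S i (fun z => F z + F' z) y = pd S i F y + pd S i F' y := by
  simp [pd, fderivWithin_fun_add hy hF hF']

theorem pd_sub {F F' : Eu n → ℝ} (hy : UniqueDiffWithinAt ℝ S y)
    (hF : DifferentiableWithinAt ℝ F S y) (hF' : DifferentiableWithinAt ℝ F' S y) (i : Fin n) :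
    pd S i (fun z => F z - F' z) y = pd S i F y - pd S i F' y := by
  simp [pd, fderivWithin_fun_sub hy hF hF']

theorem pd_mul {F F' : Eu n → ℝ} (hy : UniqueDiffWithinAt ℝ S y)
    (hF : DifferentiableWithinAt ℝ F S y) (hF' : DifferentiableWithinAt ℝ F' S y) (i : Fin n) :
    pd S i (fun z => F z * F' z) y = pd S i F y * F' y + F y * pd S i F' y := by
  simp [pd, fderivWithin_fun_mul hy hF hF']
  ring

theorem pd_sum {ι : Type*} {s : Finset ι} {F : ι → Eu n → ℝ} (hy : UniqueDiffWithinAt ℝ S y)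
    (hF : ∀ a ∈ s, DifferentiableWithinAt ℝ (F a) S y) (i : Fin n) :
    pd S i (fun z => ∑ a ∈ s, F a z) y = ∑ a ∈ s, pd S i (F a) y := by
  simp [pd, fderivWithin_fun_sum hy hF]

theorem pd_comp {F : Eu n → ℝ} {φ : ℝ → ℝ} {φ' : ℝ} (hy : UniqueDiffWithinAt ℝ S y)
    (hF : DifferentiableWithinAt ℝ F S y) (hφ : HasDerivAt φ φ' (F y)) (i : Fin n) :
    pd S i (fun z => φ (F z)) y = φ' * pd S i F y := by
  have := (hφ.comp_hasFDerivWithinAt y hF.hasFDerivWithinAt).fderivWithin hy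
  simp only [Function.comp_def] at this
  simp [pd, this]

/-! ### Inverses and determinants of matrix fields -/

section Matrix

variable {X : Type*} [NormedAddCommGroup X] [NormedSpace ℝ X] {m : ℕ} {s : Set X}
  {G : X → Matrix (Fin m) (Fin m) ℝ}

theorem contDiffOn_det (hG : ∀ i j, ContDiffOn ℝ ∞ (fun x => G x i j) s) :
    ContDiffOn ℝ ∞ (fun x => (G x).det) s := by
  simp only [Matrix.det_apply']
  exact ContDiffOn.sum fun σ _ => contDiffOn_const.mul (contDiffOn_prod fun i _ => hG _ _)

theorem contDiffOn_inv_apply (hG : ∀ i j, ContDiffOn ℝ ∞ (fun x => G x i j) s)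
    (hd : ∀ x ∈ s, (G x).det ≠ 0) (i j : Fin m) : ContDiffOn ℝ ∞ (fun x => (G x)⁻¹ i j) s := by
  simp only [Matrix.inv_def, Ring.inverse_eq_inv', Matrix.smul_apply, smul_eq_mul]
  refine ((contDiffOn_det hG).inv hd).mul ?_
  simp only [Matrix.adjugate_apply]
  refine contDiffOn_det fun k l => ?_
  simp only [Matrix.updateRow_apply]
  split_ifs
  · exact contDiffOn_const
  · exact hG _ _

/-- Jacobi's formula. -/
theorem hasFDerivWithinAt_det {x : X} {G' : Fin m → Fin m → X →L[ℝ] ℝ}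
    (hG : ∀ i j, HasFDerivWithinAt (fun x => G x i j) (G' i j) s x) :
    HasFDerivWithinAt (fun x => (G x).det) (∑ i, ∑ j, (G x).adjugate j i • G' i j) s x := by
  have h1 : HasFDerivWithinAt G (ContinuousLinearMap.pi fun i => ContinuousLinearMap.pi fun j =>
      G' i j) s x := hasFDerivWithinAt_pi.2 fun i => hasFDerivWithinAt_pi.2 fun j => hG i j
  let D : ContinuousMultilinearMap ℝ (fun _ : Fin m => Fin m → ℝ) ℝ :=
    { toMultilinearMap := (Matrix.detRowAlternating (R := ℝ) (n := Fin m)).toMultilinearMap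
      cont := by
        change Continuous fun A : Matrix (Fin m) (Fin m) ℝ => A.det
        exact continuous_id.matrix_det }
  have h2 := (D.hasFDerivAt (G x)).comp_hasFDerivWithinAt x h1
  refine h2.congr_fderiv ?_
  ext v
  have h3 : (D.linearDeriv (G x)) (fun i j => G' i j v) =
      ∑ i, ∑ j, (G x).adjugate j i * G' i j v := by
    -- The derivative of a multilinear map replaces one row at a time. After transposition each
    -- resulting determinant is a coordinate of a Cramer vector, and so a row of the adjugate
    -- applied to the new entries.
    refine (D.linearDeriv_apply (G x) _).trans (Finset.sum_congr rfl fun i _ => ?_)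
    change ((G x).updateRow i (fun j => G' i j v)).det = _
    rw [← Matrix.det_transpose, ← Matrix.updateCol_transpose, ← Matrix.cramer_apply,
      Matrix.cramer_eq_adjugate_mulVec, ← Matrix.adjugate_transpose]
    simp [Matrix.mulVec, dotProduct]
  simpa using h3

end Matrix


section MatrixField

variable {m : ℕ} {G : Eu n → Matrix (Fin m) (Fin m) ℝ}

/-- Differentiate `G⁻¹ G = 1` and solve for the derivative of the inverse. -/
theorem RelOpen.pd_inv (h : RelOpen S t) (hG : ∀ i j, ContDiffOn ℝ ∞ (fun x => G x i j) t)
    (hd : ∀ x ∈ t, (G x).det ≠ 0) (hy : y ∈ t) (k : Fin n) (i j : Fin m) :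
    Perelman.pd S k (fun z => (G z)⁻¹ i j) y =
      -∑ a, ∑ b, (G y)⁻¹ i a * Perelman.pd S k (fun z => G z a b) y * (G y)⁻¹ b j := by
  have hu : IsUnit (G y).det := (hd y hy).isUnit
  have hN := contDiffOn_inv_apply hG hd
  let dN : Matrix (Fin m) (Fin m) ℝ :=
    Matrix.of fun i j => Perelman.pd S k (fun z => (G z)⁻¹ i j) y
  let dG : Matrix (Fin m) (Fin m) ℝ := Matrix.of fun i j => Perelman.pd S k (fun z => G z i j) y
  have h1 : dN * G y + (G y)⁻¹ * dG = 0 := by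
    ext i j
    have h2 : EqOn (fun z => ∑ b, (G z)⁻¹ i b * G z b j)
        (fun _ => (1 : Matrix (Fin m) (Fin m) ℝ) i j) t := fun z hz => by
      simp only
      rw [← Matrix.nonsing_inv_mul (G z) (hd z hz).isUnit, Matrix.mul_apply]
    have h3 := h.pd_congr h2 hy k
    rw [pd_const, pd_sum (F := fun b z => (G z)⁻¹ i b * G z b j) (h.uniqueDiffWithinAt hy)
      fun b _ => (h.diff (hN i b) hy).mul (h.diff (hG b j) hy)] at h3
    simp only [pd_mul (h.uniqueDiffWithinAt hy) (h.diff (hN _ _) hy) (h.diff (hG _ _) hy)] at h3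
    simpa [Matrix.mul_apply, dN, dG, Finset.sum_add_distrib] using h3
  have h4 : dN = -((G y)⁻¹ * dG * (G y)⁻¹) := by
    have h5 : dN * G y * (G y)⁻¹ = dN := Matrix.mul_nonsing_inv_cancel_right _ _ hu
    rw [← h5, eq_neg_of_add_eq_zero_left h1, Matrix.neg_mul]
  have h6 := congrFun (congrFun h4 i) j
  simp only [dN, dG, Matrix.of_apply, Matrix.neg_apply, Matrix.mul_apply, Finset.sum_mul] at h6
  rw [h6, Finset.sum_comm]

theorem RelOpen.pd_det (h : RelOpen S t) (hG : ∀ i j, ContDiffOn ℝ ∞ (fun x => G x i j) t)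
    (hd : ∀ x ∈ t, (G x).det ≠ 0) (hy : y ∈ t) (k : Fin n) :
    Perelman.pd S k (fun z => (G z).det) y =
      (G y).det * ∑ i, ∑ j, (G y)⁻¹ j i * Perelman.pd S k (fun z => G z i j) y := by
  have h1 := (hasFDerivWithinAt_det fun i j =>
    (h.diff (hG i j) hy).hasFDerivWithinAt).fderivWithin (h.uniqueDiffWithinAt hy)
  rw [Perelman.pd, h1]
  simp [Matrix.inv_def, Finset.mul_sum, Perelman.pd, mul_assoc, hd y hy]

theorem RelOpen.pd_sqrt_det (h : RelOpen S t)
    (hG : ∀ i j, ContDiffOn ℝ ∞ (fun x => G x i j) t)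
    (hd : ∀ x ∈ t, 0 < (G x).det) (hy : y ∈ t) (k : Fin n) :
    Perelman.pd S k (fun z => √(G z).det) y =
      √(G y).det * (1 / 2 * ∑ i, ∑ j, (G y)⁻¹ j i * Perelman.pd S k (fun z => G z i j) y) := by
  rw [pd_comp (h.uniqueDiffWithinAt hy) (h.diff (contDiffOn_det hG) hy)
    (Real.hasDerivAt_sqrt (hd y hy).ne'), h.pd_det hG (fun x hx => (hd x hx).ne') hy]
  have h1 : √(G y).det ≠ 0 := (Real.sqrt_pos.2 (hd y hy)).ne'
  field_simp
  rw [Real.sq_sqrt (hd y hy).le]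

end MatrixField

/-! ### Restricting derivatives on `ℝ × ℝⁿ` to the two factors -/

section Slices

variable {X : Type*} [NormedAddCommGroup X] [NormedSpace ℝ X] {Φ : ℝ × Eu n → X}
  {Φ' : ℝ × Eu n →L[ℝ] X} {a : ℝ} {w : Eu n}

theorem hasDerivAt_comp_prodMk_right (h : HasFDerivAt Φ Φ' (a, w)) :
    HasDerivAt (fun s => Φ (s, w)) (Φ' (1, 0)) a := by
  have h2 : HasDerivAt (fun s : ℝ => (s, w)) ((1 : ℝ), (0 : Eu n)) a :=
    (hasDerivAt_id _).prodMk (hasDerivAt_const _ _)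
  exact HasFDerivAt.comp_hasDerivAt (f := fun s : ℝ => (s, w)) a h h2

theorem hasFDerivAt_comp_prodMk_left (h : HasFDerivAt Φ Φ' (a, w)) :
    HasFDerivAt (fun z => Φ (a, z)) (Φ'.comp (ContinuousLinearMap.inr ℝ ℝ (Eu n))) w := by
  have h2 : HasFDerivAt (fun z : Eu n => (a, z)) (ContinuousLinearMap.inr ℝ ℝ (Eu n)) w :=
    hasFDerivAt_prodMk_right a w
  exact HasFDerivAt.comp (f := fun z : Eu n => (a, z)) w h h2

end Slices

/-! ### Smooth one-parameter families of functions -/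

/-- `F` is a smooth family of functions on `W ⊆ ℝ × ℝⁿ`, with derivative `F'` at parameter `0`. -/
structure IsVar (W : Set (ℝ × Eu n)) (F : ℝ → Eu n → ℝ) (F' : Eu n → ℝ) : Prop where
  smooth : ContDiffOn ℝ ∞ (fun p : ℝ × Eu n => F p.1 p.2) W
  deriv : ∀ z, ((0 : ℝ), z) ∈ W → HasDerivAt (fun s => F s z) (F' z) 0

namespace IsVar

variable {W : Set (ℝ × Eu n)} {F K : ℝ → Eu n → ℝ} {F' K' : Eu n → ℝ}

theorem congr (h : IsVar W F F') {F₂ : ℝ → Eu n → ℝ} {F₂' : Eu n → ℝ} (hW : IsOpen W)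
    (h1 : ∀ p ∈ W, F₂ p.1 p.2 = F p.1 p.2)
    (h2 : ∀ z, ((0 : ℝ), z) ∈ W → F₂' z = F' z) : IsVar W F₂ F₂' where
  smooth := h.smooth.congr h1
  deriv z hz := by
    rw [h2 z hz]
    refine (h.deriv z hz).congr_of_eventuallyEq ?_
    have : Continuous fun s : ℝ => (s, z) := by fun_prop
    filter_upwards [this.continuousAt.preimage_mem_nhds (hW.mem_nhds hz)] with s hs
    exact h1 _ hs

theorem of_contDiffOn {A : Eu n → ℝ} (hA : ContDiffOn ℝ ∞ A t) (hW : ∀ p ∈ W, p.2 ∈ t) :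
    IsVar W (fun _ => A) (fun _ => 0) where
  smooth := hA.comp contDiffOn_snd hW
  deriv _ _ := hasDerivAt_const _ _

theorem const (c : ℝ) : IsVar W (fun _ _ => c) (fun _ => 0) where
  smooth := contDiffOn_const
  deriv _ _ := hasDerivAt_const _ _

theorem param : IsVar W (fun s _ => s) (fun _ => 1) where
  smooth := contDiffOn_fst
  deriv _ _ := hasDerivAt_id _

theorem add (h : IsVar W F F') (k : IsVar W K K') :
    IsVar W (fun s z => F s z + K s z) (fun z => F' z + K' z) where
  smooth := h.smooth.add k.smooth
  deriv z hz := (h.deriv z hz).add (k.deriv z hz)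

theorem sub (h : IsVar W F F') (k : IsVar W K K') :
    IsVar W (fun s z => F s z - K s z) (fun z => F' z - K' z) where
  smooth := h.smooth.sub k.smooth
  deriv z hz := (h.deriv z hz).sub (k.deriv z hz)

theorem mul (h : IsVar W F F') (k : IsVar W K K') :
    IsVar W (fun s z => F s z * K s z) (fun z => F' z * K 0 z + F 0 z * K' z) where
  smooth := h.smooth.mul k.smooth
  deriv z hz := (h.deriv z hz).mul (k.deriv z hz)

theorem sum {ι : Type*} {s : Finset ι} {F : ι → ℝ → Eu n → ℝ} {F' : ι → Eu n → ℝ}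
    (h : ∀ a ∈ s, IsVar W (F a) (F' a)) :
    IsVar W (fun s' z => ∑ a ∈ s, F a s' z) (fun z => ∑ a ∈ s, F' a z) where
  smooth := ContDiffOn.sum fun a ha => (h a ha).smooth
  deriv z hz := HasDerivAt.fun_sum fun a ha => (h a ha).deriv z hz

theorem unique (h : IsVar W F F') {F₂' : Eu n → ℝ} (k : IsVar W F F₂') {z : Eu n}
    (hz : ((0 : ℝ), z) ∈ W) : F' z = F₂' z := (h.deriv z hz).unique (k.deriv z hz)

theorem deriv_eq_fderiv (h : IsVar W F F') (hW : IsOpen W) {z : Eu n} (hz : ((0 : ℝ), z) ∈ W) :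
    F' z = fderiv ℝ (fun p : ℝ × Eu n => F p.1 p.2) (0, z) (1, 0) := by
  have h1 : HasFDerivAt (fun p : ℝ × Eu n => F p.1 p.2)
      (fderiv ℝ (fun p : ℝ × Eu n => F p.1 p.2) (0, z)) (0, z) :=
    ((h.smooth.contDiffAt (hW.mem_nhds hz)).differentiableAt (by simp)).hasFDerivAt
  exact (h.deriv z hz).unique (hasDerivAt_comp_prodMk_right h1)

/-- The parameter derivative and the spatial derivative commute because the second derivative of
`(s, z) ↦ F s z` is symmetric. This is why `IsVar` asks for joint smoothness. The hypothesis on `S`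
turns derivatives within `S` into ordinary ones. -/
theorem pd (h : IsVar W F F') (hW : IsOpen W) (hS : ∀ p ∈ W, S ∈ nhds p.2) (i : Fin n) :
    IsVar W (fun s => Perelman.pd S i (F s)) (Perelman.pd S i F') := by
  set Φ := fun p : ℝ × Eu n => F p.1 p.2 with hΦ
  have hdiff : ∀ p ∈ W, HasFDerivAt Φ (fderiv ℝ Φ p) p := fun p hp =>
    ((h.smooth.contDiffAt (hW.mem_nhds hp)).differentiableAt (by simp)).hasFDerivAt
  have hd2 : ContDiffOn ℝ ∞ (fderiv ℝ Φ) W := h.smooth.fderiv_of_isOpen hW (by simp)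
  have key : ∀ p ∈ W, Perelman.pd S i (F p.1) p.2 =
      fderiv ℝ Φ p (0, EuclideanSpace.single i 1) := fun p hp => by
    rw [pd_eq_fderiv (hS p hp)]
    have h3 := (hasFDerivAt_comp_prodMk_left (Φ := Φ) (a := p.1) (w := p.2) (hdiff p hp)).fderiv
    simp only [hΦ] at h3
    rw [h3]
    rfl
  refine ⟨(hd2.clm_apply contDiffOn_const).congr key, fun z hz => ?_⟩
  have hz2 : HasFDerivAt (fderiv ℝ Φ) (fderiv ℝ (fderiv ℝ Φ) (0, z)) (0, z) :=
    ((hd2.contDiffAt (hW.mem_nhds hz)).differentiableAt (by simp)).hasFDerivAt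
  have hsymm : fderiv ℝ (fderiv ℝ Φ) (0, z) (1, 0) (0, EuclideanSpace.single i 1) =
      fderiv ℝ (fderiv ℝ Φ) (0, z) (0, EuclideanSpace.single i 1) (1, 0) :=
    (h.smooth.contDiffAt (hW.mem_nhds hz)).isSymmSndFDerivAt
      (by simpa using (WithTop.coe_le_coe.2 (le_top : (2 : ℕ∞) ≤ ⊤))) _ _
  have h1 : HasDerivAt (fun s : ℝ => fderiv ℝ Φ (s, z) (0, EuclideanSpace.single i 1))
      (fderiv ℝ (fderiv ℝ Φ) (0, z) (1, 0) (0, EuclideanSpace.single i 1)) 0 := by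
    exact (ContinuousLinearMap.apply ℝ ℝ ((0 : ℝ), EuclideanSpace.single i (1 : ℝ))).hasFDerivAt
      |>.comp_hasDerivAt (0 : ℝ) (hasDerivAt_comp_prodMk_right hz2)
  have h4 : Perelman.pd S i F' z =
      fderiv ℝ (fderiv ℝ Φ) (0, z) (0, EuclideanSpace.single i 1) (1, 0) := by
    rw [pd_eq_fderiv (hS _ hz)]
    have hc : Continuous fun w : Eu n => ((0 : ℝ), w) := by fun_prop
    have he : F' =ᶠ[nhds z] fun w => fderiv ℝ Φ (0, w) (1, 0) := by
      filter_upwards [hc.continuousAt.preimage_mem_nhds (hW.mem_nhds hz)] with w hw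
      exact h.deriv_eq_fderiv hW hw
    rw [he.fderiv_eq]
    have h3 := ((ContinuousLinearMap.apply ℝ ℝ ((1 : ℝ), (0 : Eu n))).hasFDerivAt.comp z
      (hasFDerivAt_comp_prodMk_left hz2)).fderiv
    simp only [Function.comp_def, ContinuousLinearMap.apply_apply] at h3
    rw [h3]
    rfl
  rw [h4, ← hsymm]
  refine h1.congr_of_eventuallyEq ?_
  have hc : Continuous fun s : ℝ => (s, z) := by fun_prop
  filter_upwards [hc.continuousAt.preimage_mem_nhds (hW.mem_nhds hz)] with s hs
  exact key _ hs

theorem inv {m : ℕ} {G : ℝ → Eu n → Matrix (Fin m) (Fin m) ℝ} {G' : Eu n → Matrix (Fin m) (Fin m) ℝ}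
    (h : ∀ i j, IsVar W (fun s z => G s z i j) (fun z => G' z i j)) (hW : IsOpen W)
    (hd : ∀ p ∈ W, (G p.1 p.2).det ≠ 0) (i j : Fin m) :
    IsVar W (fun s z => (G s z)⁻¹ i j) (fun z => -((G 0 z)⁻¹ * G' z * (G 0 z)⁻¹) i j) := by
  have hs := contDiffOn_inv_apply (G := fun p : ℝ × Eu n => G p.1 p.2) (fun i j => (h i j).smooth)
    hd
  refine ⟨hs i j, fun z hz => ?_⟩
  have hu : IsUnit (G 0 z).det := (hd _ hz).isUnit
  have hc : Continuous fun s : ℝ => (s, z) := by fun_prop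
  have hdN : ∀ i j, HasDerivAt (fun s => (G s z)⁻¹ i j)
      (_root_.deriv (fun s => (G s z)⁻¹ i j) 0) 0 := fun i j => by
    have h1 := ((hs i j).contDiffAt (hW.mem_nhds hz)).differentiableAt (by simp)
    have h2 : DifferentiableAt ℝ (fun s : ℝ => (s, z)) 0 := by fun_prop
    exact (DifferentiableAt.comp (0 : ℝ) h1 h2).hasDerivAt
  let dN : Matrix (Fin m) (Fin m) ℝ := Matrix.of fun i j => _root_.deriv (fun s => (G s z)⁻¹ i j) 0
  have h1 : dN * G 0 z + (G 0 z)⁻¹ * G' z = 0 := by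
    ext i j
    have h2 : HasDerivAt (fun s => ∑ b, (G s z)⁻¹ i b * G s z b j)
        (∑ b, (dN i b * G 0 z b j + (G 0 z)⁻¹ i b * G' z b j)) 0 :=
      HasDerivAt.fun_sum fun b _ => (hdN i b).mul ((h b j).deriv z hz)
    have h3 : (fun s => ∑ b, (G s z)⁻¹ i b * G s z b j) =ᶠ[nhds 0]
        fun _ => (1 : Matrix (Fin m) (Fin m) ℝ) i j := by
      filter_upwards [hc.continuousAt.preimage_mem_nhds (hW.mem_nhds hz)] with s hs
      rw [← Matrix.nonsing_inv_mul (G s z) (hd _ hs).isUnit, Matrix.mul_apply]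
    have h4 := h2.unique ((hasDerivAt_const (0 : ℝ) _).congr_of_eventuallyEq h3)
    simpa [Matrix.mul_apply, Finset.sum_add_distrib] using h4
  have h4 : dN = -((G 0 z)⁻¹ * G' z * (G 0 z)⁻¹) := by
    have h5 : dN * G 0 z * (G 0 z)⁻¹ = dN := Matrix.mul_nonsing_inv_cancel_right _ _ hu
    rw [← h5, eq_neg_of_add_eq_zero_left h1, Matrix.neg_mul]
  have h6 : _root_.deriv (fun s => (G s z)⁻¹ i j) 0 = -((G 0 z)⁻¹ * G' z * (G 0 z)⁻¹) i j :=
    congrFun (congrFun h4 i) j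
  exact h6 ▸ hdN i j

end IsVar

end

section

variable {n : ℕ} {S t : Set (Eu n)} {y : Eu n} {G : Eu n → Matrix (Fin n) (Fin n) ℝ}

/-! ### The Levi-Civita connection -/

/-- `G` is a smooth nondegenerate symmetric matrix field on the relatively open set `t ⊆ S`. -/
structure IsMetric (S t : Set (Eu n)) (G : Eu n → Matrix (Fin n) (Fin n) ℝ) : Prop
    extends RelOpen S t where
  smooth : ∀ i j, ContDiffOn ℝ ∞ (fun z => G z i j) t
  symm : ∀ z ∈ t, (G z).IsSymm
  det_ne : ∀ z ∈ t, (G z).det ≠ 0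

theorem lower_grad (hy : IsUnit (G y).det) (u : Eu n → ℝ) (m : Fin n) :
    ∑ k, G y m k * grad S G u k y = pd S m u y := by
  simp only [grad, Finset.mul_sum]
  rw [Finset.sum_comm]
  simp only [← mul_assoc, ← Finset.sum_mul, ← Matrix.mul_apply, Matrix.mul_nonsing_inv _ hy,
    Matrix.one_apply]
  simp

theorem gradSq_eq (hy : IsUnit (G y).det) (u : Eu n → ℝ) :
    gradSq S G u y = ∑ k, pd S k u y * grad S G u k y := by
  simp only [gradSq]
  refine Finset.sum_congr rfl fun k _ => ?_
  rw [← lower_grad hy u k, Finset.sum_mul]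
  exact Finset.sum_congr rfl fun l _ => by ring

namespace IsMetric

theorem isUnit (h : IsMetric S t G) (hy : y ∈ t) : IsUnit (G y).det := (h.det_ne y hy).isUnit

theorem inv_smooth (h : IsMetric S t G) (i j : Fin n) :
    ContDiffOn ℝ ∞ (fun z => (G z)⁻¹ i j) t := contDiffOn_inv_apply h.smooth h.det_ne i j

theorem inv_symm (h : IsMetric S t G) (hy : y ∈ t) (i j : Fin n) :
    (G y)⁻¹ i j = (G y)⁻¹ j i := by
  have h1 := Matrix.transpose_nonsing_inv (G y)
  rw [(h.symm y hy).eq] at h1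
  exact congrFun (congrFun h1 j) i

theorem inv_mul (h : IsMetric S t G) (hy : y ∈ t) (i j : Fin n) :
    ∑ k, (G y)⁻¹ i k * G y k j = if i = j then 1 else 0 := by
  rw [← Matrix.mul_apply, Matrix.nonsing_inv_mul _ (h.isUnit hy), Matrix.one_apply]

theorem mul_inv (h : IsMetric S t G) (hy : y ∈ t) (i j : Fin n) :
    ∑ k, G y i k * (G y)⁻¹ k j = if i = j then 1 else 0 := by
  rw [← Matrix.mul_apply, Matrix.mul_nonsing_inv _ (h.isUnit hy), Matrix.one_apply]

theorem pd_symm (h : IsMetric S t G) (hy : y ∈ t) (k i j : Fin n) :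
    Perelman.pd S k (fun z => G z i j) y = Perelman.pd S k (fun z => G z j i) y :=
  h.pd_congr (fun z hz => (h.symm z hz).apply j i) hy k

theorem christoffel_smooth (h : IsMetric S t G) (k i j : Fin n) :
    ContDiffOn ℝ ∞ (christoffel S G k i j) t := by
  refine contDiffOn_const.mul (ContDiffOn.sum fun l _ => (h.inv_smooth k l).mul ?_)
  exact ((h.pd (h.smooth j l) i).add (h.pd (h.smooth i l) j)).sub (h.pd (h.smooth i j) l)

theorem christoffel_symm (h : IsMetric S t G) (hy : y ∈ t) (k i j : Fin n) :
    christoffel S G k i j y = christoffel S G k j i y := by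
  simp only [christoffel]
  congr 1
  refine Finset.sum_congr rfl fun l _ => ?_
  rw [h.pd_symm hy l i j]
  ring

theorem lower_christoffel (h : IsMetric S t G) (hy : y ∈ t) (m i j : Fin n) :
    ∑ k, G y m k * christoffel S G k i j y = 1 / 2 * (Perelman.pd S i (fun z => G z j m) y +
      Perelman.pd S j (fun z => G z i m) y - Perelman.pd S m (fun z => G z i j) y) := by
  have h1 : ∀ k, G y m k * christoffel S G k i j y = 1 / 2 * ∑ l, (G y m k * (G y)⁻¹ k l) *
      (Perelman.pd S i (fun z => G z j l) y + Perelman.pd S j (fun z => G z i l) y -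
        Perelman.pd S l (fun z => G z i j) y) := fun k => by
    simp only [christoffel, mul_assoc, ← Finset.mul_sum]
    ring
  simp only [h1, ← Finset.mul_sum]
  rw [Finset.sum_comm]
  simp only [← Finset.sum_mul, h.mul_inv hy]
  simp

/-- This is `∇g = 0`. In the sum of two instances of the Koszul formula, every derivative of the
metric except `∂ₖ gᵢⱼ` cancels. -/
theorem pd_metric (h : IsMetric S t G) (hy : y ∈ t) (k i j : Fin n) :
    Perelman.pd S k (fun z => G z i j) y =
      ∑ l, (christoffel S G l k i y * G y l j + christoffel S G l k j y * G y i l) := by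
  have h1 := h.lower_christoffel hy j k i
  have h2 := h.lower_christoffel hy i k j
  rw [Finset.sum_add_distrib]
  have h3 : ∑ l, christoffel S G l k i y * G y l j = ∑ l, G y j l * christoffel S G l k i y :=
    Finset.sum_congr rfl fun l _ => by rw [(h.symm y hy).apply l j, mul_comm]
  have h4 : ∑ l, christoffel S G l k j y * G y i l = ∑ l, G y i l * christoffel S G l k j y :=
    Finset.sum_congr rfl fun l _ => mul_comm _ _
  rw [h3, h4, h1, h2, h.pd_symm hy k j i, h.pd_symm hy i k j, h.pd_symm hy j k i]
  ring

/-- This is `∇g⁻¹ = 0`, the form of metric compatibility that the contracted Palatini identity uses.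
With `A` the matrix of `Γₖ`, compatibility reads `∂G = Aᵀ G + G A`, and conjugating by `G⁻¹` gives
the claim. -/
theorem pd_inv_metric (h : IsMetric S t G) (hy : y ∈ t) (k i j : Fin n) :
    Perelman.pd S k (fun z => (G z)⁻¹ i j) y =
      -∑ l, (christoffel S G i k l y * (G y)⁻¹ l j + christoffel S G j k l y * (G y)⁻¹ i l) := by
  rw [h.pd_inv h.smooth h.det_ne hy]
  congr 1
  let N := (G y)⁻¹
  let A : Matrix (Fin n) (Fin n) ℝ := Matrix.of fun l i => christoffel S G l k i y
  have hdG : (Matrix.of fun i j => Perelman.pd S k (fun z => G z i j) y) =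
      A.transpose * G y + G y * A := by
    ext i j
    simp only [Matrix.of_apply, h.pd_metric hy, Matrix.add_apply, Matrix.mul_apply,
      Matrix.transpose_apply, Finset.sum_add_distrib, A]
    congr 1
    exact Finset.sum_congr rfl fun l _ => mul_comm _ _
  have h1 : N * (Matrix.of fun i j => Perelman.pd S k (fun z => G z i j) y) * N =
      N * A.transpose + A * N := by
    rw [hdG, Matrix.mul_add, Matrix.add_mul, Matrix.mul_assoc, Matrix.mul_assoc,
      Matrix.mul_nonsing_inv _ (h.isUnit hy), Matrix.mul_one, ← Matrix.mul_assoc,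
      Matrix.nonsing_inv_mul _ (h.isUnit hy), Matrix.one_mul]
  have h2 := congrFun (congrFun h1 i) j
  simp only [Matrix.mul_apply, Matrix.add_apply, Matrix.transpose_apply, Finset.sum_mul,
    Matrix.of_apply, A, N] at h2
  rw [Finset.sum_comm, h2, add_comm, Finset.sum_add_distrib]
  congr 1
  exact Finset.sum_congr rfl fun l _ => mul_comm _ _

/-- Two of the three terms of the Christoffel symbol are exchanged by the symmetry of `g⁻¹` and
cancel in the trace. What remains is the logarithmic derivative of `√det g`. -/
theorem sum_christoffel (h : IsMetric S t G) (hy : y ∈ t) (k : Fin n) :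
    ∑ i, christoffel S G i i k y =
      1 / 2 * ∑ i, ∑ j, (G y)⁻¹ j i * Perelman.pd S k (fun z => G z i j) y := by
  have h1 : ∀ i, christoffel S G i i k y = 1 / 2 * ∑ l, ((G y)⁻¹ i l *
      Perelman.pd S i (fun z => G z k l) y - (G y)⁻¹ i l * Perelman.pd S l (fun z => G z k i) y +
      (G y)⁻¹ l i * Perelman.pd S k (fun z => G z i l) y) := fun i => by
    simp only [christoffel]
    congr 1
    refine Finset.sum_congr rfl fun l _ => ?_
    rw [h.pd_symm hy l k i, h.inv_symm hy l i]
    ring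
  simp only [h1, ← Finset.mul_sum, Finset.sum_add_distrib, Finset.sum_sub_distrib]
  have h2 : ∑ i, ∑ l, (G y)⁻¹ i l * Perelman.pd S i (fun z => G z k l) y =
      ∑ i, ∑ l, (G y)⁻¹ i l * Perelman.pd S l (fun z => G z k i) y := by
    rw [Finset.sum_comm]
    exact Finset.sum_congr rfl fun i _ => Finset.sum_congr rfl fun l _ => by
      rw [h.inv_symm hy l i]
  rw [h2]
  ring

theorem pd_sqrt_det_metric (h : IsMetric S t G) (hpos : ∀ z ∈ t, 0 < (G z).det) (hy : y ∈ t)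
    (k : Fin n) : Perelman.pd S k (fun z => √(G z).det) y =
      √(G y).det * ∑ i, christoffel S G i i k y := by
  rw [h.pd_sqrt_det h.smooth hpos hy, h.sum_christoffel hy]

theorem sqrt_det_smooth (h : IsMetric S t G) (hpos : ∀ z ∈ t, 0 < (G z).det) :
    ContDiffOn ℝ ∞ (fun z => √(G z).det) t :=
  (contDiffOn_det h.smooth).sqrt fun z hz => (hpos z hz).ne'

/-- The density `√det g` turns the Riemannian divergence into a Euclidean one, so all later
integrations by parts can be done with Lebesgue measure. -/
theorem sqrt_det_mul_divg (h : IsMetric S t G) (hpos : ∀ z ∈ t, 0 < (G z).det) (hy : y ∈ t)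
    {X : Fin n → Eu n → ℝ} (hX : ∀ k, ContDiffOn ℝ ∞ (X k) t) :
    √(G y).det * divg S G X y = ∑ k, Perelman.pd S k (fun z => √(G z).det * X k z) y := by
  simp only [pd_mul (h.uniqueDiffWithinAt hy) (h.diff (h.sqrt_det_smooth hpos) hy)
    (h.diff (hX _) hy), h.pd_sqrt_det_metric hpos hy, divg]
  rw [Finset.sum_add_distrib, Finset.sum_add_distrib, Finset.sum_comm, mul_add, Finset.mul_sum,
    Finset.mul_sum, add_comm]
  congr 1
  refine Finset.sum_congr rfl fun i _ => ?_
  rw [← Finset.sum_mul, mul_assoc]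

theorem grad_smooth (h : IsMetric S t G) {u : Eu n → ℝ} (hu : ContDiffOn ℝ ∞ u t) (k : Fin n) :
    ContDiffOn ℝ ∞ (grad S G u k) t :=
  ContDiffOn.sum fun l _ => (h.inv_smooth k l).mul (h.pd hu l)

theorem divg_smooth (h : IsMetric S t G) {X : Fin n → Eu n → ℝ}
    (hX : ∀ k, ContDiffOn ℝ ∞ (X k) t) : ContDiffOn ℝ ∞ (divg S G X) t :=
  ContDiffOn.sum fun k _ => (h.pd (hX k) k).add
    (ContDiffOn.sum fun i _ => (h.christoffel_smooth k k i).mul (hX i))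

theorem ricci_smooth (h : IsMetric S t G) (j k : Fin n) : ContDiffOn ℝ ∞ (ricci S G j k) t := by
  refine ContDiffOn.sum fun i _ => ((h.pd (h.christoffel_smooth _ _ _) _).sub
    (h.pd (h.christoffel_smooth _ _ _) _)).add (ContDiffOn.sum fun l _ => ?_)
  exact ((h.christoffel_smooth _ _ _).mul (h.christoffel_smooth _ _ _)).sub
    ((h.christoffel_smooth _ _ _).mul (h.christoffel_smooth _ _ _))

theorem scal_smooth (h : IsMetric S t G) : ContDiffOn ℝ ∞ (scal S G) t :=
  ContDiffOn.sum fun j _ => ContDiffOn.sum fun k _ => (h.inv_smooth j k).mul (h.ricci_smooth j k)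

theorem driftLap_smooth (h : IsMetric S t G) {f u : Eu n → ℝ} (hf : ContDiffOn ℝ ∞ f t)
    (hu : ContDiffOn ℝ ∞ u t) : ContDiffOn ℝ ∞ (driftLap S G f u) t :=
  hf.exp.mul (h.divg_smooth fun k => hf.neg.exp.mul (h.grad_smooth hu k))

theorem gradSq_smooth (h : IsMetric S t G) {u : Eu n → ℝ} (hu : ContDiffOn ℝ ∞ u t) :
    ContDiffOn ℝ ∞ (gradSq S G u) t :=
  (ContDiffOn.sum fun k _ => (h.pd hu k).mul (h.grad_smooth hu k)).congr
    fun _ hz => gradSq_eq (h.isUnit hz) u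

theorem inter (h : IsMetric S t G) {O : Set (Eu n)} (hO : IsOpen O) : IsMetric S (t ∩ O) G where
  toRelOpen := h.toRelOpen.inter hO
  smooth i j := (h.smooth i j).mono inter_subset_left
  symm z hz := h.symm z hz.1
  det_ne z hz := h.det_ne z hz.1

end IsMetric

/-- The Perelman scalar curvature in coordinates. -/
def coordScal (S : Set (Eu n)) (G : Eu n → Matrix (Fin n) (Fin n) ℝ) (f : Eu n → ℝ) (y : Eu n) :
    ℝ :=
  scal S G y + 2 * lap S G f y - gradSq S G f y

theorem IsMetric.coordScal_smooth (h : IsMetric S t G) {f : Eu n → ℝ} (hf : ContDiffOn ℝ ∞ f t) :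
    ContDiffOn ℝ ∞ (coordScal S G f) t :=
  (h.scal_smooth.add (contDiffOn_const.mul (h.divg_smooth (h.grad_smooth hf)))).sub
    (h.gradSq_smooth hf)

/-! ### The contracted Palatini identity -/

/-- The variation of the Ricci tensor under a variation `T` of the Christoffel symbols. -/
def linRicci (S : Set (Eu n)) (G : Eu n → Matrix (Fin n) (Fin n) ℝ)
    (T : Fin n → Fin n → Fin n → Eu n → ℝ) (j k : Fin n) (y : Eu n) : ℝ :=
  ∑ i, (pd S i (T i j k) y - pd S j (T i i k) y +
    ∑ l, ((T i i l y * christoffel S G l j k y + christoffel S G i i l y * T l j k y) -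
      (T i j l y * christoffel S G l i k y + christoffel S G i j l y * T l i k y)))

/-- The first contraction `gʲᵏ Tⁱⱼₖ`. -/
def contr₁ (G : Eu n → Matrix (Fin n) (Fin n) ℝ) (T : Fin n → Fin n → Fin n → Eu n → ℝ)
    (i : Fin n) (y : Eu n) : ℝ :=
  ∑ j, ∑ k, (G y)⁻¹ j k * T i j k y

/-- The second contraction `gⁱᵏ Tʲⱼₖ`. -/
def contr₂ (G : Eu n → Matrix (Fin n) (Fin n) ℝ) (T : Fin n → Fin n → Fin n → Eu n → ℝ)
    (i : Fin n) (y : Eu n) : ℝ :=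
  ∑ k, (G y)⁻¹ i k * ∑ j, T j j k y

theorem sum_comm_pairs {n : ℕ} (F : Fin n → Fin n → Fin n → Fin n → ℝ) :
    ∑ j, ∑ k, ∑ i, ∑ l, F j k i l = ∑ i, ∑ l, ∑ j, ∑ k, F j k i l := by
  rw [Finset.sum_comm_cycle]
  exact Finset.sum_congr rfl fun i _ => Finset.sum_comm_cycle

/-- The pointwise content of the Palatini identity: `N` stands for `g⁻¹`, `T` for the varied
Christoffel symbols, and `dT`, `dN` for derivatives. Both sides reduce to `D1 - D2 + A + B - 2C`. On
the left the two subtracted quadratic terms coincide after relabelling. On the right `dN` is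
replaced through `∇g⁻¹ = 0`, which produces `-2C` and `-(X + A)`, and `X` cancels against the
connection term of the second divergence. -/
theorem palatini_algebra (N : Fin n → Fin n → ℝ) (Γ T : Fin n → Fin n → Fin n → ℝ)
    (dT : Fin n → Fin n → Fin n → Fin n → ℝ) (dN : Fin n → Fin n → Fin n → ℝ)
    (hN : ∀ i j, N i j = N j i) (hΓ : ∀ k i j, Γ k i j = Γ k j i) (hT : ∀ k i j, T k i j = T k j i)
    (hdN : ∀ k i j, dN k i j = -∑ l, (Γ i k l * N l j + Γ j k l * N i l)) :
    ∑ j, ∑ k, N j k * ∑ i, (dT i i j k - dT j i i k + ∑ l, ((T i i l * Γ l j k + Γ i i l * T l j k)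
      - (T i j l * Γ l i k + Γ i j l * T l i k))) =
    ∑ i, (∑ j, ∑ k, (dN i j k * T i j k + N j k * dT i i j k) +
      ∑ m, Γ i i m * ∑ j, ∑ k, N j k * T m j k) -
    ∑ j, (∑ k, (dN j j k * ∑ i, T i i k + N j k * ∑ i, dT j i i k) +
      ∑ m, Γ j j m * ∑ k, N m k * ∑ i, T i i k) := by
  set D1 := ∑ i, ∑ j, ∑ k, N j k * dT i i j k with hD1
  set D2 := ∑ j, ∑ k, N j k * ∑ i, dT j i i k with hD2
  set A := ∑ j, ∑ k, ∑ i, ∑ l, N j k * (T i i l * Γ l j k) with hA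
  set B := ∑ i, ∑ m, Γ i i m * ∑ j, ∑ k, N j k * T m j k with hB
  set C := ∑ j, ∑ k, ∑ i, ∑ l, N j k * (T i j l * Γ l i k) with hC
  set X := ∑ j, ∑ m, Γ j j m * ∑ k, N m k * ∑ i, T i i k with hX
  have e1 : ∑ j, ∑ k, N j k * ∑ i, (dT i i j k - dT j i i k + ∑ l, ((T i i l * Γ l j k +
      Γ i i l * T l j k) - (T i j l * Γ l i k + Γ i j l * T l i k))) =
      D1 - D2 + (A + B) - (C + C) := by
    have b1 : ∑ j, ∑ k, ∑ i, N j k * dT i i j k = D1 := by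
      rw [hD1, Finset.sum_comm_cycle]
    have b2 : ∑ j, ∑ k, ∑ i, ∑ l, N j k * (Γ i i l * T l j k) = B := by
      rw [sum_comm_pairs, hB]
      simp only [Finset.mul_sum]
      exact Finset.sum_congr rfl fun i _ => Finset.sum_congr rfl fun m _ =>
        Finset.sum_congr rfl fun j _ => Finset.sum_congr rfl fun k _ => by ring
    have b3 : ∑ j, ∑ k, ∑ i, ∑ l, N j k * (Γ i j l * T l i k) = C := by
      rw [Finset.sum_comm, hC]
      refine Finset.sum_congr rfl fun j _ => Finset.sum_congr rfl fun k _ => ?_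
      rw [Finset.sum_comm]
      refine Finset.sum_congr rfl fun i _ => Finset.sum_congr rfl fun l _ => ?_
      rw [hN k j, hΓ l k i, hT i l j]
      ring
    simp only [Finset.mul_sum, Finset.sum_add_distrib, Finset.sum_sub_distrib, mul_add, mul_sub]
    rw [b1, b2, b3, hD2, hA]
    simp only [Finset.mul_sum]
    rw [← hC]
    ring
  have e2 : ∑ i, ∑ j, ∑ k, dN i j k * T i j k = -(C + C) := by
    have c1 : ∑ i, ∑ j, ∑ k, ∑ l, Γ j i l * N l k * T i j k = C := by
      rw [sum_comm_pairs, hC]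
      refine Finset.sum_congr rfl fun j _ => Finset.sum_congr rfl fun k _ =>
        Finset.sum_congr rfl fun i _ => Finset.sum_congr rfl fun l _ => ?_
      rw [hN k j, hT i l j]
      ring
    have c2 : ∑ i, ∑ j, ∑ k, ∑ l, Γ k i l * N j l * T i j k = C := by
      have : ∀ i j, ∑ k, ∑ l, Γ k i l * N j l * T i j k = ∑ l, ∑ k, Γ k i l * N j l * T i j k :=
        fun _ _ => Finset.sum_comm
      simp only [this]
      rw [← Finset.sum_comm_cycle, hC]
      exact Finset.sum_congr rfl fun j _ => Finset.sum_congr rfl fun k _ =>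
        Finset.sum_congr rfl fun i _ => Finset.sum_congr rfl fun l _ => by ring
    simp only [hdN, neg_mul, Finset.sum_mul, add_mul, Finset.sum_neg_distrib,
      Finset.sum_add_distrib]
    rw [c1, c2]
  have e3 : ∑ j, ∑ k, dN j j k * ∑ i, T i i k = -(X + A) := by
    have c1 : ∑ j, ∑ k, ∑ l, Γ j j l * N l k * ∑ i, T i i k = X := by
      rw [hX]
      simp only [Finset.mul_sum]
      refine Finset.sum_congr rfl fun j _ => ?_
      rw [Finset.sum_comm]
      exact Finset.sum_congr rfl fun j _ => Finset.sum_congr rfl fun k _ =>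
        Finset.sum_congr rfl fun i _ => by ring
    have c2 : ∑ j, ∑ k, ∑ l, Γ k j l * N j l * ∑ i, T i i k = A := by
      rw [hA]
      refine Finset.sum_congr rfl fun j _ => ?_
      rw [Finset.sum_comm]
      refine Finset.sum_congr rfl fun k _ => ?_
      simp only [Finset.mul_sum]
      rw [Finset.sum_comm]
      exact Finset.sum_congr rfl fun i _ => Finset.sum_congr rfl fun l _ => by ring
    simp only [hdN, neg_mul, Finset.sum_mul, add_mul, Finset.sum_neg_distrib,
      Finset.sum_add_distrib]
    rw [c1, c2]
  have e4 : ∑ i, (∑ j, ∑ k, (dN i j k * T i j k + N j k * dT i i j k) +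
      ∑ m, Γ i i m * ∑ j, ∑ k, N j k * T m j k) = -(C + C) + D1 + B := by
    simp only [Finset.sum_add_distrib]
    rw [e2]
  have e5 : ∑ j, (∑ k, (dN j j k * ∑ i, T i i k + N j k * ∑ i, dT j i i k) +
      ∑ m, Γ j j m * ∑ k, N m k * ∑ i, T i i k) = -(X + A) + D2 + X := by
    simp only [Finset.sum_add_distrib]
    rw [e3]
  rw [e1, e4, e5]
  ring

theorem IsMetric.contr₁_smooth (h : IsMetric S t G) {T : Fin n → Fin n → Fin n → Eu n → ℝ}
    (hT : ∀ k i j, ContDiffOn ℝ ∞ (T k i j) t) (i : Fin n) :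
    ContDiffOn ℝ ∞ (contr₁ G T i) t :=
  ContDiffOn.sum fun j _ => ContDiffOn.sum fun k _ => (h.inv_smooth j k).mul (hT i j k)

theorem IsMetric.contr₂_smooth (h : IsMetric S t G) {T : Fin n → Fin n → Fin n → Eu n → ℝ}
    (hT : ∀ k i j, ContDiffOn ℝ ∞ (T k i j) t) (i : Fin n) :
    ContDiffOn ℝ ∞ (contr₂ G T i) t :=
  ContDiffOn.sum fun k _ => (h.inv_smooth i k).mul (ContDiffOn.sum fun j _ => hT j j k)

theorem divg_sub (hy : UniqueDiffWithinAt ℝ S y) {X Y : Fin n → Eu n → ℝ}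
    (hX : ∀ k, DifferentiableWithinAt ℝ (X k) S y) (hY : ∀ k, DifferentiableWithinAt ℝ (Y k) S y) :
    divg S G (fun k z => X k z - Y k z) y = divg S G X y - divg S G Y y := by
  simp only [divg, pd_sub hy (hX _) (hY _), mul_sub, Finset.sum_sub_distrib,
    Finset.sum_add_distrib]
  ring

theorem divg_add (hy : UniqueDiffWithinAt ℝ S y) {X Y : Fin n → Eu n → ℝ}
    (hX : ∀ k, DifferentiableWithinAt ℝ (X k) S y) (hY : ∀ k, DifferentiableWithinAt ℝ (Y k) S y) :
    divg S G (fun k z => X k z + Y k z) y = divg S G X y + divg S G Y y := by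
  simp only [divg, pd_add hy (hX _) (hY _), mul_add, Finset.sum_add_distrib]
  ring

/-- All derivatives of `T` in the traced variation of Ricci sit inside a divergence. Against a
weight they can therefore be integrated by parts. -/
theorem IsMetric.palatini (h : IsMetric S t G) (hy : y ∈ t) {T : Fin n → Fin n → Fin n → Eu n → ℝ}
    (hT : ∀ k i j, ContDiffOn ℝ ∞ (T k i j) t) (hsymm : ∀ k i j, T k i j y = T k j i y) :
    ∑ j, ∑ k, (G y)⁻¹ j k * linRicci S G T j k y =
      divg S G (fun i z => contr₁ G T i z - contr₂ G T i z) y := by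
  have hu := h.uniqueDiffWithinAt hy
  have dT : ∀ k i j, DifferentiableWithinAt ℝ (T k i j) S y := fun k i j => h.diff (hT k i j) hy
  have dN : ∀ i j, DifferentiableWithinAt ℝ (fun z => (G z)⁻¹ i j) S y := fun i j =>
    h.diff (h.inv_smooth i j) hy
  have p1 : ∀ i, pd S i (contr₁ G T i) y = ∑ j, ∑ k, (pd S i (fun z => (G z)⁻¹ j k) y * T i j k y +
      (G y)⁻¹ j k * pd S i (T i j k) y) := fun i => by
    unfold contr₁
    rw [pd_sum hu fun j _ => DifferentiableWithinAt.fun_sum fun k _ => (dN j k).fun_mul (dT i j k)]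
    refine Finset.sum_congr rfl fun j _ => ?_
    rw [pd_sum hu fun k _ => (dN j k).fun_mul (dT i j k)]
    exact Finset.sum_congr rfl fun k _ => pd_mul hu (dN j k) (dT i j k) i
  have p2 : ∀ i, pd S i (contr₂ G T i) y = ∑ k, (pd S i (fun z => (G z)⁻¹ i k) y * ∑ j, T j j k y +
      (G y)⁻¹ i k * ∑ j, pd S i (T j j k) y) := fun i => by
    have ds : ∀ k, DifferentiableWithinAt ℝ (fun z => ∑ j, T j j k z) S y := fun k =>
      DifferentiableWithinAt.fun_sum fun j _ => dT j j k
    unfold contr₂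
    rw [pd_sum hu fun k _ => (dN i k).fun_mul (ds k)]
    refine Finset.sum_congr rfl fun k _ => ?_
    rw [pd_mul hu (dN i k) (ds k), pd_sum hu fun j _ => dT j j k]
  rw [divg_sub hu (fun k => h.diff (h.contr₁_smooth hT k) hy)
    (fun k => h.diff (h.contr₂_smooth hT k) hy)]
  simp only [divg, p1, p2]
  exact palatini_algebra (fun i j => (G y)⁻¹ i j) (fun k i j => christoffel S G k i j y)
    (fun k i j => T k i j y) (fun m k i j => pd S m (T k i j) y)
    (fun k i j => pd S k (fun z => (G z)⁻¹ i j) y) (h.inv_symm hy) (h.christoffel_symm hy) hsymm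
    (h.pd_inv_metric hy)

end

section

variable {n : ℕ} {S t : Set (Eu n)} {y : Eu n}

/-! ### The linearization of the Perelman scalar curvature in coordinates -/

/-- The variation of the inverse metric. -/
def linInv (G h : Eu n → Matrix (Fin n) (Fin n) ℝ) (i j : Fin n) (y : Eu n) : ℝ :=
  -((G y)⁻¹ * h y * (G y)⁻¹) i j

/-- The variation of the Christoffel symbols. -/
def linChristoffel (S : Set (Eu n)) (G h : Eu n → Matrix (Fin n) (Fin n) ℝ) (k i j : Fin n)
    (y : Eu n) : ℝ :=
  1 / 2 * ∑ l, (linInv G h k l y *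
    (pd S i (fun z => G z j l) y + pd S j (fun z => G z i l) y - pd S l (fun z => G z i j) y) +
    (G y)⁻¹ k l *
    (pd S i (fun z => h z j l) y + pd S j (fun z => h z i l) y - pd S l (fun z => h z i j) y))

/-- The variation of the scalar curvature. -/
def linScal (S : Set (Eu n)) (G h : Eu n → Matrix (Fin n) (Fin n) ℝ) (y : Eu n) : ℝ :=
  ∑ j, ∑ k, (linInv G h j k y * ricci S G j k y +
    (G y)⁻¹ j k * linRicci S G (linChristoffel S G h) j k y)

/-- The variation of the gradient of `f`, when `f` varies by `ψ`. -/
def linGrad (S : Set (Eu n)) (G h : Eu n → Matrix (Fin n) (Fin n) ℝ) (f ψ : Eu n → ℝ) (k : Fin n)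
    (y : Eu n) : ℝ :=
  ∑ l, (linInv G h k l y * pd S l f y + (G y)⁻¹ k l * pd S l ψ y)

/-- The variation of the Perelman scalar curvature, when `f` varies by `ψ`. -/
def linCoordScal (S : Set (Eu n)) (G h : Eu n → Matrix (Fin n) (Fin n) ℝ) (f ψ : Eu n → ℝ)
    (y : Eu n) : ℝ :=
  linScal S G h y +
    2 * (∑ k, (pd S k (linGrad S G h f ψ k) y +
      ∑ i, (linChristoffel S G h k k i y * grad S G f i y +
        christoffel S G k k i y * linGrad S G h f ψ i y))) -
    ∑ k, (pd S k ψ y * grad S G f k y + pd S k f y * linGrad S G h f ψ k y)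

namespace IsVar

variable {W : Set (ℝ × Eu n)} {G : ℝ → Eu n → Matrix (Fin n) (Fin n) ℝ}
  {h : Eu n → Matrix (Fin n) (Fin n) ℝ} {f : ℝ → Eu n → ℝ} {ψ : Eu n → ℝ}
  (hG : ∀ i j, IsVar W (fun s z => G s z i j) (fun z => h z i j)) (hW : IsOpen W)
  (hS : ∀ p ∈ W, S ∈ nhds p.2) (hd : ∀ p ∈ W, (G p.1 p.2).det ≠ 0)

include hG hW hS hd

theorem christoffel (k i j : Fin n) :
    IsVar W (fun s => Perelman.christoffel S (G s) k i j) (linChristoffel S (G 0) h k i j) := by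
  refine ((const (1 / 2)).mul (sum fun l _ => (inv hG hW hd k l).mul
    ((((hG j l).pd hW hS i).add ((hG i l).pd hW hS j)).sub ((hG i j).pd hW hS l)))).congr hW
    (fun _ _ => rfl) fun z _ => ?_
  simp [linChristoffel, linInv]

theorem ricci (j k : Fin n) : IsVar W (fun s => Perelman.ricci S (G s) j k)
    (linRicci S (G 0) (linChristoffel S (G 0) h) j k) := by
  have c := fun k i j => christoffel hG hW hS hd k i j
  exact sum fun i _ => (((c i j k).pd hW hS i).sub ((c i i k).pd hW hS j)).add
    (sum fun l _ => ((c i i l).mul (c l j k)).sub ((c i j l).mul (c l i k)))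

theorem scal : IsVar W (fun s => Perelman.scal S (G s)) (linScal S (G 0) h) :=
  sum fun j _ => sum fun k _ => (inv hG hW hd j k).mul (ricci hG hW hS hd j k)

theorem grad (hf : IsVar W f ψ) (k : Fin n) :
    IsVar W (fun s => Perelman.grad S (G s) (f s) k) (linGrad S (G 0) h (f 0) ψ k) :=
  sum fun l _ => (inv hG hW hd k l).mul (hf.pd hW hS l)

/-- This certifies `linCoordScal` as a genuine derivative in the parameter. The function `f` varies
together with the metric because a pullback moves both. -/
theorem coordScal (hf : IsVar W f ψ) : IsVar W (fun s => Perelman.coordScal S (G s) (f s))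
    (linCoordScal S (G 0) h (f 0) ψ) := by
  have gr := fun k => grad hG hW hS hd hf k
  refine (((scal hG hW hS hd).add ((const 2).mul (sum (s := Finset.univ) fun k _ => ((gr k).pd hW hS k).add
    (sum (s := Finset.univ) fun i _ => (christoffel hG hW hS hd k k i).mul (gr i))))).sub
    (sum (s := Finset.univ) fun k _ => (hf.pd hW hS k).mul (gr k))).congr hW (fun p hp => ?_) fun z _ => ?_
  · simp only [Perelman.coordScal, gradSq_eq (hd p hp).isUnit]
    rfl
  · simp [linCoordScal]

end IsVar

variable {G h : Eu n → Matrix (Fin n) (Fin n) ℝ} {f ψ : Eu n → ℝ}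

theorem IsMetric.linInv_smooth (hG : IsMetric S t G)
    (hh : ∀ i j, ContDiffOn ℝ ∞ (fun z => h z i j) t) (i j : Fin n) :
    ContDiffOn ℝ ∞ (linInv G h i j) t := by
  unfold linInv
  simp only [Matrix.mul_apply, Finset.sum_mul]
  exact (ContDiffOn.sum fun a _ => ContDiffOn.sum fun b _ =>
    ((hG.inv_smooth _ _).mul (hh _ _)).mul (hG.inv_smooth _ _)).neg

theorem IsMetric.linChristoffel_smooth (hG : IsMetric S t G)
    (hh : ∀ i j, ContDiffOn ℝ ∞ (fun z => h z i j) t) (k i j : Fin n) :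
    ContDiffOn ℝ ∞ (linChristoffel S G h k i j) t := by
  refine contDiffOn_const.mul (ContDiffOn.sum fun l _ => ((hG.linInv_smooth hh k l).mul ?_).add
    ((hG.inv_smooth k l).mul ?_))
  · exact ((hG.pd (hG.smooth j l) i).add (hG.pd (hG.smooth i l) j)).sub (hG.pd (hG.smooth i j) l)
  · exact ((hG.pd (hh j l) i).add (hG.pd (hh i l) j)).sub (hG.pd (hh i j) l)

theorem IsMetric.linChristoffel_symm (hG : IsMetric S t G) (hy : y ∈ t)
    (hh : ∀ z ∈ t, (h z).IsSymm) (k i j : Fin n) :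
    linChristoffel S G h k i j y = linChristoffel S G h k j i y := by
  have h1 : ∀ l, pd S l (fun z => h z i j) y = pd S l (fun z => h z j i) y := fun l =>
    hG.pd_congr (fun z hz => (hh z hz).apply j i) hy l
  simp only [linChristoffel]
  congr 1
  refine Finset.sum_congr rfl fun l _ => ?_
  rw [hG.pd_symm hy l i j, h1]
  ring

theorem IsMetric.linGrad_smooth (hG : IsMetric S t G)
    (hh : ∀ i j, ContDiffOn ℝ ∞ (fun z => h z i j) t) (hf : ContDiffOn ℝ ∞ f t)
    (hψ : ContDiffOn ℝ ∞ ψ t) (k : Fin n) : ContDiffOn ℝ ∞ (linGrad S G h f ψ k) t :=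
  ContDiffOn.sum fun l _ => ((hG.linInv_smooth hh k l).mul (hG.pd hf l)).add
    ((hG.inv_smooth k l).mul (hG.pd hψ l))

theorem linGrad_eq (k : Fin n) :
    linGrad S G h f ψ k y = (∑ l, linInv G h k l y * pd S l f y) + grad S G ψ k y := by
  simp only [linGrad, grad, Finset.sum_add_distrib]

/-- The linearization in divergence form. -/
theorem IsMetric.linCoordScal_eq (hG : IsMetric S t G) (hy : y ∈ t)
    (hh : ∀ i j, ContDiffOn ℝ ∞ (fun z => h z i j) t) (hs : ∀ z ∈ t, (h z).IsSymm)
    (hf : ContDiffOn ℝ ∞ f t) :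
    linCoordScal S G h f (fun _ => 0) y =
      divg S G (fun i z => (contr₁ G (linChristoffel S G h) i z -
        contr₂ G (linChristoffel S G h) i z) + 2 * ∑ l, linInv G h i l z * pd S l f z) y +
      2 * ∑ i, (∑ k, linChristoffel S G h k k i y) * grad S G f i y +
      ∑ j, ∑ k, linInv G h j k y * (ricci S G j k y - pd S j f y * pd S k f y) := by
  have hT := hG.linChristoffel_smooth hh
  have hu := hG.uniqueDiffWithinAt hy
  have hV : ∀ i, ContDiffOn ℝ ∞ (fun z => contr₁ G (linChristoffel S G h) i z -
        contr₂ G (linChristoffel S G h) i z) t := fun i =>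
    (hG.contr₁_smooth hT i).sub (hG.contr₂_smooth hT i)
  have hY : ∀ i, ContDiffOn ℝ ∞ (fun z => ∑ l, linInv G h i l z * pd S l f z) t := fun i =>
    ContDiffOn.sum fun l _ => (hG.linInv_smooth hh i l).mul (hG.pd hf l)
  -- The first divergence is `g⁻¹ · δRic`, by Palatini. The second is the part of `2 δ(Δf)` in which
  -- the gradient varies; the varied connection contributes the trace of `δΓ` against `∇f`.
  rw [divg_add hu (fun i => hG.diff (hV i) hy)
    (fun i => hG.diff (contDiffOn_const.mul (hY i)) hy),
    ← hG.palatini hy hT (hG.linChristoffel_symm hy hs)]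
  have h1 : ∀ k, linGrad S G h f (fun _ => 0) k = fun z => ∑ l, linInv G h k l z * pd S l f z :=
    fun k => by
      ext z
      simp [linGrad_eq, grad]
  have h2 : divg S G (fun i z => 2 * ∑ l, linInv G h i l z * pd S l f z) y =
      2 * divg S G (fun i z => ∑ l, linInv G h i l z * pd S l f z) y := by
    simp only [divg, pd_mul hu (differentiableWithinAt_const _) (hG.diff (hY _) hy), pd_const,
      zero_mul, zero_add, mul_left_comm _ (2 : ℝ), ← Finset.mul_sum, ← mul_add]
  rw [h2]
  simp only [linCoordScal, linScal, h1, divg, pd_const, zero_mul, zero_add, Finset.sum_add_distrib,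
    mul_sub, Finset.sum_sub_distrib, Finset.sum_mul]
  have h3 : ∑ k, ∑ i, linChristoffel S G h k k i y * grad S G f i y =
      ∑ i, ∑ k, linChristoffel S G h k k i y * grad S G f i y := Finset.sum_comm
  have h4 : ∑ k, pd S k f y * ∑ l, linInv G h k l y * pd S l f y =
      ∑ j, ∑ k, linInv G h j k y * (pd S j f y * pd S k f y) := by
    simp only [Finset.mul_sum]
    exact Finset.sum_congr rfl fun _ _ => Finset.sum_congr rfl fun _ _ => by ring
  rw [h3, h4]
  ring

/-- The dependence of the linearization on the variation of `f`. -/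
theorem IsMetric.linCoordScal_add (hG : IsMetric S t G) (hy : y ∈ t)
    (hh : ∀ i j, ContDiffOn ℝ ∞ (fun z => h z i j) t)
    (hf : ContDiffOn ℝ ∞ f t) (hψ : ContDiffOn ℝ ∞ ψ t) :
    linCoordScal S G h f ψ y = linCoordScal S G h f (fun _ => 0) y +
      2 * (lap S G ψ y - ∑ k, grad S G f k y * pd S k ψ y) := by
  have hu := hG.uniqueDiffWithinAt hy
  have h0 : ∀ k, linGrad S G h f (fun _ => 0) k = fun z => ∑ l, linInv G h k l z * pd S l f z :=
    fun k => by
      ext z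
      simp [linGrad_eq, grad]
  have h1 : ∀ k, linGrad S G h f ψ k =
      fun z => linGrad S G h f (fun _ => 0) k z + grad S G ψ k z := fun k => by
    ext z
    rw [linGrad_eq, h0]
  have d0 := fun k => hG.diff (hG.linGrad_smooth hh hf contDiffOn_const (ψ := fun _ => 0) k) hy
  have dψ := fun k => hG.diff (hG.grad_smooth hψ k) hy
  have h2 : ∑ k, pd S k f y * grad S G ψ k y = ∑ k, grad S G f k y * pd S k ψ y := by
    simp only [grad, Finset.mul_sum, Finset.sum_mul]
    rw [Finset.sum_comm]
    exact Finset.sum_congr rfl fun k _ => Finset.sum_congr rfl fun l _ => by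
      rw [hG.inv_symm hy l k]
      ring
  have h3 : ∑ k, pd S k ψ y * grad S G f k y = ∑ k, grad S G f k y * pd S k ψ y :=
    Finset.sum_congr rfl fun k _ => mul_comm _ _
  simp only [linCoordScal, h1, pd_add hu (d0 _) (dψ _), lap, divg, Finset.sum_add_distrib, mul_add,
    pd_const, zero_mul, zero_add]
  rw [h2, h3]
  ring

end

section

set_option synthInstance.maxHeartbeats 400000

variable {n : ℕ} {S t : Set (Eu n)} {y : Eu n} {G : Eu n → Matrix (Fin n) (Fin n) ℝ}

scoped instance (priority := 2000) instNormedAddCommGroupCLM {Y F : Type*} [NormedAddCommGroup Y]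
    [NormedSpace ℝ Y] [NormedAddCommGroup F] [NormedSpace ℝ F] : NormedAddCommGroup (Y →L[ℝ] F) :=
  ContinuousLinearMap.toNormedAddCommGroup

scoped instance (priority := 2000) instNormedAddCommGroupCLM₂ {Y Z F : Type*} [NormedAddCommGroup Y]
    [NormedSpace ℝ Y] [NormedAddCommGroup Z] [NormedSpace ℝ Z] [NormedAddCommGroup F]
    [NormedSpace ℝ F] : NormedAddCommGroup (Z →L[ℝ] Y →L[ℝ] F) :=
  ContinuousLinearMap.toNormedAddCommGroup

theorem contDiffOn_smul_const' {X F : Type*} [NormedAddCommGroup X] [NormedSpace ℝ X]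
    [NormedAddCommGroup F] [NormedSpace ℝ F] {a : X → ℝ} {s : Set X} (ha : ContDiffOn ℝ ∞ a s)
    (c : F) : ContDiffOn ℝ ∞ (fun x => a x • c) s := ha.smul contDiffOn_const

/-! ### Invariant forms of the metric, the connection and the curvature -/

theorem sum_smul_single (v : Eu n) : ∑ k, v k • EuclideanSpace.single k (1 : ℝ) = v := by
  ext i
  simp [Pi.single_apply]

theorem fderiv_eq_sum_pd {F : Eu n → ℝ} (hS : S ∈ nhds y) (v : Eu n) :
    fderiv ℝ F y v = ∑ k, v k * pd S k F y := by
  conv_lhs => rw [← sum_smul_single v]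
  simp [pd_eq_fderiv hS]

/-- The bilinear form with matrix `G`. -/
def metL (G : Eu n → Matrix (Fin n) (Fin n) ℝ) (z : Eu n) : Eu n →L[ℝ] Eu n →L[ℝ] ℝ :=
  ∑ i, ∑ j, G z i j • (EuclideanSpace.proj i : Eu n →L[ℝ] ℝ).smulRight
    (EuclideanSpace.proj j : Eu n →L[ℝ] ℝ)

/-- The Christoffel symbols as a bilinear map. -/
def gamL (S : Set (Eu n)) (G : Eu n → Matrix (Fin n) (Fin n) ℝ) (z : Eu n) :
    Eu n →L[ℝ] Eu n →L[ℝ] Eu n :=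
  ∑ k, ∑ i, ∑ j, christoffel S G k i j z • (EuclideanSpace.proj i : Eu n →L[ℝ] ℝ).smulRight
    ((EuclideanSpace.proj j : Eu n →L[ℝ] ℝ).smulRight (EuclideanSpace.single k (1 : ℝ)))

theorem metL_apply (z v w : Eu n) : metL G z v w = ∑ i, ∑ j, G z i j * (v i * w j) := by
  simp [metL]

theorem gamL_apply (z v w : Eu n) (k : Fin n) :
    gamL S G z v w k = ∑ i, ∑ j, christoffel S G k i j z * (v i * w j) := by
  simp [gamL, Pi.single_apply, Finset.sum_apply]

theorem metL_single (z : Eu n) (i j : Fin n) :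
    metL G z (EuclideanSpace.single i 1) (EuclideanSpace.single j 1) = G z i j := by
  simp [metL_apply]

theorem gamL_single (z : Eu n) (k i j : Fin n) :
    gamL S G z (EuclideanSpace.single i 1) (EuclideanSpace.single j 1) k =
      christoffel S G k i j z := by
  simp [gamL_apply]

theorem IsMetric.metL_symm (h : IsMetric S t G) (hy : y ∈ t) (v w : Eu n) :
    metL G y v w = metL G y w v := by
  rw [metL_apply, metL_apply, Finset.sum_comm]
  refine Finset.sum_congr rfl fun i _ => Finset.sum_congr rfl fun j _ => ?_
  rw [(h.symm y hy).apply i j]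
  ring

theorem IsMetric.gamL_symm (h : IsMetric S t G) (hy : y ∈ t) (v w : Eu n) :
    gamL S G y v w = gamL S G y w v := by
  ext k
  rw [gamL_apply, gamL_apply, Finset.sum_comm]
  refine Finset.sum_congr rfl fun i _ => Finset.sum_congr rfl fun j _ => ?_
  rw [h.christoffel_symm hy k j i]
  ring

theorem IsMetric.eq_zero_of_metL (h : IsMetric S t G) (hy : y ∈ t) {v : Eu n}
    (hv : ∀ w, metL G y v w = 0) : v = 0 := by
  have h1 : Matrix.vecMul v.ofLp (G y) = 0 := by
    ext j
    have := hv (EuclideanSpace.single j 1)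
    simpa [metL_apply, Pi.single_apply, Matrix.vecMul, dotProduct, mul_comm] using this
  have h2 := Matrix.eq_zero_of_vecMul_eq_zero (h.det_ne y hy) h1
  ext i
  exact congrFun h2 i

theorem IsMetric.metL_smooth (h : IsMetric S t G) : ContDiffOn ℝ ∞ (metL G) t :=
  ContDiffOn.sum fun i _ => ContDiffOn.sum fun j _ => contDiffOn_smul_const' (h.smooth i j) _

theorem IsMetric.gamL_smooth (h : IsMetric S t G) : ContDiffOn ℝ ∞ (gamL S G) t :=
  ContDiffOn.sum fun k _ => ContDiffOn.sum fun i _ => ContDiffOn.sum fun j _ =>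
    contDiffOn_smul_const' (h.christoffel_smooth k i j) _

theorem IsMetric.mem_nhds (h : IsMetric S t G) (ht : IsOpen t) (hy : y ∈ t) : S ∈ nhds y :=
  Filter.mem_of_superset (ht.mem_nhds hy) h.sub

theorem hasFDerivAt_apply_const {X Y F : Type*} [NormedAddCommGroup X] [NormedSpace ℝ X]
    [NormedAddCommGroup Y] [NormedSpace ℝ Y] [NormedAddCommGroup F] [NormedSpace ℝ F]
    {B : X → Y →L[ℝ] F} {B' : X →L[ℝ] Y →L[ℝ] F} {x : X} (hB : HasFDerivAt B B' x) (w : Y) :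
    HasFDerivAt (fun z => B z w) (B'.flip w) x := by
  simpa using hB.clm_apply (hasFDerivAt_const w x)

theorem hasFDerivAt_apply_apply {X Y F : Type*} [NormedAddCommGroup X] [NormedSpace ℝ X]
    [NormedAddCommGroup Y] [NormedSpace ℝ Y] [NormedAddCommGroup F] [NormedSpace ℝ F]
    {B : X → Y →L[ℝ] Y →L[ℝ] F} {B' : X →L[ℝ] Y →L[ℝ] Y →L[ℝ] F} {v w : X → Y} {v' w' : X →L[ℝ] Y}
    {x : X} (hB : HasFDerivAt B B' x) (hv : HasFDerivAt v v' x) (hw : HasFDerivAt w w' x) :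
    ∃ L : X →L[ℝ] F, HasFDerivAt (fun z => B z (v z) (w z)) L x ∧
      ∀ u, L u = B' u (v x) (w x) + B x (v' u) (w x) + B x (v x) (w' u) := by
  have h1 := hB.clm_apply hv
  refine ⟨_, h1.clm_apply hw, fun u => ?_⟩
  simp only [add_apply, ContinuousLinearMap.comp_apply,
    ContinuousLinearMap.flip_apply]
  abel

theorem hasFDerivAt_comp_fderiv {X F : Type*} [NormedAddCommGroup X] [NormedSpace ℝ X]
    [NormedAddCommGroup F] [NormedSpace ℝ F] {g : X → F} {φ : X → X} {x : X}
    (hg : DifferentiableAt ℝ g (φ x)) (hφ : DifferentiableAt ℝ φ x) :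
    HasFDerivAt (fun z => g (φ z)) ((fderiv ℝ g (φ x)).comp (fderiv ℝ φ x)) x :=
  hg.hasFDerivAt.comp x hφ.hasFDerivAt

theorem fderiv_apply₂ {X Y F : Type*} [NormedAddCommGroup X] [NormedSpace ℝ X]
    [NormedAddCommGroup Y] [NormedSpace ℝ Y] [NormedAddCommGroup F] [NormedSpace ℝ F]
    {A : X → Y →L[ℝ] Y →L[ℝ] F} {x : X} (hA : DifferentiableAt ℝ A x) (v : X) (w w' : Y) :
    fderiv ℝ A x v w w' = fderiv ℝ (fun z => A z w w') x v := by
  obtain ⟨L, hL, h⟩ := hasFDerivAt_apply_apply hA.hasFDerivAt (hasFDerivAt_const w x)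
    (hasFDerivAt_const w' x)
  rw [hL.fderiv, h]
  simp

theorem fderiv_sum_mul {m : ℕ} {a : Fin m → Fin m → Eu n → ℝ}
    (ha : ∀ i j, DifferentiableAt ℝ (a i j) y) (c : Fin m → Fin m → ℝ) (v : Eu n) :
    fderiv ℝ (fun z => ∑ i, ∑ j, a i j z * c i j) y v =
      ∑ i, ∑ j, fderiv ℝ (a i j) y v * c i j := by
  have h1 : HasFDerivAt (fun z => ∑ i, ∑ j, a i j z * c i j)
      (∑ i, ∑ j, c i j • fderiv ℝ (a i j) y) y :=
    HasFDerivAt.fun_sum fun i _ => HasFDerivAt.fun_sum fun j _ =>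
      (ha i j).hasFDerivAt.mul_const (c i j)
  rw [h1.fderiv]
  simp [mul_comm]

/-- Metric compatibility without indices, in the shape required by `connection_transform`. -/
theorem IsMetric.fderiv_metL (h : IsMetric S t G) (ht : IsOpen t) (hy : y ∈ t) (v w x : Eu n) :
    fderiv ℝ (metL G) y v w x =
      metL G y (gamL S G y v w) x + metL G y w (gamL S G y v x) := by
  have dG : ∀ i j, DifferentiableAt ℝ (fun z => G z i j) y := fun i j =>
    ((h.smooth i j).contDiffAt (ht.mem_nhds hy)).differentiableAt (by simp)
  rw [fderiv_apply₂ ((h.metL_smooth.contDiffAt (ht.mem_nhds hy)).differentiableAt (by simp))]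
  simp only [metL_apply]
  rw [fderiv_sum_mul dG]
  simp only [fderiv_eq_sum_pd (h.mem_nhds ht hy), h.pd_metric hy, gamL_apply,
    Finset.sum_add_distrib, mul_add, add_mul, Finset.mul_sum, Finset.sum_mul]
  congr 1
  · rw [sum_comm_pairs]
    refine Eq.trans ?_ (sum_comm_pairs _).symm
    refine Finset.sum_congr rfl fun k _ => ?_
    rw [Finset.sum_comm]
    exact Finset.sum_congr rfl fun i _ => Finset.sum_congr rfl fun l _ =>
      Finset.sum_congr rfl fun j _ => by ring
  · refine Finset.sum_congr rfl fun i _ => ?_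
    rw [Finset.sum_comm_cycle]
    refine Finset.sum_congr rfl fun l _ => ?_
    rw [Finset.sum_comm]
    exact Finset.sum_congr rfl fun k _ => Finset.sum_congr rfl fun j _ => by ring

theorem IsMetric.fderiv_gamL (h : IsMetric S t G) (ht : IsOpen t) (hy : y ∈ t) (m i j k : Fin n) :
    fderiv ℝ (gamL S G) y (EuclideanSpace.single m 1) (EuclideanSpace.single i 1)
      (EuclideanSpace.single j 1) k = pd S m (christoffel S G k i j) y := by
  have d1 : ContDiffAt ℝ ∞ (gamL S G) y := h.gamL_smooth.contDiffAt (ht.mem_nhds hy)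
  rw [fderiv_apply₂ (d1.differentiableAt (by simp)), pd_eq_fderiv (h.mem_nhds ht hy)]
  have d2 : DifferentiableAt ℝ (fun z => gamL S G z (EuclideanSpace.single i 1)
      (EuclideanSpace.single j 1)) y :=
    ((d1.clm_apply contDiffAt_const).clm_apply contDiffAt_const).differentiableAt (by simp)
  have h3 := ((EuclideanSpace.proj k : Eu n →L[ℝ] ℝ).hasFDerivAt.comp y d2.hasFDerivAt).fderiv
  have h4 : (EuclideanSpace.proj k : Eu n →L[ℝ] ℝ) ∘ (fun z => gamL S G z
      (EuclideanSpace.single i 1) (EuclideanSpace.single j 1)) = christoffel S G k i j := by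
    ext z
    exact gamL_single z k i j
  rw [h4] at h3
  rw [h3]
  rfl

/-- The curvature of a connection form `A`. -/
def curv {X : Type*} [NormedAddCommGroup X] [NormedSpace ℝ X] (A : X → X →L[ℝ] X →L[ℝ] X)
    (z x v w : X) : X :=
  fderiv ℝ A z x v w - fderiv ℝ A z v x w + A z x (A z v w) - A z v (A z x w)

/-- Exhibits Ricci as the trace of `x ↦ R(x, eⱼ) eₖ`, so that its invariance becomes invariance of
the trace under conjugation. -/
theorem IsMetric.ricci_eq (h : IsMetric S t G) (ht : IsOpen t) (hy : y ∈ t) (j k : Fin n) :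
    ricci S G j k y = ∑ i, curv (gamL S G) y (EuclideanSpace.single i 1)
      (EuclideanSpace.single j 1) (EuclideanSpace.single k 1) i := by
  refine Finset.sum_congr rfl fun i _ => ?_
  have h1 : ∀ a v, gamL S G y (EuclideanSpace.single a 1) v i =
      ∑ l, christoffel S G i a l y * v l := fun a v => by
    simp [gamL_apply]
  simp only [curv, PiLp.sub_apply, PiLp.add_apply, h.fderiv_gamL ht hy, h1, gamL_single]
  rw [Finset.sum_sub_distrib]
  ring

/-! ### Abstract transformation laws -/



variable {X : Type*} [NormedAddCommGroup X] [NormedSpace ℝ X] {U U' : Set X}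
  {g g' : X → X →L[ℝ] X →L[ℝ] ℝ} {A A' : X → X →L[ℝ] X →L[ℝ] X} {φ : X → X}

end

section

set_option synthInstance.maxHeartbeats 400000

variable {X : Type*} [NormedAddCommGroup X] [NormedSpace ℝ X] {U U' : Set X}
  {g g' : X → X →L[ℝ] X →L[ℝ] ℝ} {A A' : X → X →L[ℝ] X →L[ℝ] X} {φ : X → X}

set_option maxHeartbeats 1000000 in
set_option maxHeartbeats 1000000 in
/-- The transformation law of the Levi-Civita connection. -/
theorem connection_transform (hU : IsOpen U) (hU' : IsOpen U') (hφ : ContDiffOn ℝ ∞ φ U)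
    (hmap : MapsTo φ U U') (hg' : ContDiffOn ℝ ∞ g' U')
    (hs' : ∀ z ∈ U', ∀ v w, g' z v w = g' z w v)
    (hnd : ∀ z ∈ U', ∀ v, (∀ w, g' z v w = 0) → v = 0)
    (hA : ∀ z ∈ U, ∀ v w, A z v w = A z w v) (hA' : ∀ z ∈ U', ∀ v w, A' z v w = A' z w v)
    (hc : ∀ z ∈ U, ∀ v w x, fderiv ℝ g z v w x = g z (A z v w) x + g z w (A z v x))
    (hc' : ∀ z ∈ U', ∀ v w x, fderiv ℝ g' z v w x = g' z (A' z v w) x + g' z w (A' z v x))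
    (hgd : DifferentiableOn ℝ g U)
    (hiso : ∀ z ∈ U, ∀ v w, g z v w = g' (φ z) (fderiv ℝ φ z v) (fderiv ℝ φ z w))
    (hsurj : ∀ z ∈ U, Function.Surjective (fderiv ℝ φ z)) {z : X} (hz : z ∈ U) (v w : X) :
    fderiv ℝ φ z (A z v w) =
      A' (φ z) (fderiv ℝ φ z v) (fderiv ℝ φ z w) + fderiv ℝ (fderiv ℝ φ) z v w := by
  have hzn := hU.mem_nhds hz
  have dφ : HasFDerivAt φ (fderiv ℝ φ z) z :=
    ((hφ.contDiffAt hzn).differentiableAt (by simp)).hasFDerivAt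
  have dφ2 : HasFDerivAt (fderiv ℝ φ) (fderiv ℝ (fderiv ℝ φ) z) z :=
    (((hφ.fderiv_of_isOpen hU (m := ∞) (by simp)).contDiffAt hzn).differentiableAt
      (by simp)).hasFDerivAt
  have hsym : ∀ v w, fderiv ℝ (fderiv ℝ φ) z v w = fderiv ℝ (fderiv ℝ φ) z w v := fun v w =>
    (hφ.contDiffAt hzn).isSymmSndFDerivAt
      (by simpa using (WithTop.coe_le_coe.2 (le_top : (2 : ℕ∞) ≤ ⊤))) v w
  have dg' : HasFDerivAt g' (fderiv ℝ g' (φ z)) (φ z) :=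
    ((hg'.contDiffAt (hU'.mem_nhds (hmap hz))).differentiableAt (by simp)).hasFDerivAt
  have key : ∀ v w x, fderiv ℝ g z v w x =
      fderiv ℝ g' (φ z) (fderiv ℝ φ z v) (fderiv ℝ φ z w) (fderiv ℝ φ z x) +
      g' (φ z) (fderiv ℝ (fderiv ℝ φ) z v w) (fderiv ℝ φ z x) +
      g' (φ z) (fderiv ℝ φ z w) (fderiv ℝ (fderiv ℝ φ) z v x) := fun v w x => by
    rw [fderiv_apply₂ (hgd.differentiableAt hzn)]
    have he : (fun y => g y w x) =ᶠ[nhds z]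
        fun y => g' (φ y) (fderiv ℝ φ y w) (fderiv ℝ φ y x) := by
      filter_upwards [hzn] with y hy using hiso y hy w x
    have dgφ : HasFDerivAt (fun y => g' (φ y)) ((fderiv ℝ g' (φ z)).comp (fderiv ℝ φ z)) z :=
      hasFDerivAt_comp_fderiv (F := X →L[ℝ] X →L[ℝ] ℝ) (g := g') dg'.differentiableAt dφ.differentiableAt
    obtain ⟨L, hL, h⟩ := hasFDerivAt_apply_apply dgφ
      (hasFDerivAt_apply_const dφ2 w) (hasFDerivAt_apply_const dφ2 x)
    rw [he.fderiv_eq, hL.fderiv, h]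
    simp only [ContinuousLinearMap.comp_apply, ContinuousLinearMap.flip_apply]
  have hΨ := hiso z hz
  set Φ := fderiv ℝ φ z with hΦ
  set H := fderiv ℝ (fderiv ℝ φ) z with hH
  -- `C` is the defect in the claimed law. Torsion-freeness of both connections makes it symmetric
  -- in its arguments. Compatibility with both metrics makes `g'(C(v, w), Φ x)` antisymmetric in `w`
  -- and `x`.
  let C : X → X → X := fun v w => Φ (A z v w) - A' (φ z) (Φ v) (Φ w) - H v w
  have Csymm : ∀ v w, C v w = C w v := fun v w => by
    simp only [C]
    rw [hA z hz v w, hA' _ (hmap hz) (Φ v) (Φ w), hsym v w]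
  have Canti : ∀ v w x, g' (φ z) (C v w) (Φ x) = -g' (φ z) (C v x) (Φ w) := fun v w x => by
    have h1 := key v w x
    rw [hc z hz, hc' _ (hmap hz), hΨ, hΨ] at h1
    rw [hs' _ (hmap hz) (C v x)]
    simp only [C, map_sub, sub_apply]
    linarith
  -- Symmetry in the first pair of slots and antisymmetry in the last pair force a trilinear form to
  -- vanish, as in the uniqueness of the Levi-Civita connection.
  have C0 : ∀ x, g' (φ z) (C v w) (Φ x) = 0 := fun x => by
    have e1 := Canti v w x
    have e2 := Canti x v w
    have e3 := Canti w x v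
    rw [Csymm x v] at e2
    rw [Csymm w x] at e3
    rw [Csymm w v] at e3
    linarith
  have : C v w = 0 := hnd _ (hmap hz) _ fun u => by
    obtain ⟨x, rfl⟩ := hsurj z hz u
    exact C0 x
  simp only [C] at this
  rw [sub_sub, sub_eq_zero] at this
  exact this

set_option maxHeartbeats 1000000 in
/-- The transformation law of the curvature. -/
theorem curv_transform (hU : IsOpen U) (hU' : IsOpen U') (hφ : ContDiffOn ℝ ∞ φ U)
    (hmap : MapsTo φ U U') (hAs : ContDiffOn ℝ ∞ A U) (hAs' : ContDiffOn ℝ ∞ A' U')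
    (hlaw : ∀ z ∈ U, ∀ v w, fderiv ℝ φ z (A z v w) =
      A' (φ z) (fderiv ℝ φ z v) (fderiv ℝ φ z w) + fderiv ℝ (fderiv ℝ φ) z v w)
    {z : X} (hz : z ∈ U) (x v w : X) :
    fderiv ℝ φ z (curv A z x v w) =
      curv A' (φ z) (fderiv ℝ φ z x) (fderiv ℝ φ z v) (fderiv ℝ φ z w) := by
  have hzn := hU.mem_nhds hz
  have dφ : HasFDerivAt φ (fderiv ℝ φ z) z :=
    ((hφ.contDiffAt hzn).differentiableAt (by simp)).hasFDerivAt
  have sφ : ContDiffOn ℝ ∞ (fderiv ℝ φ) U := hφ.fderiv_of_isOpen hU (by simp)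
  have dφ2 : HasFDerivAt (fderiv ℝ φ) (fderiv ℝ (fderiv ℝ φ) z) z :=
    ((sφ.contDiffAt hzn).differentiableAt (by simp)).hasFDerivAt
  have dφ3 : HasFDerivAt (fderiv ℝ (fderiv ℝ φ)) (fderiv ℝ (fderiv ℝ (fderiv ℝ φ)) z) z :=
    (((sφ.fderiv_of_isOpen hU (m := ∞) (by simp)).contDiffAt hzn).differentiableAt
      (by simp)).hasFDerivAt
  have hsym : ∀ v w, fderiv ℝ (fderiv ℝ φ) z v w = fderiv ℝ (fderiv ℝ φ) z w v := fun v w =>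
    (hφ.contDiffAt hzn).isSymmSndFDerivAt
      (by simpa using (WithTop.coe_le_coe.2 (le_top : (2 : ℕ∞) ≤ ⊤))) v w
  have hsym3 : fderiv ℝ (fderiv ℝ (fderiv ℝ φ)) z x v = fderiv ℝ (fderiv ℝ (fderiv ℝ φ)) z v x :=
    (sφ.contDiffAt hzn).isSymmSndFDerivAt
      (by simpa using (WithTop.coe_le_coe.2 (le_top : (2 : ℕ∞) ≤ ⊤))) x v
  have dA : HasFDerivAt A (fderiv ℝ A z) z :=
    ((hAs.contDiffAt hzn).differentiableAt (by simp)).hasFDerivAt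
  have dA' : HasFDerivAt A' (fderiv ℝ A' (φ z)) (φ z) :=
    ((hAs'.contDiffAt (hU'.mem_nhds (hmap hz))).differentiableAt (by simp)).hasFDerivAt
  -- The derivative of the connection law in direction `x`. Exchanging `x` and `v` and subtracting
  -- removes the third derivative of `φ` by symmetry; the law itself, applied to the quadratic
  -- terms, absorbs the remaining second derivatives.
  have key : ∀ x v w, fderiv ℝ (fderiv ℝ φ) z x (A z v w) + fderiv ℝ φ z (fderiv ℝ A z x v w) =
      fderiv ℝ A' (φ z) (fderiv ℝ φ z x) (fderiv ℝ φ z v) (fderiv ℝ φ z w) +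
      A' (φ z) (fderiv ℝ (fderiv ℝ φ) z x v) (fderiv ℝ φ z w) +
      A' (φ z) (fderiv ℝ φ z v) (fderiv ℝ (fderiv ℝ φ) z x w) +
      fderiv ℝ (fderiv ℝ (fderiv ℝ φ)) z x v w := fun x v w => by
    have he : (fun y => fderiv ℝ φ y (A y v w)) =ᶠ[nhds z] fun y =>
        A' (φ y) (fderiv ℝ φ y v) (fderiv ℝ φ y w) + fderiv ℝ (fderiv ℝ φ) y v w := by
      filter_upwards [hzn] with y hy using hlaw y hy v w
    have dAφ : HasFDerivAt (fun y => A' (φ y)) ((fderiv ℝ A' (φ z)).comp (fderiv ℝ φ z)) z :=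
      hasFDerivAt_comp_fderiv (F := X →L[ℝ] X →L[ℝ] X) (g := A') dA'.differentiableAt dφ.differentiableAt
    obtain ⟨L, hL, h⟩ := hasFDerivAt_apply_apply dAφ
      (hasFDerivAt_apply_const dφ2 v) (hasFDerivAt_apply_const dφ2 w)
    obtain ⟨L₁, hL₁, h₁⟩ := hasFDerivAt_apply_apply dA (hasFDerivAt_const v z)
      (hasFDerivAt_const w z)
    obtain ⟨L₂, hL₂, h₂⟩ := hasFDerivAt_apply_apply dφ3 (hasFDerivAt_const v z)
      (hasFDerivAt_const w z)
    have h3 := DFunLike.congr_fun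
      ((dφ2.clm_apply hL₁).fderiv.symm.trans (he.fderiv_eq.trans (hL.add hL₂).fderiv)) x
    simp only [add_apply, h, h₁, h₂, ContinuousLinearMap.comp_apply,
      ContinuousLinearMap.flip_apply, zero_apply, map_zero,
      add_zero] at h3
    rw [add_comm, h3]
  have k1 := key x v w
  have k2 := key v x w
  have l1 := hlaw z hz x (A z v w)
  have l2 := hlaw z hz v (A z x w)
  rw [hlaw z hz v w] at l1
  rw [hlaw z hz x w] at l2
  simp only [curv, map_sub, map_add]
  rw [eq_sub_of_add_eq' k1, eq_sub_of_add_eq' k2, l1, l2, map_add, map_add, hsym v x, hsym3]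
  abel

end

section

variable {n : ℕ} {S U U' : Set (Eu n)} {y : Eu n} {G G' : Eu n → Matrix (Fin n) (Fin n) ℝ}
  {φ : Eu n → Eu n}

/-! ### Invariance under isometries -/

theorem trace_eq_sum_single (F : Eu n →ₗ[ℝ] Eu n) :
    LinearMap.trace ℝ (Eu n) F = ∑ i, F (EuclideanSpace.single i 1) i := by
  rw [LinearMap.trace_eq_matrix_trace ℝ (EuclideanSpace.basisFun (Fin n) ℝ).toBasis,
    Matrix.trace]
  simp [LinearMap.toMatrix_apply]

/-- The sum is a trace, and traces are invariant under conjugation. Ricci and the divergence are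
both handled by this. -/
theorem sum_single_conj (Φ : Eu n ≃ₗ[ℝ] Eu n) (F F' : Eu n →ₗ[ℝ] Eu n)
    (h : ∀ x, Φ (F x) = F' (Φ x)) :
    ∑ i, F (EuclideanSpace.single i 1) i = ∑ i, F' (EuclideanSpace.single i 1) i := by
  rw [← trace_eq_sum_single, ← trace_eq_sum_single]
  have : F' = Φ.conj F := by
    ext x : 1
    rw [LinearEquiv.conj_apply_apply, h, LinearEquiv.apply_symm_apply]
  rw [this, LinearMap.trace_conj']

/-- `φ` is an isometry from the open set `U` with metric `G` to the open set `U'` with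
metric `G'`. -/
structure IsIsom (S U U' : Set (Eu n)) (G G' : Eu n → Matrix (Fin n) (Fin n) ℝ)
    (φ : Eu n → Eu n) : Prop where
  metric : IsMetric S U G
  metric' : IsMetric S U' G'
  isOpen : IsOpen U
  isOpen' : IsOpen U'
  smooth : ContDiffOn ℝ ∞ φ U
  mapsTo : MapsTo φ U U'
  iso : ∀ z ∈ U, ∀ v w, metL G z v w = metL G' (φ z) (fderiv ℝ φ z v) (fderiv ℝ φ z w)

/-- The linear map `x ↦ R(x, v) w`. -/
def curvLin (A : Eu n → Eu n →L[ℝ] Eu n →L[ℝ] Eu n) (z v w : Eu n) : Eu n →ₗ[ℝ] Eu n where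
  toFun x := curv A z x v w
  map_add' x x' := by
    simp only [curv, map_add, add_apply]
    abel
  map_smul' c x := by
    simp only [curv, map_smul, smul_apply, RingHom.id_apply, smul_add, smul_sub]

/-- The Ricci form of a connection form. -/
def ricForm (A : Eu n → Eu n →L[ℝ] Eu n →L[ℝ] Eu n) (z : Eu n) : Eu n →ₗ[ℝ] Eu n →ₗ[ℝ] ℝ :=
  LinearMap.mk₂ ℝ (fun v w => ∑ i, curv A z (EuclideanSpace.single i 1) v w i)
    (fun v v' w => by
      rw [← Finset.sum_add_distrib]
      refine Finset.sum_congr rfl fun i _ => ?_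
      simp only [curv, map_add, add_apply, PiLp.add_apply, PiLp.sub_apply]
      ring)
    (fun c v w => by
      rw [smul_eq_mul, Finset.mul_sum]
      refine Finset.sum_congr rfl fun i _ => ?_
      simp only [curv, map_smul, smul_apply, PiLp.add_apply, PiLp.sub_apply, PiLp.smul_apply,
        smul_eq_mul]
      ring)
    (fun v w w' => by
      rw [← Finset.sum_add_distrib]
      refine Finset.sum_congr rfl fun i _ => ?_
      simp only [curv, map_add, PiLp.add_apply, PiLp.sub_apply]
      ring)
    (fun c v w => by
      rw [smul_eq_mul, Finset.mul_sum]
      refine Finset.sum_congr rfl fun i _ => ?_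
      simp only [curv, map_smul, PiLp.add_apply, PiLp.sub_apply, PiLp.smul_apply, smul_eq_mul]
      ring)

theorem bilin_apply_eq_sum (B : Eu n →ₗ[ℝ] Eu n →ₗ[ℝ] ℝ) (v w : Eu n) :
    B v w = ∑ a, ∑ b, v a * B (EuclideanSpace.single a 1) (EuclideanSpace.single b 1) * w b := by
  conv_lhs => rw [← sum_smul_single v, ← sum_smul_single w]
  simp only [map_sum, map_smul, LinearMap.sum_apply, LinearMap.smul_apply, smul_eq_mul,
    Finset.mul_sum]
  rw [Finset.sum_comm]
  exact Finset.sum_congr rfl fun a _ => Finset.sum_congr rfl fun b _ => by ring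

/-- The vector field with components `X`. -/
def vec (X : Fin n → Eu n → ℝ) (z : Eu n) : Eu n := WithLp.toLp 2 fun k => X k z

theorem contDiffOn_vec {X : Fin n → Eu n → ℝ} (hX : ∀ k, ContDiffOn ℝ ∞ (X k) U) :
    ContDiffOn ℝ ∞ (vec X) U :=
  contDiffOn_piLp 2 |>.2 fun k => hX k

/-- Writes the divergence as the trace of the covariant derivative `v ↦ DX(v) + Γ(v, X)`. -/
theorem divg_eq (hS : S ∈ nhds y) {X : Fin n → Eu n → ℝ} (hX : DifferentiableAt ℝ (vec X) y) :
    divg S G X y = ∑ k, ((fderiv ℝ (vec X) y : Eu n →ₗ[ℝ] Eu n) +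
      ((gamL S G y).flip (vec X y) : Eu n →ₗ[ℝ] Eu n)) (EuclideanSpace.single k 1) k := by
  refine Finset.sum_congr rfl fun k _ => ?_
  have h1 := ((EuclideanSpace.proj k : Eu n →L[ℝ] ℝ).hasFDerivAt.comp y hX.hasFDerivAt).fderiv
  have h2 : (EuclideanSpace.proj k : Eu n →L[ℝ] ℝ) ∘ vec X = X k := rfl
  rw [h2] at h1
  rw [pd_eq_fderiv hS, h1]
  simp [gamL_apply, vec]

theorem metL_grad (h : IsMetric S U G) (hU : IsOpen U) (hy : y ∈ U) (u : Eu n → ℝ) (w : Eu n) :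
    metL G y (vec (grad S G u) y) w = fderiv ℝ u y w := by
  rw [h.metL_symm hy, fderiv_eq_sum_pd (h.mem_nhds hU hy), metL_apply]
  refine Finset.sum_congr rfl fun i _ => ?_
  rw [← lower_grad (h.isUnit hy), Finset.mul_sum]
  exact Finset.sum_congr rfl fun j _ => by simp only [vec]; ring

namespace IsIsom

/-- Nondegeneracy of the source metric already makes the differential injective, so `IsIsom` need
not assume that `φ` is a diffeomorphism. -/
theorem injective (h : IsIsom S U U' G G' φ) (hy : y ∈ U) :
    Function.Injective (fderiv ℝ φ y) := by
  rw [injective_iff_map_eq_zero]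
  intro v hv
  refine h.metric.eq_zero_of_metL hy fun w => ?_
  rw [h.iso y hy, hv, map_zero, zero_apply]

/-- The differential of an isometry. -/
def equiv (h : IsIsom S U U' G G' φ) (hy : y ∈ U) : Eu n ≃ₗ[ℝ] Eu n :=
  LinearEquiv.ofInjectiveEndo (fderiv ℝ φ y : Eu n →ₗ[ℝ] Eu n) (h.injective hy)

theorem equiv_apply (h : IsIsom S U U' G G' φ) (hy : y ∈ U) (v : Eu n) :
    h.equiv hy v = fderiv ℝ φ y v := rfl

theorem surjective (h : IsIsom S U U' G G' φ) (hy : y ∈ U) :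
    Function.Surjective (fderiv ℝ φ y) := (h.equiv hy).surjective

theorem gamL_law (h : IsIsom S U U' G G' φ) {z : Eu n} (hz : z ∈ U) (v w : Eu n) :
    fderiv ℝ φ z (gamL S G z v w) =
      gamL S G' (φ z) (fderiv ℝ φ z v) (fderiv ℝ φ z w) + fderiv ℝ (fderiv ℝ φ) z v w :=
  connection_transform h.isOpen h.isOpen' h.smooth h.mapsTo h.metric'.metL_smooth
    (fun _ hz => h.metric'.metL_symm hz) (fun _ hz _ => h.metric'.eq_zero_of_metL hz)
    (fun _ hz => h.metric.gamL_symm hz) (fun _ hz => h.metric'.gamL_symm hz)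
    (fun _ hz => h.metric.fderiv_metL h.isOpen hz)
    (fun _ hz => h.metric'.fderiv_metL h.isOpen' hz)
    (h.metric.metL_smooth.differentiableOn (by simp)) h.iso (fun _ hz => h.surjective hz) hz v w

theorem curv_law (h : IsIsom S U U' G G' φ) {z : Eu n} (hz : z ∈ U) (x v w : Eu n) :
    fderiv ℝ φ z (curv (gamL S G) z x v w) =
      curv (gamL S G') (φ z) (fderiv ℝ φ z x) (fderiv ℝ φ z v) (fderiv ℝ φ z w) :=
  curv_transform h.isOpen h.isOpen' h.smooth h.mapsTo h.metric.gamL_smooth h.metric'.gamL_smooth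
    (fun _ hz => h.gamL_law hz) hz x v w

theorem ricForm_law (h : IsIsom S U U' G G' φ) (hy : y ∈ U) (v w : Eu n) :
    ricForm (gamL S G) y v w = ricForm (gamL S G') (φ y) (fderiv ℝ φ y v) (fderiv ℝ φ y w) :=
  sum_single_conj (h.equiv hy) (curvLin (gamL S G) y v w)
    (curvLin (gamL S G') (φ y) (fderiv ℝ φ y v) (fderiv ℝ φ y w)) fun x => h.curv_law hy x v w

theorem scal_eq (h : IsIsom S U U' G G' φ) (hy : y ∈ U) : scal S G y = scal S G' (φ y) := by
  -- With the Jacobian `J`, both the metric and Ricci transform by the congruence `Jᵀ · J`. In the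
  -- trace of `G⁻¹ Ric` the factors `J` cancel.
  let J : Matrix (Fin n) (Fin n) ℝ := Matrix.of fun a j => fderiv ℝ φ y (EuclideanSpace.single j 1) a
  let R : Matrix (Fin n) (Fin n) ℝ := Matrix.of fun j k => ricci S G j k y
  let R' : Matrix (Fin n) (Fin n) ℝ := Matrix.of fun j k => ricci S G' j k (φ y)
  have hR : R = J.transpose * R' * J := by
    ext j k
    have h1 : R j k = ricForm (gamL S G) y (EuclideanSpace.single j 1)
      (EuclideanSpace.single k 1) := h.metric.ricci_eq h.isOpen hy j k
    have h2 : ∀ a b, R' a b = ricForm (gamL S G') (φ y) (EuclideanSpace.single a 1)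
      (EuclideanSpace.single b 1) := h.metric'.ricci_eq h.isOpen' (h.mapsTo hy)
    rw [h1, h.ricForm_law hy, bilin_apply_eq_sum]
    simp only [← h2, Matrix.mul_apply, Matrix.transpose_apply, Finset.sum_mul, J, Matrix.of_apply]
    exact Finset.sum_comm
  have hG : G y = J.transpose * G' (φ y) * J := by
    ext j k
    rw [← metL_single (G := G), h.iso y hy, metL_apply]
    simp only [Matrix.mul_apply, Matrix.transpose_apply, Finset.sum_mul, J, Matrix.of_apply]
    rw [Finset.sum_comm]
    exact Finset.sum_congr rfl fun a _ => Finset.sum_congr rfl fun b _ => by ring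
  have hJ : IsUnit J.det := by
    have h1 := h.metric.det_ne y hy
    rw [hG, Matrix.det_mul] at h1
    exact (right_ne_zero_of_mul h1).isUnit
  have hs : scal S G y = ((G y)⁻¹ * R.transpose).trace := by
    simp [Matrix.trace, Matrix.mul_apply, R, scal]
  have hs' : scal S G' (φ y) = ((G' (φ y))⁻¹ * R'.transpose).trace := by
    simp [Matrix.trace, Matrix.mul_apply, R', scal]
  have hJt : IsUnit J.transpose.det := by rwa [Matrix.det_transpose]
  rw [hs, hs', hR, hG, Matrix.mul_inv_rev, Matrix.mul_inv_rev, Matrix.transpose_mul,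
    Matrix.transpose_mul, Matrix.transpose_transpose, Matrix.trace_mul_comm]
  have e1 : J.transpose * (R'.transpose * J) * (J⁻¹ * ((G' (φ y))⁻¹ * J.transpose⁻¹)) =
      J.transpose * (R'.transpose * (G' (φ y))⁻¹ * J.transpose⁻¹) := by
    simp only [Matrix.mul_assoc]
    rw [← Matrix.mul_assoc J J⁻¹, Matrix.mul_nonsing_inv _ hJ, Matrix.one_mul]
  rw [e1, Matrix.trace_mul_comm, Matrix.mul_assoc, Matrix.nonsing_inv_mul _ hJt, Matrix.mul_one,
    Matrix.trace_mul_comm]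

/-- Differentiate `X' ∘ φ = dφ X`. The term `D²φ(v, X)` cancels against the inhomogeneous term of
`gamL_law`, so `dφ` intertwines the two covariant derivatives and their traces agree. -/
theorem divg_eq (h : IsIsom S U U' G G' φ) (hy : y ∈ U) {X X' : Fin n → Eu n → ℝ}
    (hX : ∀ k, ContDiffOn ℝ ∞ (X k) U) (hX' : ∀ k, ContDiffOn ℝ ∞ (X' k) U')
    (hXX' : ∀ z ∈ U, vec X' (φ z) = fderiv ℝ φ z (vec X z)) :
    divg S G X y = divg S G' X' (φ y) := by
  have hyn := h.isOpen.mem_nhds hy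
  have dX : DifferentiableAt ℝ (vec X) y :=
    ((contDiffOn_vec hX).contDiffAt hyn).differentiableAt (by simp)
  have dX' : DifferentiableAt ℝ (vec X') (φ y) :=
    ((contDiffOn_vec hX').contDiffAt (h.isOpen'.mem_nhds (h.mapsTo hy))).differentiableAt (by simp)
  have dφ : DifferentiableAt ℝ φ y := (h.smooth.contDiffAt hyn).differentiableAt (by simp)
  have dφ2 : DifferentiableAt ℝ (fderiv ℝ φ) y :=
    ((h.smooth.fderiv_of_isOpen h.isOpen (m := ∞) (by simp)).contDiffAt hyn).differentiableAt
      (by simp)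
  rw [Perelman.divg_eq (h.metric.mem_nhds h.isOpen hy) dX,
    Perelman.divg_eq (h.metric'.mem_nhds h.isOpen' (h.mapsTo hy)) dX']
  refine sum_single_conj (h.equiv hy) _ _ fun v => ?_
  have he : (fun z => vec X' (φ z)) =ᶠ[nhds y] fun z => fderiv ℝ φ z (vec X z) := by
    filter_upwards [hyn] with z hz using hXX' z hz
  have h1 := DFunLike.congr_fun ((hasFDerivAt_comp_fderiv dX' dφ).fderiv.symm.trans
    (he.fderiv_eq.trans (dφ2.hasFDerivAt.clm_apply dX.hasFDerivAt).fderiv)) v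
  simp only [ContinuousLinearMap.comp_apply, add_apply, ContinuousLinearMap.flip_apply] at h1
  simp only [equiv_apply, LinearMap.add_apply, ContinuousLinearMap.coe_coe,
    ContinuousLinearMap.flip_apply, map_add]
  rw [h.gamL_law hy, h1, hXX' y hy]
  abel

variable {f f' u u' : Eu n → ℝ}

/-- Both sides have the same pairing with every `dφ w`, namely `du(w)`. Since `dφ` is surjective,
nondegeneracy concludes. -/
theorem grad_eq (h : IsIsom S U U' G G' φ) (hu' : ContDiffOn ℝ ∞ u' U')
    (huu' : ∀ z ∈ U, u z = u' (φ z)) {z : Eu n} (hz : z ∈ U) :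
    vec (grad S G' u') (φ z) = fderiv ℝ φ z (vec (grad S G u) z) := by
  have hzn := h.isOpen.mem_nhds hz
  rw [← sub_eq_zero]
  refine h.metric'.eq_zero_of_metL (h.mapsTo hz) fun w => ?_
  obtain ⟨w, rfl⟩ := h.surjective hz w
  have he : u =ᶠ[nhds z] fun z => u' (φ z) := by
    filter_upwards [hzn] with z hz using huu' z hz
  rw [map_sub, sub_apply, metL_grad h.metric' h.isOpen' (h.mapsTo hz), ← h.iso z hz,
    metL_grad h.metric h.isOpen hz, he.fderiv_eq,
    (hasFDerivAt_comp_fderiv ((hu'.contDiffAt (h.isOpen'.mem_nhds (h.mapsTo hz))).differentiableAt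
      (by simp)) ((h.smooth.contDiffAt hzn).differentiableAt (by simp))).fderiv]
  simp

theorem smooth_comp (h : IsIsom S U U' G G' φ) (hu' : ContDiffOn ℝ ∞ u' U')
    (huu' : ∀ z ∈ U, u z = u' (φ z)) : ContDiffOn ℝ ∞ u U :=
  (hu'.comp h.smooth h.mapsTo).congr huu'

theorem coordScal_eq (h : IsIsom S U U' G G' φ) (hf' : ContDiffOn ℝ ∞ f' U')
    (hff' : ∀ z ∈ U, f z = f' (φ z)) (hy : y ∈ U) :
    coordScal S G f y = coordScal S G' f' (φ y) := by
  have hyn := h.isOpen.mem_nhds hy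
  have hf := h.smooth_comp hf' hff'
  have h1 : lap S G f y = lap S G' f' (φ y) :=
    h.divg_eq hy (h.metric.grad_smooth hf) (h.metric'.grad_smooth hf')
      fun z hz => h.grad_eq hf' hff' hz
  have h2 : gradSq S G f y = gradSq S G' f' (φ y) := by
    have e : ∀ (G : Eu n → Matrix (Fin n) (Fin n) ℝ) f (z : Eu n), S ∈ nhds z →
        IsUnit (G z).det → gradSq S G f z = fderiv ℝ f z (vec (grad S G f) z) := fun G f z hz hu => by
      rw [gradSq_eq hu, fderiv_eq_sum_pd hz]
      exact Finset.sum_congr rfl fun k _ => mul_comm _ _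
    rw [e _ _ _ (h.metric.mem_nhds h.isOpen hy) (h.metric.isUnit hy),
      e _ _ _ (h.metric'.mem_nhds h.isOpen' (h.mapsTo hy)) (h.metric'.isUnit (h.mapsTo hy)),
      h.grad_eq hf' hff' hy]
    have he : f =ᶠ[nhds y] fun z => f' (φ z) := by
      filter_upwards [hyn] with z hz using hff' z hz
    rw [he.fderiv_eq, (hasFDerivAt_comp_fderiv
      ((hf'.contDiffAt (h.isOpen'.mem_nhds (h.mapsTo hy))).differentiableAt (by simp))
      ((h.smooth.contDiffAt hyn).differentiableAt (by simp))).fderiv]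
    rw [ContinuousLinearMap.comp_apply]
  rw [coordScal, coordScal, h.scal_eq hy, h1, h2]

theorem driftLap_eq (h : IsIsom S U U' G G' φ) (hf' : ContDiffOn ℝ ∞ f' U')
    (hff' : ∀ z ∈ U, f z = f' (φ z)) (hu' : ContDiffOn ℝ ∞ u' U')
    (huu' : ∀ z ∈ U, u z = u' (φ z)) (hy : y ∈ U) :
    driftLap S G f u y = driftLap S G' f' u' (φ y) := by
  have hf := h.smooth_comp hf' hff'
  have hu := h.smooth_comp hu' huu'
  rw [driftLap, driftLap, hff' y hy]
  congr 1
  refine h.divg_eq hy (fun k => hf.neg.exp.mul (h.metric.grad_smooth hu k))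
    (fun k => hf'.neg.exp.mul (h.metric'.grad_smooth hu' k)) fun z hz => ?_
  have e : ∀ (c : ℝ) (Y : Fin n → ℝ), WithLp.toLp 2 (fun k => c * Y k) = c • WithLp.toLp 2 Y :=
    fun _ _ => rfl
  have h1 := h.grad_eq hu' huu' hz
  simp only [vec] at h1 ⊢
  rw [e, e, map_smul, ← h1, hff' z hz]

end IsIsom

end

section

variable {n : ℕ} {S U K : Set (Eu n)} {y : Eu n}

/-! ### Integration by parts and the fundamental lemma -/

section Vanishing

variable {F : Eu n → ℝ} (hU : IsOpen U) (hK : IsCompact K) (hKU : K ⊆ U)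

include hU hK hKU

/-- Extension by zero: near a point outside the compact set `K` the extension is identically zero,
so no smoothness is lost at the boundary of `U`. -/
theorem contDiff_indicator (hF : ContDiffOn ℝ ∞ F U) (h0 : ∀ z ∈ U, z ∉ K → F z = 0) :
    ContDiff ℝ ∞ (U.indicator F) := by
  rw [contDiff_iff_contDiffAt]
  intro z
  by_cases hz : z ∈ K
  · have hzn := hU.mem_nhds (hKU hz)
    refine (hF.contDiffAt hzn).congr_of_eventuallyEq ?_
    filter_upwards [hzn] with w hw using indicator_of_mem hw F
  · refine (contDiffAt_const (c := (0 : ℝ))).congr_of_eventuallyEq ?_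
    filter_upwards [hK.isClosed.isOpen_compl.mem_nhds hz] with w hw
    by_cases hwU : w ∈ U
    · rw [indicator_of_mem hwU, h0 w hwU hw]
    · exact indicator_of_notMem hwU F

theorem integrableOn_of_vanish (hF : ContinuousOn F U) (h0 : ∀ z ∈ U, z ∉ K → F z = 0) :
    IntegrableOn F U :=
  ((hF.mono hKU).integrableOn_compact hK).of_forall_sdiff_eq_zero hU.measurableSet
    fun z hz => h0 z hz.1 hz.2

theorem integral_pd_eq_zero (hUS : U ⊆ S) (hF : ContDiffOn ℝ ∞ F U)
    (h0 : ∀ z ∈ U, z ∉ K → F z = 0) (j : Fin n) : ∫ z in U, pd S j F z = 0 := by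
  have hg := contDiff_indicator hU hK hKU hF h0
  have hsupp : ∀ z, z ∉ K → U.indicator F z = 0 := fun z hz => by
    by_cases hzU : z ∈ U
    · rw [indicator_of_mem hzU, h0 z hzU hz]
    · exact indicator_of_notMem hzU F
  have hcs : HasCompactSupport (U.indicator F) := HasCompactSupport.intro hK hsupp
  have hd : ∀ z, z ∉ U → fderiv ℝ (U.indicator F) z (EuclideanSpace.single j 1) = 0 :=
    fun z hz => by
      have : U.indicator F =ᶠ[nhds z] fun _ => 0 := by
        filter_upwards [hK.isClosed.isOpen_compl.mem_nhds fun h => hz (hKU h)] with w hw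
        exact hsupp w hw
      rw [this.fderiv_eq]
      simp
  have hdc : HasCompactSupport fun z => fderiv ℝ (U.indicator F) z (EuclideanSpace.single j 1) :=
    (hcs.fderiv (𝕜 := ℝ)).comp_left (g := fun L : Eu n →L[ℝ] ℝ => L (EuclideanSpace.single j 1))
      (by simp)
  have hcont : Continuous fun z => fderiv ℝ (U.indicator F) z (EuclideanSpace.single j 1) :=
    (hg.continuous_fderiv (by simp)).clm_apply continuous_const
  -- Integration by parts against the constant function `1`.
  have h1 := integral_mul_fderiv_eq_neg_fderiv_mul_of_integrable (μ := (volume : Measure (Eu n)))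
    (f := fun _ => (1 : ℝ)) (g := U.indicator F) (v := EuclideanSpace.single j 1) (by simp)
    (by simpa using hcont.integrable_of_hasCompactSupport hdc)
    (by simpa using hg.continuous.integrable_of_hasCompactSupport hcs)
    (fun _ _ => by fun_prop) (fun z _ => hg.differentiable (by simp) z)
  simp only [one_mul, fderiv_fun_const, Pi.zero_apply, zero_apply, zero_mul, integral_zero,
    neg_zero] at h1
  rw [← h1, ← setIntegral_eq_integral_of_forall_compl_eq_zero (s := U) hd]
  refine setIntegral_congr_fun hU.measurableSet fun z hz => ?_
  have hzn := hU.mem_nhds hz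
  have : F =ᶠ[nhds z] U.indicator F := by
    filter_upwards [hzn] with w hw using (indicator_of_mem hw F).symm
  rw [pd_eq_fderiv (Filter.mem_of_superset hzn hUS), this.fderiv_eq]

theorem integral_mul_pd (hS : UniqueDiffOn ℝ S) (hUS : U ⊆ S) {q : Eu n → ℝ}
    (hq : ContDiffOn ℝ ∞ q U) (hF : ContDiffOn ℝ ∞ F U)
    (h0 : ∀ z ∈ U, z ∉ K → F z = 0) (j : Fin n) :
    ∫ z in U, q z * pd S j F z = -∫ z in U, pd S j q z * F z := by
  have hr := RelOpen.of_isOpen hS hU hUS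
  have h1 := integral_pd_eq_zero hU hK hKU hUS (hq.mul hF)
    (fun z hz hzK => by simp [h0 z hz hzK]) j
  have hd0 : ∀ z ∈ U, z ∉ K → pd S j F z = 0 := fun z hz hzK => by
    have : F =ᶠ[nhds z] fun _ => 0 := by
      filter_upwards [hK.isClosed.isOpen_compl.mem_nhds hzK, hU.mem_nhds hz] with w hw hwU
      exact h0 w hwU hw
    rw [pd_eq_fderiv (Filter.mem_of_superset (hU.mem_nhds hz) hUS), this.fderiv_eq]
    simp
  have i1 : IntegrableOn (fun z => pd S j q z * F z) U := integrableOn_of_vanish hU hK hKU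
    ((hr.pd hq j).continuousOn.mul hF.continuousOn) fun z hz hzK => by simp [h0 z hz hzK]
  have i2 : IntegrableOn (fun z => q z * pd S j F z) U := integrableOn_of_vanish hU hK hKU
    (hq.continuousOn.mul (hr.pd hF j).continuousOn) fun z hz hzK => by simp [hd0 z hz hzK]
  have h2 : ∫ z in U, pd S j (fun z => q z * F z) z =
      ∫ z in U, (pd S j q z * F z + q z * pd S j F z) :=
    setIntegral_congr_fun hU.measurableSet fun z hz =>
      pd_mul (hr.uniqueDiffWithinAt hz) (hr.diff hq hz) (hr.diff hF hz) j
  have h3 : ∫ z in U, pd S j (fun z => q z * F z) z = 0 := h1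
  rw [h2, integral_add i1 i2] at h3
  linarith

end Vanishing

/-- `η` is a test function on `U`. -/
structure IsTest (U : Set (Eu n)) (η : Eu n → ℝ) : Prop where
  smooth : ContDiff ℝ ∞ η
  compact : HasCompactSupport η
  sub : tsupport η ⊆ U

theorem IsTest.eq_zero {η : Eu n → ℝ} {z : Eu n} (hz : z ∉ tsupport η) : η z = 0 :=
  image_eq_zero_of_notMem_tsupport hz

theorem IsTest.pd_eq_zero {η : Eu n → ℝ} (hU : IsOpen U) (hUS : U ⊆ S)
    {z : Eu n} (hzU : z ∈ U) (hz : z ∉ tsupport η) (j : Fin n) : pd S j η z = 0 := by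
  rw [pd_eq_fderiv (Filter.mem_of_superset (hU.mem_nhds hzU) hUS),
    (notMem_tsupport_iff_eventuallyEq.1 hz).fderiv_eq]
  simp

/-- The fundamental lemma of the calculus of variations, first order version. -/
theorem eq_sum_pd_of_integral_eq_zero (hS : UniqueDiffOn ℝ S) (hU : IsOpen U) (hUS : U ⊆ S)
    {p : Eu n → ℝ} {q : Fin n → Eu n → ℝ} (hp : ContDiffOn ℝ ∞ p U)
    (hq : ∀ j, ContDiffOn ℝ ∞ (q j) U)
    (h : ∀ η, IsTest U η → ∫ z in U, (p z * η z + ∑ j, q j z * pd S j η z) = 0) :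
    EqOn p (fun z => ∑ j, pd S j (q j) z) U := by
  have hr := RelOpen.of_isOpen hS hU hUS
  have hc : ContinuousOn (fun z => p z - ∑ j, pd S j (q j) z) U :=
    hp.continuousOn.sub (continuousOn_finsetSum _ fun j _ => (hr.pd (hq j) j).continuousOn)
  have h1 : ∀ᵐ z, z ∈ U → p z - ∑ j, pd S j (q j) z = 0 := by
    refine hU.ae_eq_zero_of_integral_contDiff_smul_eq_zero (hc.locallyIntegrableOn
      hU.measurableSet) fun η h1 h2 h3 => ?_
    have hη : IsTest U η := ⟨h1, h2, h3⟩
    rw [← setIntegral_eq_integral_of_forall_compl_eq_zero (s := U) fun z hz => by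
      rw [IsTest.eq_zero fun h => hz (h3 h), zero_smul]]
    have i0 : IntegrableOn (fun z => p z * η z) U := integrableOn_of_vanish hU h2 h3
      (hp.continuousOn.mul h1.continuous.continuousOn) fun z _ hz => by
        rw [IsTest.eq_zero hz, mul_zero]
    have i1 : ∀ j, IntegrableOn (fun z => pd S j (q j) z * η z) U := fun j =>
      integrableOn_of_vanish hU h2 h3 ((hr.pd (hq j) j).continuousOn.mul
        h1.continuous.continuousOn) fun z _ hz => by rw [IsTest.eq_zero hz, mul_zero]
    have i2 : ∀ j, IntegrableOn (fun z => q j z * pd S j η z) U := fun j =>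
      integrableOn_of_vanish hU h2 h3 ((hq j).continuousOn.mul
        (hr.pd h1.contDiffOn j).continuousOn) fun z hzU hz => by
          rw [IsTest.pd_eq_zero hU hUS hzU hz, mul_zero]
    have h4 := h η hη
    rw [integral_add i0 (integrable_finsetSum _ fun j _ => i2 j),
      integral_finsetSum _ fun j _ => i2 j] at h4
    simp only [integral_mul_pd hU h2 h3 hS hUS (hq _) h1.contDiffOn
      (fun z _ hz => IsTest.eq_zero hz)] at h4
    have h5 : ∀ z, η z • (p z - ∑ j, pd S j (q j) z) =
        p z * η z - ∑ j, pd S j (q j) z * η z := fun z => by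
      rw [smul_eq_mul, mul_sub, Finset.mul_sum]
      congr 1
      · ring
      · exact Finset.sum_congr rfl fun j _ => mul_comm _ _
    simp only [h5]
    rw [integral_sub i0 (integrable_finsetSum _ fun j _ => i1 j),
      integral_finsetSum _ fun j _ => i1 j]
    simpa [Finset.sum_neg_distrib, sub_eq_add_neg] using h4
  -- The fundamental lemma gives the identity almost everywhere; continuity upgrades it to every
  -- point of `U`.
  have h2 := Measure.eqOn_open_of_ae_eq (μ := volume) (f := fun z => p z - ∑ j, pd S j (q j) z)
    (g := fun _ => 0) ((ae_restrict_iff' hU.measurableSet).2 h1) hU hc continuousOn_const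
  intro z hz
  have := h2 hz
  simp only at this ⊢
  linarith

/-! ### Interior points are dense -/

/-- A relatively open subset of a set with dense interior. -/
theorem RelOpen.isOpen_inter_interior {t : Set (Eu n)} (h : RelOpen S t) :
    IsOpen (t ∩ interior S) := by
  rw [isOpen_iff_mem_nhds]
  intro z hz
  have h1 := h.nhds z hz.1
  rw [nhdsWithin_eq_nhds.2 (mem_interior_iff_mem_nhds.1 hz.2)] at h1
  exact Filter.inter_mem h1 (isOpen_interior.mem_nhds hz.2)

theorem RelOpen.subset_closure {t : Set (Eu n)} (h : RelOpen S t)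
    (hS : S ⊆ closure (interior S)) : t ⊆ closure (t ∩ interior S) := by
  intro z hz
  rw [mem_closure_iff_nhds]
  intro V hV
  obtain ⟨O, hO, hOt⟩ := mem_nhdsWithin_iff_exists_mem_nhds_inter.1 (h.nhds z hz)
  obtain ⟨w, hw, hwS⟩ := mem_closure_iff_nhds.1 (hS (h.sub hz)) _ (Filter.inter_mem hV hO)
  exact ⟨w, hw.1, hOt ⟨hw.2, interior_subset hwS⟩, hwS⟩

/-- The device by which every identity tested or computed at interior points is carried to boundary
points. -/
theorem RelOpen.eqOn {t : Set (Eu n)} (h : RelOpen S t) (hS : S ⊆ closure (interior S))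
    {F F' : Eu n → ℝ} (hF : ContinuousOn F t) (hF' : ContinuousOn F' t)
    (hFF' : EqOn F F' (t ∩ interior S)) : EqOn F F' t :=
  hFF'.of_subset_closure hF hF' inter_subset_left (h.subset_closure hS)

theorem RelOpen.pd_comm {t : Set (Eu n)} (h : RelOpen S t) (hS : S ⊆ closure (interior S))
    {F : Eu n → ℝ} (hF : ContDiffOn ℝ ∞ F t) (i j : Fin n) :
    EqOn (Perelman.pd S i (Perelman.pd S j F)) (Perelman.pd S j (Perelman.pd S i F)) t := by
  refine h.eqOn hS (h.pd (h.pd hF j) i).continuousOn (h.pd (h.pd hF i) j).continuousOn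
    fun z hz => ?_
  have hU := h.isOpen_inter_interior
  have hzn := hU.mem_nhds hz
  have hF' : ContDiffAt ℝ ∞ F z := (hF.mono inter_subset_left).contDiffAt hzn
  have hsym := hF'.isSymmSndFDerivAt
      (by simpa using (WithTop.coe_le_coe.2 (le_top : (2 : ℕ∞) ≤ ⊤)))
  have key : ∀ i j, Perelman.pd S i (Perelman.pd S j F) z =
      fderiv ℝ (fderiv ℝ F) z (EuclideanSpace.single i 1) (EuclideanSpace.single j 1) :=
    fun i j => by
      have he : Perelman.pd S j F =ᶠ[_root_.nhds z] fun w => fderiv ℝ F w (EuclideanSpace.single j 1) := by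
        filter_upwards [hzn] with w hw
        exact pd_eq_fderiv (mem_interior_iff_mem_nhds.1 hw.2) j
      have hd : DifferentiableAt ℝ (fderiv ℝ F) z :=
        (hF'.fderiv_right (m := ∞) (by simp)).differentiableAt (by simp)
      rw [pd_eq_fderiv (mem_interior_iff_mem_nhds.1 hz.2), he.fderiv_eq,
        (hasFDerivAt_apply_const hd.hasFDerivAt _).fderiv]
      rfl
  rw [key, key]
  exact hsym _ _

end

section

variable {n : ℕ} {S U t : Set (Eu n)} {y : Eu n} {G h s : Eu n → Matrix (Fin n) (Fin n) ℝ}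
  {f v η : Eu n → ℝ}

/-! ### The linearization in direction `η s` -/

/-- The trace `gᵃᵇ sₐᵦ`. -/
def trG (G s : Eu n → Matrix (Fin n) (Fin n) ℝ) (y : Eu n) : ℝ := ∑ a, ∑ b, (G y)⁻¹ a b * s y a b

/-- The principal coefficients of the adjoint of the linearization. -/
def symb (G s : Eu n → Matrix (Fin n) (Fin n) ℝ) (i j : Fin n) (y : Eu n) : ℝ :=
  -linInv G s i j y - trG G s y * (G y)⁻¹ i j

/-- The first order coefficients. -/
def symb₁ (S : Set (Eu n)) (G s : Eu n → Matrix (Fin n) (Fin n) ℝ) (f : Eu n → ℝ) (i : Fin n)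
    (y : Eu n) : ℝ :=
  (contr₁ G (linChristoffel S G s) i y - contr₂ G (linChristoffel S G s) i y) +
    2 * ∑ l, linInv G s i l y * pd S l f y

/-- The zeroth order coefficient. -/
def symb₀ (S : Set (Eu n)) (G s : Eu n → Matrix (Fin n) (Fin n) ℝ) (f : Eu n → ℝ) (y : Eu n) : ℝ :=
  2 * ∑ i, (∑ k, linChristoffel S G s k k i y) * grad S G f i y +
      ∑ j, ∑ k, linInv G s j k y * (ricci S G j k y - pd S j f y * pd S k f y)

theorem linInv_eq (i j : Fin n) :
    linInv G s i j y = -∑ a, ∑ b, (G y)⁻¹ i a * s y a b * (G y)⁻¹ b j := by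
  simp only [linInv, Matrix.mul_apply, Finset.sum_mul]
  rw [Finset.sum_comm]

theorem linInv_smul (hh : h y = η y • s y) (i j : Fin n) :
    linInv G h i j y = η y * linInv G s i j y := by
  simp [linInv, hh]

/-- For `h = η s`, the part of `δΓ` containing `e = dη` is `½ g^{il}(s_{kl} eⱼ + s_{jl} eₖ - s_{jk}
e_l)`. Contracted with `g^{jk}`, the first two terms coincide and give `s` with raised indices
applied to `e`; the third gives minus half the trace. -/
theorem contr_smul_algebra (N s : Fin n → Fin n → ℝ) (e : Fin n → ℝ) (hN : ∀ i j, N i j = N j i)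
    (hs : ∀ i j, s i j = s j i) (i : Fin n) :
    (∑ j, ∑ k, N j k * (1 / 2 * ∑ l, N i l * (s k l * e j + s j l * e k - s j k * e l))) =
      (∑ j, (∑ a, ∑ b, N i a * s a b * N b j) * e j) -
        1 / 2 * ((∑ a, ∑ b, N a b * s a b) * ∑ j, N i j * e j) := by
  have h1 : ∀ j k, N j k * (1 / 2 * ∑ l, N i l * (s k l * e j + s j l * e k - s j k * e l)) =
      1 / 2 * ∑ l, N j k * N i l * s k l * e j + 1 / 2 * ∑ l, N j k * N i l * s j l * e k -
        1 / 2 * (N j k * s j k * ∑ l, N i l * e l) := fun j k => by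
    simp only [Finset.mul_sum, ← Finset.sum_add_distrib, ← Finset.sum_sub_distrib]
    exact Finset.sum_congr rfl fun l _ => by ring
  simp only [h1, Finset.sum_add_distrib, Finset.sum_sub_distrib]
  have h2 : ∑ j, ∑ k, 1 / 2 * ∑ l, N j k * N i l * s j l * e k =
      ∑ j, ∑ k, 1 / 2 * ∑ l, N j k * N i l * s k l * e j := by
    rw [Finset.sum_comm]
    exact Finset.sum_congr rfl fun j _ => Finset.sum_congr rfl fun k _ => by rw [hN k j]
  have h3 : ∑ j, ∑ k, 1 / 2 * ∑ l, N j k * N i l * s k l * e j =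
      1 / 2 * ∑ j, (∑ a, ∑ b, N i a * s a b * N b j) * e j := by
    simp only [Finset.mul_sum, Finset.sum_mul]
    refine Finset.sum_congr rfl fun j _ => ?_
    rw [Finset.sum_comm]
    refine Finset.sum_congr rfl fun a _ => Finset.sum_congr rfl fun b _ => ?_
    rw [hN j b, hs b a]
    ring
  rw [h2, h3]
  simp only [← Finset.mul_sum, ← Finset.sum_mul]
  ring

/-- In the other contraction of the same expression, the first and third terms cancel by symmetry
and only the trace term survives. -/
theorem contr_smul_algebra' (N s : Fin n → Fin n → ℝ) (e : Fin n → ℝ) (hN : ∀ i j, N i j = N j i)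
    (hs : ∀ i j, s i j = s j i) (k : Fin n) :
    (∑ j, 1 / 2 * ∑ l, N j l * (s k l * e j + s j l * e k - s j k * e l)) =
      1 / 2 * (∑ a, ∑ b, N a b * s a b) * e k := by
  have h2 : ∑ j, ∑ l, N j l * s j k * e l = ∑ j, ∑ l, N j l * s k l * e j := by
    rw [Finset.sum_comm]
    exact Finset.sum_congr rfl fun j _ => Finset.sum_congr rfl fun l _ => by
      rw [hN l j, hs l k]
  simp only [mul_add, mul_sub, Finset.sum_add_distrib, Finset.sum_sub_distrib, ← Finset.mul_sum,
    ← mul_assoc]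
  rw [h2]
  simp only [← Finset.sum_mul]
  ring

section Smul

variable (hG : IsMetric S t G) (hy : y ∈ t) (hη : ContDiffOn ℝ ∞ η t)
  (hs : ∀ i j, ContDiffOn ℝ ∞ (fun z => s z i j) t) (hss : ∀ z ∈ t, (s z).IsSymm)
  (hh : ∀ z ∈ t, h z = η z • s z)

include hG hy hη hs hh

theorem IsMetric.linChristoffel_smul (k i j : Fin n) :
    linChristoffel S G h k i j y = η y * linChristoffel S G s k i j y +
      1 / 2 * ∑ l, (G y)⁻¹ k l * (s y j l * pd S i η y + s y i l * pd S j η y -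
        s y i j * pd S l η y) := by
  have h1 : ∀ k i j, pd S k (fun z => h z i j) y =
      pd S k η y * s y i j + η y * pd S k (fun z => s z i j) y := fun k i j => by
    rw [← pd_mul (hG.uniqueDiffWithinAt hy) (hG.diff hη hy) (hG.diff (hs i j) hy)]
    exact hG.pd_congr (fun z hz => by simp [hh z hz]) hy k
  simp only [linChristoffel, linInv_smul (hh y hy), h1, Finset.mul_sum]
  rw [← Finset.sum_add_distrib]
  exact Finset.sum_congr rfl fun l _ => by ring

include hss

theorem IsMetric.sum_linChristoffel_smul (i : Fin n) :
    ∑ k, linChristoffel S G h k k i y = η y * ∑ k, linChristoffel S G s k k i y +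
      1 / 2 * trG G s y * pd S i η y := by
  simp only [hG.linChristoffel_smul hy hη hs hh, Finset.sum_add_distrib, ← Finset.mul_sum]
  congr 1
  rw [Finset.mul_sum]
  exact contr_smul_algebra' (fun a b => (G y)⁻¹ a b) (fun a b => s y a b) (fun l => pd S l η y)
    (hG.inv_symm hy) (fun i j => (hss y hy).apply j i) i

/-- Each of the two contractions contributes half of the trace term in `symb`; their difference
produces it with coefficient `-1`. -/
theorem IsMetric.contr_smul (i : Fin n) :
    contr₁ G (linChristoffel S G h) i y - contr₂ G (linChristoffel S G h) i y =
      η y * (contr₁ G (linChristoffel S G s) i y - contr₂ G (linChristoffel S G s) i y) +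
        ∑ j, symb G s i j y * pd S j η y := by
  have e2 : contr₂ G (linChristoffel S G h) i y = η y * contr₂ G (linChristoffel S G s) i y +
      1 / 2 * (trG G s y * ∑ k, (G y)⁻¹ i k * pd S k η y) := by
    simp only [contr₂, hG.sum_linChristoffel_smul hy hη hs hss hh, Finset.mul_sum,
      ← Finset.sum_add_distrib]
    exact Finset.sum_congr rfl fun k _ => by
      rw [mul_add, Finset.mul_sum]
      congr 1
      · exact Finset.sum_congr rfl fun _ _ => by ring
      · ring
  have e1 : contr₁ G (linChristoffel S G h) i y = η y * contr₁ G (linChristoffel S G s) i y +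
      ((∑ j, -linInv G s i j y * pd S j η y) -
        1 / 2 * (trG G s y * ∑ k, (G y)⁻¹ i k * pd S k η y)) := by
    simp only [linInv_eq, neg_neg, trG]
    have h1 := contr_smul_algebra (fun a b => (G y)⁻¹ a b) (fun a b => s y a b)
      (fun l => pd S l η y) (hG.inv_symm hy) (fun i j => (hss y hy).apply j i) i
    rw [← h1]
    simp only [contr₁, hG.linChristoffel_smul hy hη hs hh, mul_add, Finset.sum_add_distrib]
    congr 1
    simp only [Finset.mul_sum]
    exact Finset.sum_congr rfl fun k _ => Finset.sum_congr rfl fun j _ => by ring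
  rw [e1, e2]
  simp only [symb, sub_mul, Finset.sum_sub_distrib, mul_assoc, ← Finset.mul_sum]
  ring

end Smul

section Smooth

variable (hG : IsMetric S t G) (hs : ∀ i j, ContDiffOn ℝ ∞ (fun z => s z i j) t)

include hG hs

theorem IsMetric.trG_smooth : ContDiffOn ℝ ∞ (trG G s) t :=
  ContDiffOn.sum fun a _ => ContDiffOn.sum fun b _ => (hG.inv_smooth a b).mul (hs a b)

theorem IsMetric.symb_smooth (i j : Fin n) : ContDiffOn ℝ ∞ (symb G s i j) t :=
  (hG.linInv_smooth hs i j).neg.sub ((hG.trG_smooth hs).mul (hG.inv_smooth i j))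

theorem IsMetric.symb₁_smooth (hf : ContDiffOn ℝ ∞ f t) (i : Fin n) :
    ContDiffOn ℝ ∞ (symb₁ S G s f i) t :=
  ((hG.contr₁_smooth (hG.linChristoffel_smooth hs) i).sub
    (hG.contr₂_smooth (hG.linChristoffel_smooth hs) i)).add
    (contDiffOn_const.mul (ContDiffOn.sum fun l _ => (hG.linInv_smooth hs i l).mul (hG.pd hf l)))

theorem IsMetric.symb₀_smooth (hf : ContDiffOn ℝ ∞ f t) : ContDiffOn ℝ ∞ (symb₀ S G s f) t :=
  (contDiffOn_const.mul (ContDiffOn.sum fun i _ =>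
    (ContDiffOn.sum fun k _ => hG.linChristoffel_smooth hs k k i).mul (hG.grad_smooth hf i))).add
    (ContDiffOn.sum fun j _ => ContDiffOn.sum fun k _ => (hG.linInv_smooth hs j k).mul
      ((hG.ricci_smooth j k).sub ((hG.pd hf j).mul (hG.pd hf k))))

end Smooth

/-- Separates `η` from `dη`. Integrated against `v`, only the divergence hides second derivatives of
`η`, and one integration by parts leaves a functional of first order in `η`. -/
theorem IsMetric.linCoordScal_smul (hG : IsMetric S t G) (hy : y ∈ t) (hη : ContDiffOn ℝ ∞ η t)
    (hs : ∀ i j, ContDiffOn ℝ ∞ (fun z => s z i j) t) (hss : ∀ z ∈ t, (s z).IsSymm)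
    (hh : ∀ z ∈ t, h z = η z • s z) (hf : ContDiffOn ℝ ∞ f t) :
    linCoordScal S G h f (fun _ => 0) y =
      divg S G (fun i z => η z * symb₁ S G s f i z + ∑ j, symb G s i j z * pd S j η z) y +
      (η y * symb₀ S G s f y + ∑ j, trG G s y * grad S G f j y * pd S j η y) := by
  have hhs : ∀ i j, ContDiffOn ℝ ∞ (fun z => h z i j) t := fun i j =>
    (hη.mul (hs i j)).congr fun z hz => by simp [hh z hz]
  have hhss : ∀ z ∈ t, (h z).IsSymm := fun z hz => by
    rw [hh z hz]
    exact (hss z hz).smul _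
  rw [hG.linCoordScal_eq hy hhs hhss hf, add_assoc]
  congr 1
  · refine Finset.sum_congr rfl fun k _ => ?_
    have h1 : ∀ i, ∀ z ∈ t, (contr₁ G (linChristoffel S G h) i z -
        contr₂ G (linChristoffel S G h) i z) + 2 * ∑ l, linInv G h i l z * pd S l f z =
        η z * symb₁ S G s f i z + ∑ j, symb G s i j z * pd S j η z := fun i z hz => by
      simp only [hG.contr_smul hz hη hs hss hh, linInv_smul (hh z hz), symb₁, mul_assoc,
        ← Finset.mul_sum]
      ring
    rw [hG.pd_congr (h1 k) hy k]
    simp only [h1 _ y hy]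
  · simp only [hG.sum_linChristoffel_smul hy hη hs hss hh, linInv_smul (hh y hy), symb₀, mul_assoc,
      ← Finset.mul_sum, add_mul, Finset.sum_add_distrib]
    have : ∑ j, grad S G f j y * pd S j η y = ∑ j, pd S j η y * grad S G f j y :=
      Finset.sum_congr rfl fun _ _ => mul_comm _ _
    rw [this]
    ring

end

section

variable {n : ℕ} {S t : Set (Eu n)} {y : Eu n} {G s : Eu n → Matrix (Fin n) (Fin n) ℝ}
  {f v : Eu n → ℝ}

/-! ### The adjoint equation in coordinates -/

/-- `v` is annihilated by the adjoint of the linearization, tested in the interior. -/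
structure IsKer (S t : Set (Eu n)) (G : Eu n → Matrix (Fin n) (Fin n) ℝ) (f v : Eu n → ℝ) :
    Prop extends IsMetric S t G where
  pos : ∀ z ∈ t, 0 < (G z).det
  dense : S ⊆ closure (interior S)
  smooth_f : ContDiffOn ℝ ∞ f t
  smooth_v : ContDiffOn ℝ ∞ v t
  weak : ∀ k : Eu n → Matrix (Fin n) (Fin n) ℝ, (∀ i j, ContDiff ℝ ∞ fun z => k z i j) →
    (∀ z, (k z).IsSymm) → (∃ K, IsCompact K ∧ K ⊆ t ∩ interior S ∧ ∀ z, z ∉ K → k z = 0) →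
    ∫ z in t ∩ interior S, v z * linCoordScal S G k f (fun _ => 0) z * √(G z).det = 0

namespace IsKer

/-- The adjoint equation, tested with tensors of the form `η s`. -/
theorem adjoint_eq (h : IsKer S t G f v) (hs : ∀ i j, ContDiffOn ℝ ∞ (fun z => s z i j) t)
    (hss : ∀ z ∈ t, (s z).IsSymm) :
    EqOn (fun z => √(G z).det * (v z * symb₀ S G s f z -
        ∑ i, Perelman.pd S i v z * symb₁ S G s f i z))
      (fun z => ∑ j, Perelman.pd S j (fun z => √(G z).det * (v z * (trG G s z * grad S G f j z) -
        ∑ i, Perelman.pd S i v z * symb G s i j z)) z) t := by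
  have hq : ∀ j, ContDiffOn ℝ ∞ (fun z => √(G z).det * (v z * (trG G s z * grad S G f j z) -
      ∑ i, Perelman.pd S i v z * symb G s i j z)) t := fun j =>
    (h.sqrt_det_smooth h.pos).mul ((h.smooth_v.mul ((h.trG_smooth hs).mul
      (h.grad_smooth h.smooth_f j))).sub (ContDiffOn.sum fun i _ => (h.pd h.smooth_v i).mul
        (h.symb_smooth hs i j)))
  have hp : ContDiffOn ℝ ∞ (fun z => √(G z).det * (v z * symb₀ S G s f z -
        ∑ i, Perelman.pd S i v z * symb₁ S G s f i z)) t :=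
    (h.sqrt_det_smooth h.pos).mul ((h.smooth_v.mul (h.symb₀_smooth hs h.smooth_f)).sub
      (ContDiffOn.sum fun i _ => (h.pd h.smooth_v i).mul (h.symb₁_smooth hs h.smooth_f i)))
  -- Both sides are continuous up to the boundary, so the equation need only be derived where test
  -- functions are available.
  refine h.toRelOpen.eqOn h.dense hp.continuousOn
    (continuousOn_finsetSum _ fun j _ => (h.pd (hq j) j).continuousOn) ?_
  set U := t ∩ interior S with hUdef
  have hU : IsOpen U := h.isOpen_inter_interior
  have hUS : U ⊆ S := inter_subset_right.trans interior_subset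
  have hUt : U ⊆ t := inter_subset_left
  have hG : IsMetric S U G := h.toIsMetric.inter isOpen_interior
  have hfU := h.smooth_f.mono hUt
  have hvU := h.smooth_v.mono hUt
  have hsU := fun i j => (hs i j).mono hUt
  have hdet := (h.sqrt_det_smooth h.pos).mono hUt
  refine eq_sum_pd_of_integral_eq_zero h.uniq hU hUS (hp.mono hUt) (fun j => (hq j).mono hUt)
    fun η hη => ?_
  have hηU : ContDiffOn ℝ ∞ η U := hη.smooth.contDiffOn
  -- The admissible variation is `η s`, cut off outside `U`, since `s` is only controlled on `t`.
  set k : Eu n → Matrix (Fin n) (Fin n) ℝ := fun z => Matrix.of fun i j =>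
    U.indicator (fun z => η z * s z i j) z with hk
  have hkU : ∀ z ∈ U, k z = η z • s z := fun z hz => by
    ext i j
    simp [hk, indicator_of_mem hz]
  have hk0 : ∀ z, z ∉ tsupport η → k z = 0 := fun z hz => by
    ext i j
    by_cases hzU : z ∈ U
    · simp [hk, indicator_of_mem hzU, IsTest.eq_zero hz]
    · simp [hk, indicator_of_notMem hzU]
  have hks : ∀ z, (k z).IsSymm := fun z => by
    by_cases hzU : z ∈ U
    · rw [hkU z hzU]
      exact (hss z (hUt hzU)).smul _
    · rw [hk0 z fun hz => hzU (hη.sub hz)]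
      exact Matrix.isSymm_zero
  have h1 := h.weak k (fun i j => contDiff_indicator hU hη.compact hη.sub (hηU.mul (hsU i j))
    fun z _ hz => by rw [IsTest.eq_zero hz, zero_mul]) hks ⟨_, hη.compact, hη.sub, hk0⟩
  set X : Fin n → Eu n → ℝ := fun i z => η z * symb₁ S G s f i z +
    ∑ j, symb G s i j z * Perelman.pd S j η z with hX
  have hXs : ∀ i, ContDiffOn ℝ ∞ (X i) U := fun i =>
    (hηU.mul (hG.symb₁_smooth hsU hfU i)).add
      (ContDiffOn.sum fun j _ => (hG.symb_smooth hsU i j).mul (hG.pd hηU j))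
  have hX0 : ∀ i, ∀ z ∈ U, z ∉ tsupport η → X i z = 0 := fun i z hzU hz => by
    simp [hX, IsTest.eq_zero hz, IsTest.pd_eq_zero hU hUS hzU hz]
  have hdX0 : ∀ i, ∀ z ∈ U, z ∉ tsupport η → Perelman.pd S i (fun z => √(G z).det * X i z) z = 0 :=
    fun i z hzU hz => by
      have : (fun z => √(G z).det * X i z) =ᶠ[nhdsWithin z S] fun _ => 0 := by
        refine Filter.Eventually.filter_mono nhdsWithin_le_nhds ?_
        filter_upwards [hU.mem_nhds hzU, (isClosed_tsupport η).isOpen_compl.mem_nhds hz]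
          with w hw hw'
        rw [hX0 i w hw hw', mul_zero]
      rw [pd_congr_of_eventuallyEq this (hUS hzU), pd_const]
  have e1 : ∀ z ∈ U, v z * linCoordScal S G k f (fun _ => 0) z * √(G z).det =
      (∑ i, v z * Perelman.pd S i (fun z => √(G z).det * X i z) z) +
        √(G z).det * v z * (η z * symb₀ S G s f z +
          ∑ j, trG G s z * grad S G f j z * Perelman.pd S j η z) := fun z hz => by
    rw [hG.linCoordScal_smul hz hηU hsU (fun z hz => hss z (hUt hz)) hkU hfU, ← Finset.mul_sum,
      ← hG.sqrt_det_mul_divg (fun z hz => h.pos z (hUt hz)) hz hXs]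
    ring
  have e2 : ∀ z ∈ U, √(G z).det * (v z * symb₀ S G s f z -
        ∑ i, Perelman.pd S i v z * symb₁ S G s f i z) * η z +
      ∑ j, √(G z).det * (v z * (trG G s z * grad S G f j z) -
        ∑ i, Perelman.pd S i v z * symb G s i j z) * Perelman.pd S j η z =
      (∑ i, -(Perelman.pd S i v z * (√(G z).det * X i z))) +
        √(G z).det * v z * (η z * symb₀ S G s f z +
          ∑ j, trG G s z * grad S G f j z * Perelman.pd S j η z) := fun z _ => by
    have a1 : ∑ j, √(G z).det * (v z * (trG G s z * grad S G f j z) -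
        ∑ i, Perelman.pd S i v z * symb G s i j z) * Perelman.pd S j η z =
        √(G z).det * v z * (∑ j, trG G s z * grad S G f j z * Perelman.pd S j η z) -
        √(G z).det * ∑ i, Perelman.pd S i v z * ∑ j, symb G s i j z * Perelman.pd S j η z := by
      simp only [mul_sub, sub_mul, Finset.sum_sub_distrib, Finset.mul_sum, Finset.sum_mul]
      congr 1
      · exact Finset.sum_congr rfl fun _ _ => by ring
      · rw [Finset.sum_comm]
        exact Finset.sum_congr rfl fun _ _ => Finset.sum_congr rfl fun _ _ => by ring
    have a2 : ∑ i, -(Perelman.pd S i v z * (√(G z).det * X i z)) =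
        -(√(G z).det * η z * ∑ i, Perelman.pd S i v z * symb₁ S G s f i z) -
        √(G z).det * ∑ i, Perelman.pd S i v z * ∑ j, symb G s i j z * Perelman.pd S j η z := by
      simp only [hX, Finset.mul_sum (s := Finset.univ) (a := √(G z).det),
        Finset.mul_sum (s := Finset.univ) (a := √(G z).det * η z), Finset.sum_neg_distrib,
        ← Finset.sum_add_distrib, neg_sub_left, neg_inj]
      exact Finset.sum_congr rfl fun _ _ => by ring
    rw [a1, a2]
    ring
  -- The single integration by parts: the derivative of the flux `√det g · X` is moved onto `v`, so
  -- that `η` appears with at most one derivative and the first-order fundamental lemma applies.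
  have e3 : ∀ i, ∫ z in U, v z * Perelman.pd S i (fun z => √(G z).det * X i z) z =
      ∫ z in U, -(Perelman.pd S i v z * (√(G z).det * X i z)) := fun i => by
    rw [integral_neg]
    exact integral_mul_pd hU hη.compact hη.sub h.uniq hUS hvU (hdet.mul (hXs i))
      (fun z hzU hz => by simp only [hX0 i z hzU hz, mul_zero]) i
  have i1 : ∀ i, IntegrableOn (fun z => v z * Perelman.pd S i (fun z => √(G z).det * X i z) z) U :=
    fun i => integrableOn_of_vanish hU hη.compact hη.sub
      (hvU.mul (hG.pd (hdet.mul (hXs i)) i)).continuousOn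
      fun z hzU hz => by rw [hdX0 i z hzU hz, mul_zero]
  have i2 : ∀ i, IntegrableOn (fun z => -(Perelman.pd S i v z * (√(G z).det * X i z))) U :=
    fun i => integrableOn_of_vanish hU hη.compact hη.sub
      ((hG.pd hvU i).mul (hdet.mul (hXs i))).neg.continuousOn
      fun z hzU hz => by rw [hX0 i z hzU hz, mul_zero, mul_zero, neg_zero]
  have i3 : IntegrableOn (fun z => √(G z).det * v z * (η z * symb₀ S G s f z +
          ∑ j, trG G s z * grad S G f j z * Perelman.pd S j η z)) U :=
    integrableOn_of_vanish hU hη.compact hη.sub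
      ((hdet.mul hvU).mul ((hηU.mul (hG.symb₀_smooth hsU hfU)).add (ContDiffOn.sum fun j _ =>
        ((hG.trG_smooth hsU).mul (hG.grad_smooth hfU j)).mul (hG.pd hηU j)))).continuousOn
      fun z hzU hz => by simp [IsTest.eq_zero hz, IsTest.pd_eq_zero hU hUS hzU hz]
  rw [setIntegral_congr_fun hU.measurableSet e2, ← h1, setIntegral_congr_fun hU.measurableSet e1,
    integral_add (integrable_finsetSum _ fun i _ => i2 i) i3,
    integral_add (integrable_finsetSum _ fun i _ => i1 i) i3,
    integral_finsetSum _ fun i _ => i1 i, integral_finsetSum _ fun i _ => i2 i]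
  simp only [e3]

end IsKer

end

/-! ### The trace of the adjoint equation and the Hessian of `v` -/

section

variable {n : ℕ} {S t : Set (Eu n)} {y : Eu n} {G s : Eu n → Matrix (Fin n) (Fin n) ℝ}
  {f v : Eu n → ℝ}

theorem divg_mul (hy : UniqueDiffWithinAt ℝ S y) {a : Eu n → ℝ} {X : Fin n → Eu n → ℝ}
    (ha : DifferentiableWithinAt ℝ a S y) (hX : ∀ k, DifferentiableWithinAt ℝ (X k) S y) :
    divg S G (fun k z => a z * X k z) y = a y * divg S G X y + ∑ k, pd S k a y * X k y := by
  simp only [divg, pd_mul hy ha (hX _), mul_add, Finset.sum_add_distrib, Finset.mul_sum,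
    mul_left_comm _ (a y)]
  ring

theorem divg_congr {t : Set (Eu n)} (h : RelOpen S t) (hy : y ∈ t) {X Y : Fin n → Eu n → ℝ}
    (hXY : ∀ k, EqOn (X k) (Y k) t) : divg S G X y = divg S G Y y :=
  Finset.sum_congr rfl fun k _ => by
    rw [h.pd_congr (hXY k) hy]
    simp only [fun i => hXY i hy]

/-- The drift Laplacian of `u` in terms of `v = e^{-f} u`. -/
theorem IsMetric.driftLap_exp_mul (hG : IsMetric S t G) (hy : y ∈ t) (hf : ContDiffOn ℝ ∞ f t)
    (hv : ContDiffOn ℝ ∞ v t) : driftLap S G f (fun z => Real.exp (f z) * v z) y =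
      Real.exp (f y) * (lap S G v y + (v y * lap S G f y + ∑ k, pd S k v y * grad S G f k y)) := by
  have hu := fun {z} (hz : z ∈ t) => hG.uniqueDiffWithinAt hz
  rw [driftLap, divg_congr (Y := fun k z => grad S G v k z + v z * grad S G f k z) hG.toRelOpen hy,
    divg_add (hu hy) (fun k => hG.diff (hG.grad_smooth hv k) hy)
      (fun k => hG.diff (hv.mul (hG.grad_smooth hf k)) hy),
    divg_mul (hu hy) (hG.diff hv hy) (fun k => hG.diff (hG.grad_smooth hf k) hy)]
  · rfl
  · intro k z hz
    simp only [grad, pd_mul (hu hz) (hG.diff hf.exp hz) (hG.diff hv hz),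
      pd_comp (hu hz) (hG.diff hf hz) (Real.hasDerivAt_exp _), Finset.mul_sum,
      ← Finset.sum_add_distrib]
    refine Finset.sum_congr rfl fun l _ => ?_
    have : Real.exp (-f z) * Real.exp (f z) = 1 := by rw [← Real.exp_add]; simp
    linear_combination ((G z)⁻¹ k l * (pd S l v z + v z * pd S l f z)) * this

theorem IsMetric.linInv_self (hG : IsMetric S t G) (hy : y ∈ t) (i j : Fin n) :
    linInv G G i j y = -(G y)⁻¹ i j := by
  rw [linInv, Matrix.nonsing_inv_mul _ (hG.isUnit hy), Matrix.one_mul]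

theorem IsMetric.linChristoffel_self (hG : IsMetric S t G) (hy : y ∈ t) (k i j : Fin n) :
    linChristoffel S G G k i j y = 0 := by
  simp [linChristoffel, hG.linInv_self hy]

theorem IsMetric.trG_self (hG : IsMetric S t G) (hy : y ∈ t) : trG G G y = n := by
  have : ∀ a, ∑ b, (G y)⁻¹ a b * G y a b = 1 := fun a => by
    have := hG.inv_mul hy a a
    simp only [if_true] at this
    rw [← this]
    exact Finset.sum_congr rfl fun b _ => by rw [(hG.symm y hy).apply]
  simp [trG, this]

namespace IsKer

/-- The trace of the adjoint equation, at a common zero of `v` and `df`. -/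
theorem lap_eq_zero (h : IsKer S t G f v) (hn : 2 ≤ n) (hy : y ∈ t) (hv : v y = 0)
    (hf : ∀ i, Perelman.pd S i f y = 0) : lap S G v y = 0 := by
  have hu := h.uniqueDiffWithinAt hy
  have hgf := h.grad_smooth h.smooth_f
  have hgv := h.grad_smooth h.smooth_v
  -- The choice `s = G` tests with conformal variations. Then `δΓ` vanishes for constant `η`, so
  -- `symb₁` consists of terms in `df` and is zero at `y`; the term with `symb₀` is killed by `v y =
  -- 0`.
  have h1 := h.adjoint_eq h.smooth h.symm hy
  have hgf0 : ∀ i, grad S G f i y = 0 := fun i => by simp [grad, hf]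
  have h2 : ∀ i, symb₁ S G G f i y = 0 := fun i => by
    simp [symb₁, h.linInv_self hy, hf, contr₁, contr₂, h.linChristoffel_self hy]
  -- For `s = G` the trace is `n`, and the principal symbol is `-(n - 1) g⁻¹`. The flux becomes `n v
  -- ∇f + (n - 1) ∇v`.
  have h3 : ∀ j, EqOn (fun z => √(G z).det * (v z * (trG G G z * grad S G f j z) -
      ∑ i, Perelman.pd S i v z * symb G G i j z)) (fun z => √(G z).det *
      ((n * v z) * grad S G f j z + (n - 1 : ℝ) * grad S G v j z)) t := fun j z hz => by
    simp only [symb, h.trG_self hz, h.linInv_self hz, grad, neg_neg]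
    congr 1
    rw [← mul_assoc, mul_comm (v z), sub_eq_add_neg, ← Finset.sum_neg_distrib, Finset.mul_sum _ _ (n - 1 : ℝ)]
    congr 1
    exact Finset.sum_congr rfl fun i _ => by rw [h.inv_symm hz j i]; ring
  have h4 : ∀ k, ContDiffOn ℝ ∞ (fun z => (n * v z) * grad S G f k z +
      (n - 1 : ℝ) * grad S G v k z) t := fun k =>
    ((contDiffOn_const.mul h.smooth_v).mul (hgf k)).add (contDiffOn_const.mul (hgv k))
  simp only [hv, h2, zero_mul, mul_zero, Finset.sum_const_zero, sub_zero] at h1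
  rw [Finset.sum_congr rfl fun j _ => h.pd_congr (h3 j) hy j,
    ← h.sqrt_det_mul_divg h.pos hy h4, divg_add hu
      (fun k => h.diff ((contDiffOn_const.mul h.smooth_v).mul (hgf k)) hy)
      (fun k => h.diff (contDiffOn_const.mul (hgv k)) hy),
    divg_mul hu (h.diff (contDiffOn_const.mul h.smooth_v) hy) (fun k => h.diff (hgf k) hy),
    divg_mul hu (differentiableWithinAt_const _) (fun k => h.diff (hgv k) hy)] at h1
  simp only [hv, hgf0, pd_const, mul_zero, zero_mul, Finset.sum_const_zero, zero_add,
    add_zero] at h1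
  have h5 : √(G y).det ≠ 0 := (Real.sqrt_pos.2 (h.pos y hy)).ne'
  have h6 : (n - 1 : ℝ) ≠ 0 := by
    have : (2 : ℝ) ≤ n := by exact_mod_cast hn
    linarith
  rcases mul_eq_zero.1 h1.symm with h7 | h7
  · exact absurd h7 h5
  · exact (mul_eq_zero.1 h7).resolve_left h6

end IsKer

/-- `F` is a first order linear differential expression in `v` with continuous coefficients. -/
def IsFirstOrder (S t : Set (Eu n)) (v F : Eu n → ℝ) : Prop :=
  ∃ (a : Fin n → Eu n → ℝ) (b : Eu n → ℝ), (∀ i, ContinuousOn (a i) t) ∧ ContinuousOn b t ∧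
    ∀ z ∈ t, F z = ∑ i, a i z * pd S i v z + b z * v z

namespace IsFirstOrder

variable {F F' : Eu n → ℝ}

theorem congr (h : IsFirstOrder S t v F) (hF : EqOn F' F t) : IsFirstOrder S t v F' := by
  obtain ⟨a, b, ha, hb, h⟩ := h
  exact ⟨a, b, ha, hb, fun z hz => by rw [hF hz, h z hz]⟩

theorem mul {c : Eu n → ℝ} (hc : ContinuousOn c t) (h : IsFirstOrder S t v F) :
    IsFirstOrder S t v (fun z => c z * F z) := by
  obtain ⟨a, b, ha, hb, h⟩ := h
  refine ⟨fun i z => c z * a i z, fun z => c z * b z, fun i => hc.mul (ha i), hc.mul hb,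
    fun z hz => ?_⟩
  simp only [h z hz, mul_add, Finset.mul_sum]
  congr 1
  · exact Finset.sum_congr rfl fun _ _ => by ring
  · ring

theorem add (h : IsFirstOrder S t v F) (h' : IsFirstOrder S t v F') :
    IsFirstOrder S t v (fun z => F z + F' z) := by
  obtain ⟨a, b, ha, hb, h⟩ := h
  obtain ⟨a', b', ha', hb', h'⟩ := h'
  refine ⟨fun i z => a i z + a' i z, fun z => b z + b' z, fun i => (ha i).add (ha' i), hb.add hb',
    fun z hz => ?_⟩
  simp only [h z hz, h' z hz, add_mul, Finset.sum_add_distrib]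
  ring

theorem neg (h : IsFirstOrder S t v F) : IsFirstOrder S t v (fun z => -F z) :=
  (mul (c := fun _ => -1) continuousOn_const h).congr fun z _ => by simp

theorem sub (h : IsFirstOrder S t v F) (h' : IsFirstOrder S t v F') :
    IsFirstOrder S t v (fun z => F z - F' z) :=
  (h.add h'.neg).congr fun z _ => by simp [sub_eq_add_neg]

theorem zero : IsFirstOrder S t v (fun _ => 0) :=
  ⟨fun _ _ => 0, fun _ => 0, fun _ => continuousOn_const, continuousOn_const, fun _ _ => by simp⟩

theorem sum {ι : Type*} {s : Finset ι} {F : ι → Eu n → ℝ}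
    (h : ∀ a ∈ s, IsFirstOrder S t v (F a)) : IsFirstOrder S t v (fun z => ∑ a ∈ s, F a z) := by
  classical
  induction s using Finset.induction_on with
  | empty => exact zero.congr fun z _ => by simp
  | insert a s ha ih =>
    exact ((h a (Finset.mem_insert_self _ _)).add (ih fun b hb =>
      h b (Finset.mem_insert_of_mem hb))).congr fun z _ => by simp [Finset.sum_insert ha]

theorem self : IsFirstOrder S t v v :=
  ⟨fun _ _ => 0, fun _ => 1, fun _ => continuousOn_const, continuousOn_const, fun _ _ => by simp⟩

theorem pd (i : Fin n) : IsFirstOrder S t v (pd S i v) :=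
  ⟨fun j _ => if j = i then 1 else 0, fun _ => 0, fun _ => continuousOn_const, continuousOn_const,
    fun _ _ => by simp⟩

end IsFirstOrder

namespace IsKer

/-- The principal part of the adjoint equation. -/
theorem isFirstOrder_symb (h : IsKer S t G f v)
    (hs : ∀ i j, ContDiffOn ℝ ∞ (fun z => s z i j) t) (hss : ∀ z ∈ t, (s z).IsSymm) :
    IsFirstOrder S t v fun z => ∑ j, ∑ i, symb G s i j z *
      Perelman.pd S j (Perelman.pd S i v) z := by
  have hdet := h.sqrt_det_smooth h.pos
  have hd0 : ∀ z ∈ t, √(G z).det ≠ 0 := fun z hz => (Real.sqrt_pos.2 (h.pos z hz)).ne'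
  have c1 := fun j => (h.trG_smooth hs).mul (h.grad_smooth h.smooth_f j)
  have hsy := h.symb_smooth hs
  have hpv := fun i => h.pd h.smooth_v i
  -- The product rule applied to the flux in `adjoint_eq`, solved for the terms with two derivatives
  -- of `v`.
  have key : ∀ z ∈ t, √(G z).det * ∑ j, ∑ i, symb G s i j z *
        Perelman.pd S j (Perelman.pd S i v) z =
      (∑ j, (Perelman.pd S j (fun z => √(G z).det * (trG G s z * grad S G f j z)) z * v z +
        (√(G z).det * (trG G s z * grad S G f j z)) * Perelman.pd S j v z -
        ∑ i, Perelman.pd S j (fun z => √(G z).det * symb G s i j z) z * Perelman.pd S i v z)) -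
      √(G z).det * (symb₀ S G s f z * v z -
        ∑ i, symb₁ S G s f i z * Perelman.pd S i v z) := fun z hz => by
    have hu := h.uniqueDiffWithinAt hz
    have h1 := h.adjoint_eq hs hss hz
    have h2 : ∀ j, Perelman.pd S j (fun z => √(G z).det * (v z * (trG G s z * grad S G f j z) -
        ∑ i, Perelman.pd S i v z * symb G s i j z)) z =
        Perelman.pd S j (fun z => √(G z).det * (trG G s z * grad S G f j z)) z * v z +
        (√(G z).det * (trG G s z * grad S G f j z)) * Perelman.pd S j v z -
        ∑ i, (Perelman.pd S j (fun z => √(G z).det * symb G s i j z) z * Perelman.pd S i v z +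
          √(G z).det * symb G s i j z * Perelman.pd S j (Perelman.pd S i v) z) := fun j => by
      rw [← pd_mul hu (h.diff (hdet.mul (c1 j)) hz) (h.diff h.smooth_v hz)]
      simp only [← pd_mul hu (h.diff (hdet.mul (hsy _ j)) hz) (h.diff (hpv _) hz)]
      rw [← pd_sum hu (fun i _ => h.diff ((hdet.mul (hsy i j)).mul (hpv i)) hz),
        ← pd_sub hu (h.diff ((hdet.mul (c1 j)).mul h.smooth_v) hz)
          (h.diff (ContDiffOn.sum fun i _ => (hdet.mul (hsy i j)).mul (hpv i)) hz)]
      refine h.pd_congr (fun w _ => ?_) hz j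
      simp only [mul_sub, Finset.mul_sum]
      congr 1
      · ring
      · exact Finset.sum_congr rfl fun _ _ => by ring
    simp only [h2] at h1
    simp only [Finset.sum_add_distrib, Finset.sum_sub_distrib, mul_assoc, ← Finset.mul_sum,
      mul_comm (Perelman.pd S _ v z) (symb₁ S G s f _ z)] at h1 ⊢
    linear_combination h1
  have hl : ContinuousOn (fun z => (√(G z).det)⁻¹) t := hdet.continuousOn.inv₀ hd0
  have h3 : IsFirstOrder S t v fun z => √(G z).det * ∑ j, ∑ i, symb G s i j z *
      Perelman.pd S j (Perelman.pd S i v) z := by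
    refine IsFirstOrder.congr ?_ key
    refine (IsFirstOrder.sum fun j _ => ((IsFirstOrder.mul
      (h.pd (hdet.mul (c1 j)) j).continuousOn .self).add (.mul
      (hdet.mul (c1 j)).continuousOn (.pd j))).sub (.sum fun i _ => .mul
      (h.pd (hdet.mul (hsy i j)) j).continuousOn (.pd i))).sub (.mul hdet.continuousOn (.sub
      (.mul (h.symb₀_smooth hs h.smooth_f).continuousOn .self) (.sum fun i _ => .mul
        (h.symb₁_smooth hs h.smooth_f i).continuousOn (.pd i))))
  exact (IsFirstOrder.mul hl h3).congr fun z hz => by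
    simp only
    rw [← mul_assoc, inv_mul_cancel₀ (hd0 z hz), one_mul]

/-- The Hessian of `v` is of first order in `v`. -/
theorem isFirstOrder_hess (h : IsKer S t G f v) (hn : 2 ≤ n) (i j : Fin n) :
    IsFirstOrder S t v (Perelman.pd S i (Perelman.pd S j v)) := by
  have h6 : (n - 1 : ℝ) ≠ 0 := by
    have : (2 : ℝ) ≤ n := by exact_mod_cast hn
    linarith
  set A : Matrix (Fin n) (Fin n) ℝ := Matrix.single i j 1 + Matrix.single j i 1 with hA
  have hAs : A.IsSymm := by
    rw [Matrix.IsSymm, hA, Matrix.transpose_add, Matrix.transpose_single, Matrix.transpose_single,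
      add_comm]
  -- Chosen so that the symbol of `s` is the constant matrix `A`: lowering the indices of `A` gives
  -- `G A G`, and the multiple of `G` is subtracted to cancel the trace. The coefficient solves `(n
  -- - 1) c = tr(A G)`, which is where `n ≥ 2` enters.
  set s : Eu n → Matrix (Fin n) (Fin n) ℝ := fun z =>
    G z * A * G z - ((A * G z).trace / (n - 1)) • G z with hs
  have hss : ∀ z ∈ t, (s z).IsSymm := fun z hz => by
    refine Matrix.IsSymm.sub ?_ ((h.symm z hz).smul _)
    rw [Matrix.IsSymm, Matrix.transpose_mul, Matrix.transpose_mul, (h.symm z hz).eq, hAs.eq,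
      Matrix.mul_assoc]
  have hsm : ∀ a b, ContDiffOn ℝ ∞ (fun z => s z a b) t := fun a b => by
    simp only [hs, Matrix.sub_apply, Matrix.smul_apply, Matrix.trace, Matrix.diag, Matrix.mul_apply,
      smul_eq_mul, Finset.sum_mul]
    exact (ContDiffOn.sum fun _ _ => ContDiffOn.sum fun _ _ => ((h.smooth _ _).mul
      contDiffOn_const).mul (h.smooth _ _)).sub (((ContDiffOn.sum fun _ _ => ContDiffOn.sum
      fun _ _ => contDiffOn_const.mul (h.smooth _ _)).div_const _).mul (h.smooth _ _))
  have hsymb : ∀ z ∈ t, ∀ a b, symb G s a b z = A a b := fun z hz a b => by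
    have hu := h.isUnit hz
    have e1 : (G z)⁻¹ * s z = A * G z - ((A * G z).trace / (n - 1)) • 1 := by
      simp only [hs, Matrix.mul_sub, Matrix.mul_smul, Matrix.nonsing_inv_mul _ hu]
      rw [Matrix.mul_assoc, ← Matrix.mul_assoc (G z)⁻¹, Matrix.nonsing_inv_mul _ hu, Matrix.one_mul]
    have e2 : (G z)⁻¹ * s z * (G z)⁻¹ = A - ((A * G z).trace / (n - 1)) • (G z)⁻¹ := by
      rw [e1, Matrix.sub_mul, Matrix.mul_assoc, Matrix.mul_nonsing_inv _ hu, Matrix.mul_one,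
        Matrix.smul_mul, Matrix.one_mul]
    have e3 : trG G s z = ((G z)⁻¹ * s z).trace := by
      simp only [trG, Matrix.trace, Matrix.diag, Matrix.mul_apply]
      exact Finset.sum_congr rfl fun a _ => Finset.sum_congr rfl fun b _ => by
        rw [(hss z hz).apply a b]
    rw [symb, e3, e1, linInv, e2, Matrix.trace_sub, Matrix.trace_smul, Matrix.trace_one]
    simp only [Matrix.sub_apply, Matrix.smul_apply, smul_eq_mul, Fintype.card_fin]
    field_simp
    ring
  -- The two entries of `A` give `∂ᵢ∂ⱼ v` and `∂ⱼ∂ᵢ v`, which agree up to the boundary; hence the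
  -- factor one half.
  refine (IsFirstOrder.mul (c := fun _ => 1 / 2) continuousOn_const
    (h.isFirstOrder_symb hsm hss)).congr fun z hz => ?_
  simp only [hsymb z hz, hA, Matrix.add_apply, Matrix.single_apply, add_mul,
    Finset.sum_add_distrib, ite_and, ite_mul, one_mul, zero_mul,
    Finset.sum_ite_eq, Finset.mem_univ, if_true]
  rw [h.pd_comm h.dense h.smooth_v i j hz]
  ring

end IsKer

end

section

variable {n : ℕ} {S t U : Set (Eu n)} {y : Eu n} {G : Eu n → Matrix (Fin n) (Fin n) ℝ}
  {f v η : Eu n → ℝ} {m : Fin n}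

/-! ### Invariance under the flow of `η ∂ₘ` -/

/-- The translation by `s η` in the direction `m`. -/
def shift (η : Eu n → ℝ) (m : Fin n) (s : ℝ) (z : Eu n) : Eu n :=
  z + (s * η z) • EuclideanSpace.single m 1

/-- The pullback of `G` by `shift η m s`. -/
def shiftMetric (S : Set (Eu n)) (η : Eu n → ℝ) (m : Fin n)
    (G : Eu n → Matrix (Fin n) (Fin n) ℝ) (s : ℝ) (z : Eu n) : Matrix (Fin n) (Fin n) ℝ :=
  Matrix.of fun i j => G (shift η m s z) i j + s * pd S i η z * G (shift η m s z) m j +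
    s * pd S j η z * G (shift η m s z) i m +
    (s * pd S i η z) * (s * pd S j η z) * G (shift η m s z) m m

/-- The Lie derivative of `G` along `η ∂ₘ`. -/
def lieMetric (S : Set (Eu n)) (η : Eu n → ℝ) (m : Fin n)
    (G : Eu n → Matrix (Fin n) (Fin n) ℝ) (z : Eu n) : Matrix (Fin n) (Fin n) ℝ :=
  Matrix.of fun i j => η z * pd S m (fun w => G w i j) z + pd S i η z * G z m j +
    pd S j η z * G z i m

@[simp] theorem shift_zero (z : Eu n) : shift η m 0 z = z := by simp [shift]

@[simp] theorem shiftMetric_zero : shiftMetric S η m G 0 = G := by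
  ext z i j
  simp [shiftMetric]

theorem contDiff_shift (hη : ContDiff ℝ ∞ η) :
    ContDiff ℝ ∞ fun p : ℝ × Eu n => shift η m p.1 p.2 :=
  contDiff_snd.add ((contDiff_fst.mul (hη.comp contDiff_snd)).smul contDiff_const)

theorem hasDerivAt_shift (z : Eu n) :
    HasDerivAt (fun s => shift η m s z) (η z • EuclideanSpace.single m (1 : ℝ)) 0 := by
  have h1 : HasDerivAt (fun s : ℝ => s * η z) (η z) 0 := by
    simpa using (hasDerivAt_id (0 : ℝ)).mul_const (η z)
  exact (h1.smul_const (EuclideanSpace.single m (1 : ℝ))).const_add z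

theorem fderiv_shift (hη : ContDiff ℝ ∞ η) (hS : S ∈ nhds y) (s : ℝ) (v : Eu n) :
    fderiv ℝ (shift η m s) y v =
      v + (s * ∑ k, v k * pd S k η y) • EuclideanSpace.single m (1 : ℝ) := by
  have hd : HasFDerivAt η (fderiv ℝ η y) y := (hη.differentiable (by simp) y).hasFDerivAt
  have h1 : HasFDerivAt (shift η m s) (ContinuousLinearMap.id ℝ (Eu n) +
      (s • fderiv ℝ η y).smulRight (EuclideanSpace.single m (1 : ℝ))) y :=
    (hasFDerivAt_id y).add ((hd.const_mul s).smul_const (EuclideanSpace.single m (1 : ℝ)))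
  rw [h1.fderiv, ← fderiv_eq_sum_pd hS]
  rfl

theorem metL_shiftMetric (hη : ContDiff ℝ ∞ η) (hS : S ∈ nhds y) (s : ℝ) (v w : Eu n) :
    metL (shiftMetric S η m G s) y v w = metL G (shift η m s y)
      (fderiv ℝ (shift η m s) y v) (fderiv ℝ (shift η m s) y w) := by
  rw [fderiv_shift hη hS, fderiv_shift hη hS]
  simp only [map_add, add_apply, map_smul, smul_apply, metL_single, smul_eq_mul]
  have e1 : ∀ x : Eu n, metL G (shift η m s y) x (EuclideanSpace.single m 1) =
      ∑ i, x i * G (shift η m s y) i m := fun x => by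
    simp [metL_apply, mul_comm]
  have e2 : ∀ x : Eu n, metL G (shift η m s y) (EuclideanSpace.single m 1) x =
      ∑ i, x i * G (shift η m s y) m i := fun x => by
    simp [metL_apply, mul_comm]
  rw [e1, e2]
  have c1 : ∑ i, ∑ j, s * pd S i η y * G (shift η m s y) m j * (v i * w j) =
      (s * ∑ k, v k * pd S k η y) * ∑ j, w j * G (shift η m s y) m j := by
    rw [Finset.mul_sum _ _ s, Finset.sum_mul]
    refine Finset.sum_congr rfl fun i _ => ?_
    rw [Finset.mul_sum]
    exact Finset.sum_congr rfl fun j _ => by ring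
  have c2 : ∑ i, ∑ j, s * pd S j η y * G (shift η m s y) i m * (v i * w j) =
      (s * ∑ k, w k * pd S k η y) * ∑ i, v i * G (shift η m s y) i m := by
    rw [Finset.sum_comm, Finset.mul_sum _ _ s, Finset.sum_mul]
    refine Finset.sum_congr rfl fun i _ => ?_
    rw [Finset.mul_sum]
    exact Finset.sum_congr rfl fun j _ => by ring
  have c3 : ∑ i, ∑ j, (s * pd S i η y) * (s * pd S j η y) * G (shift η m s y) m m * (v i * w j) =
      (s * ∑ k, v k * pd S k η y) * ((s * ∑ k, w k * pd S k η y) * G (shift η m s y) m m) := by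
    rw [Finset.mul_sum _ _ s, Finset.mul_sum _ _ s, Finset.sum_mul, Finset.sum_mul]
    refine Finset.sum_congr rfl fun i _ => ?_
    rw [Finset.mul_sum]
    exact Finset.sum_congr rfl fun j _ => by ring
  simp only [metL_apply, shiftMetric, Matrix.of_apply, add_mul, Finset.sum_add_distrib, c1, c2, c3]
  ring

section Var

variable {W : Set (ℝ × Eu n)} (hη : ContDiff ℝ ∞ η) (hU : IsOpen U) (hUS : U ⊆ S)
  (hW : ∀ p ∈ W, p.2 ∈ U ∧ shift η m p.1 p.2 ∈ U)

include hη hU hUS hW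

theorem IsVar.comp_shift {F : Eu n → ℝ} (hF : ContDiffOn ℝ ∞ F U) :
    IsVar W (fun s z => F (shift η m s z)) (fun z => η z * Perelman.pd S m F z) where
  smooth := hF.comp (contDiff_shift hη).contDiffOn fun p hp => (hW p hp).2
  deriv z hz := by
    have hzU := (hW _ hz).1
    have hzn := hU.mem_nhds hzU
    have hd : HasFDerivAt F (fderiv ℝ F z) (shift η m 0 z) := by
      rw [shift_zero]
      exact ((hF.contDiffAt hzn).differentiableAt (by simp)).hasFDerivAt
    have := hd.comp_hasDerivAt (0 : ℝ) (hasDerivAt_shift z)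
    rwa [map_smul, smul_eq_mul, ← pd_eq_fderiv (Filter.mem_of_superset hzn hUS)] at this

theorem IsVar.shiftMetric (hr : RelOpen S U) (hWo : IsOpen W)
    (hG : ∀ i j, ContDiffOn ℝ ∞ (fun z => G z i j) U) (i j : Fin n) :
    IsVar W (fun s z => shiftMetric S η m G s z i j) (fun z => lieMetric S η m G z i j) := by
  have c := fun i j => IsVar.comp_shift hη hU hUS hW (hG i j)
  have e : ∀ i, IsVar W (fun s z => s * Perelman.pd S i η z) (fun z => 1 * Perelman.pd S i η z + 0 * 0) :=
    fun i => param.mul (of_contDiffOn (hr.pd hη.contDiffOn i) fun p hp => (hW p hp).1)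
  refine ((((c i j).add ((e i).mul (c m j))).add ((e j).mul (c i m))).add
    (((e i).mul (e j)).mul (c m m))).congr hWo (fun p _ => rfl) fun z _ => ?_
  simp [lieMetric]

end Var

/-- Differentiate `𝓡(φₛ* G, f ∘ φₛ) = 𝓡(G, f) ∘ φₛ` at `s = 0`, where `φₛ` is the shift. Although
`φₛ` is not the flow of `η ∂ₘ`, it has the same derivative at `s = 0`, so the metric varies by the
Lie derivative and `f` by `η ∂ₘ f`. -/
theorem lin_lieMetric (hG : IsMetric S U G) (hU : IsOpen U) (hη : ContDiff ℝ ∞ η)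
    (hf : ContDiffOn ℝ ∞ f U) (hy : y ∈ U) :
    linCoordScal S G (lieMetric S η m G) f (fun z => η z * pd S m f z) y =
      η y * pd S m (coordScal S G f) y := by
  set W₀ : Set (ℝ × Eu n) := (fun p => p.2) ⁻¹' U ∩ (fun p => shift η m p.1 p.2) ⁻¹' U with hW₀
  have hW₀o : IsOpen W₀ := (hU.preimage continuous_snd).inter
    (hU.preimage (contDiff_shift hη).continuous)
  have h0 := fun i j => (IsVar.shiftMetric (m := m) hη hU hG.sub (fun p hp => hp) hG.toRelOpen hW₀o
    hG.smooth i j)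
  -- Parameters and points where the pulled-back metric degenerates are removed. The set stays open
  -- and contains `(0, y)`, and on it the shift is a local isometry.
  set W : Set (ℝ × Eu n) := W₀ ∩ (fun p => (shiftMetric S η m G p.1 p.2).det) ⁻¹' {0}ᶜ with hWdef
  have hW : IsOpen W := (contDiffOn_det (G := fun p : ℝ × Eu n => shiftMetric S η m G p.1 p.2)
    fun i j => (h0 i j).smooth).continuousOn.isOpen_inter_preimage hW₀o isOpen_compl_singleton
  have hWU : ∀ p ∈ W, p.2 ∈ U ∧ shift η m p.1 p.2 ∈ U := fun p hp => hp.1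
  have hWd : ∀ p ∈ W, (shiftMetric S η m G p.1 p.2).det ≠ 0 := fun p hp => hp.2
  have hy0 : ((0 : ℝ), y) ∈ W := ⟨⟨hy, by simpa using hy⟩, by simpa using hG.det_ne y hy⟩
  have h1 := IsVar.coordScal (S := S) (IsVar.shiftMetric (m := m) hη hU hG.sub hWU hG.toRelOpen hW hG.smooth) hW
    (fun p hp => Filter.mem_of_superset (hU.mem_nhds (hWU p hp).1) hG.sub) hWd
    (IsVar.comp_shift hη hU hG.sub hWU hf)
  have h2 := IsVar.comp_shift hη hU hG.sub hWU (hG.coordScal_smooth hf)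
  have h3 := h1.congr hW (F₂ := fun s z => coordScal S G f (shift η m s z)) (F₂' := _)
    (fun p hp => ?_) fun _ _ => rfl
  · have := h3.unique h2 hy0
    simpa using this
  · obtain ⟨s, z⟩ := p
    -- At fixed `s`, the slice of `W` is the open set on which the shift is an isometry onto its
    -- image in `(U, G)`.
    set V : Set (Eu n) := {z | (s, z) ∈ W} with hV
    have hVo : IsOpen V := hW.preimage (Continuous.prodMk_right s)
    have hVU : V ⊆ U := fun z hz => (hWU _ hz).1
    have hiso : IsIsom S V U (shiftMetric S η m G s) G (shift η m s) :=
      { metric :=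
          { toRelOpen := .of_isOpen hG.uniq hVo (hVU.trans hG.sub)
            smooth := fun i j => (h0 i j).smooth.comp
              (contDiff_prodMk_right s).contDiffOn fun z hz => hz.1
            symm := fun z hz => by
              ext i j
              have hzs := hG.symm _ (hWU _ hz).2
              simp only [shiftMetric, Matrix.transpose_apply, Matrix.of_apply, hzs.apply i j,
                hzs.apply i m, hzs.apply m j]
              ring
            det_ne := fun z hz => hWd _ hz }
        metric' := hG
        isOpen := hVo
        isOpen' := hU
        smooth := ((contDiff_shift hη).comp (contDiff_prodMk_right s)).contDiffOn
        mapsTo := fun z hz => (hWU _ hz).2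
        iso := fun z hz => metL_shiftMetric hη
          (Filter.mem_of_superset (hU.mem_nhds (hVU hz)) hG.sub) s }
    exact (hiso.coordScal_eq hf (fun _ _ => rfl) hp).symm

namespace IsKer

/-- The kernel condition is tested with the Lie derivative of `G` along `η ∂ₘ`. The factor
multiplying `2 ∂ₘ f` on the right is `div(∇v + v ∇f) = div(e^{-f} ∇u)`, with `u = e^f v`. -/
theorem mul_pd_coordScal (h : IsKer S t G f v) (m : Fin n) :
    EqOn (fun z => v z * Perelman.pd S m (coordScal S G f) z)
      (fun z => 2 * (lap S G v z + (v z * lap S G f z +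
        ∑ k, Perelman.pd S k v z * grad S G f k z)) * Perelman.pd S m f z) t := by
  have hR := h.coordScal_smooth h.smooth_f
  have hlap : ∀ {w}, ContDiffOn ℝ ∞ w t → ContDiffOn ℝ ∞ (lap S G w) t := fun hw =>
    h.divg_smooth (h.grad_smooth hw)
  have hA : ContDiffOn ℝ ∞ (fun z => lap S G v z + (v z * lap S G f z +
        ∑ k, Perelman.pd S k v z * grad S G f k z)) t :=
    (hlap h.smooth_v).add ((h.smooth_v.mul (hlap h.smooth_f)).add
      (ContDiffOn.sum fun k _ => (h.pd h.smooth_v k).mul (h.grad_smooth h.smooth_f k)))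
  refine h.toRelOpen.eqOn h.dense (h.smooth_v.mul (h.pd hR m)).continuousOn
    ((contDiffOn_const.mul hA).mul (h.pd h.smooth_f m)).continuousOn ?_
  set U := t ∩ interior S with hUdef
  have hU : IsOpen U := h.isOpen_inter_interior
  have hUS : U ⊆ S := inter_subset_right.trans interior_subset
  have hUt : U ⊆ t := inter_subset_left
  have hG : IsMetric S U G := h.toIsMetric.inter isOpen_interior
  have hfU := h.smooth_f.mono hUt
  have hvU := h.smooth_v.mono hUt
  have hRU := hR.mono hUt
  have hdet := (h.sqrt_det_smooth h.pos).mono hUt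
  have hgf := hG.grad_smooth hfU
  have hgv := hG.grad_smooth hvU
  have hfm := hG.pd hfU m
  -- In terms of `u = e^f v` this field is `e^{-f} ∇u`.
  set Y : Fin n → Eu n → ℝ := fun k z => grad S G v k z + v z * grad S G f k z with hY
  have hYs : ∀ k, ContDiffOn ℝ ∞ (Y k) U := fun k => (hgv k).add (hvU.mul (hgf k))
  have hq : ∀ k, ContDiffOn ℝ ∞ (fun z => √(G z).det * Y k z) U := fun k => hdet.mul (hYs k)
  -- One integration by parts is done by hand and leaves `⟨Y, ∇(η ∂ₘ f)⟩`, whose product rule gives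
  -- these `p` and `q`. The fundamental lemma does the other one. In the resulting equation the
  -- terms with second derivatives of `f` cancel.
  have key := eq_sum_pd_of_integral_eq_zero (S := S) (U := U)
    (p := fun z => √(G z).det * (v z * Perelman.pd S m (coordScal S G f) z) +
      2 * ∑ k, (√(G z).det * Y k z) * Perelman.pd S k (Perelman.pd S m f) z)
    (q := fun k z => 2 * ((√(G z).det * Y k z) * Perelman.pd S m f z)) h.uniq hU hUS
    ((hdet.mul (hvU.mul (hG.pd hRU m))).add (contDiffOn_const.mul
      (ContDiffOn.sum fun k _ => (hq k).mul (hG.pd hfm k))))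
    (fun k => contDiffOn_const.mul ((hq k).mul hfm)) fun η hη => ?_
  · intro z hz
    have hu := h.uniqueDiffWithinAt (hUt hz)
    have h1 := key hz
    simp only [pd_mul hu (differentiableWithinAt_const _) (hG.diff ((hq _).mul hfm) hz),
      pd_mul hu (hG.diff (hq _) hz) (hG.diff hfm hz), pd_const, zero_mul, zero_add, mul_add,
      Finset.sum_add_distrib, ← Finset.mul_sum, ← Finset.sum_mul] at h1
    rw [← hG.sqrt_det_mul_divg (fun z hz => h.pos z (hUt hz)) hz hYs, hY,
      divg_add hu (fun k => hG.diff (hgv k) hz) (fun k => hG.diff (hvU.mul (hgf k)) hz),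
      divg_mul hu (hG.diff hvU hz) (fun k => hG.diff (hgf k) hz)] at h1
    refine mul_left_cancel₀ (Real.sqrt_pos.2 (h.pos z (hUt hz))).ne' ?_
    simp only [lap] at h1 ⊢
    linear_combination h1
  have hηU : ContDiffOn ℝ ∞ η U := hη.smooth.contDiffOn
  have hη0 : ∀ z, z ∉ tsupport η → η z = 0 := fun z hz => IsTest.eq_zero hz
  have hdη0 : ∀ z ∈ U, z ∉ tsupport η → ∀ i, Perelman.pd S i η z = 0 := fun z hzU hz i =>
    IsTest.pd_eq_zero hU hUS hzU hz i
  set L := lieMetric S η m G with hL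
  have hLs : ∀ i j, ContDiffOn ℝ ∞ (fun z => L z i j) U := fun i j =>
    ((hηU.mul (hG.pd (hG.smooth i j) m)).add ((hG.pd hηU i).mul (hG.smooth m j))).add
      ((hG.pd hηU j).mul (hG.smooth i m))
  have hLz : ∀ i j, ∀ z ∈ U, z ∉ tsupport η → L z i j = 0 := fun i j z hzU hz => by
    simp [hL, lieMetric, hη0 z hz, hdη0 z hzU hz]
  set k : Eu n → Matrix (Fin n) (Fin n) ℝ := fun z => Matrix.of fun i j =>
    U.indicator (fun z => L z i j) z with hk
  have hkU : ∀ z ∈ U, k z = L z := fun z hz => by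
    ext i j
    simp [hk, indicator_of_mem hz]
  have hk0 : ∀ z, z ∉ tsupport η → k z = 0 := fun z hz => by
    ext i j
    by_cases hzU : z ∈ U
    · simp [hk, indicator_of_mem hzU, hLz i j z hzU hz]
    · simp [hk, indicator_of_notMem hzU]
  have hks : ∀ z, (k z).IsSymm := fun z => by
    by_cases hzU : z ∈ U
    · rw [hkU z hzU]
      ext i j
      simp only [hL, lieMetric, Matrix.transpose_apply, Matrix.of_apply, hG.pd_symm hzU m i j,
        (hG.symm z hzU).apply j m, (hG.symm z hzU).apply m i]
      ring
    · rw [hk0 z fun hz => hzU (hη.sub hz)]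
      exact Matrix.isSymm_zero
  have h1 := h.weak k (fun i j => contDiff_indicator hU hη.compact hη.sub (hLs i j)
    (hLz i j)) hks ⟨_, hη.compact, hη.sub, hk0⟩
  set ψ : Eu n → ℝ := fun z => η z * Perelman.pd S m f z with hψ
  have hψs : ContDiffOn ℝ ∞ ψ U := hηU.mul hfm
  have hψ0 : ∀ z ∈ U, z ∉ tsupport η → ψ z = 0 := fun z _ hz => by simp [hψ, hη0 z hz]
  have hpψ : ∀ z ∈ U, ∀ i, Perelman.pd S i ψ z = Perelman.pd S i η z * Perelman.pd S m f z +
      η z * Perelman.pd S i (Perelman.pd S m f) z := fun z hz i =>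
    pd_mul (h.uniqueDiffWithinAt (hUt hz)) (hG.diff hηU hz) (hG.diff hfm hz) i
  have hdψ0 : ∀ z ∈ U, z ∉ tsupport η → ∀ i, Perelman.pd S i ψ z = 0 := fun z hzU hz i => by
    rw [hpψ z hzU, hη0 z hz, hdη0 z hzU hz, zero_mul, zero_mul, add_zero]
  have hgψ := hG.grad_smooth hψs
  have hgψ0 : ∀ i, ∀ z ∈ U, z ∉ tsupport η → grad S G ψ i z = 0 := fun i z hzU hz => by
    simp [grad, hdψ0 z hzU hz]
  have hdgψ0 : ∀ i, ∀ z ∈ U, z ∉ tsupport η →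
      Perelman.pd S i (fun z => √(G z).det * grad S G ψ i z) z = 0 := fun i z hzU hz => by
    have : (fun z => √(G z).det * grad S G ψ i z) =ᶠ[nhdsWithin z S] fun _ => 0 := by
      refine Filter.Eventually.filter_mono nhdsWithin_le_nhds ?_
      filter_upwards [hU.mem_nhds hzU, (isClosed_tsupport η).isOpen_compl.mem_nhds hz]
        with w hw hw'
      rw [hgψ0 i w hw hw', mul_zero]
    rw [pd_congr_of_eventuallyEq this (hUS hzU), pd_const]
  have e1 : ∀ z ∈ U, v z * linCoordScal S G k f (fun _ => 0) z * √(G z).det =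
      √(G z).det * v z * (η z * Perelman.pd S m (coordScal S G f) z +
        2 * ∑ i, grad S G f i z * Perelman.pd S i ψ z) +
      ∑ i, -2 * (v z * Perelman.pd S i (fun z => √(G z).det * grad S G ψ i z) z) := fun z hz => by
    -- `k` agrees with `L` only on `U`. Applied with the constant function `1` in place of `η`,
    -- `linCoordScal_smul` expresses both linearizations through `L` alone.
    have a1 : linCoordScal S G k f (fun _ => 0) z = linCoordScal S G L f (fun _ => 0) z := by
      rw [hG.linCoordScal_smul (η := fun _ => 1) hz contDiffOn_const hLs
        (fun z hz => by rw [← hkU z hz]; exact hks z)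
        (fun z hz => by rw [one_smul, hkU z hz]) hfU,
        hG.linCoordScal_smul (η := fun _ => 1) hz contDiffOn_const hLs
        (fun z hz => by rw [← hkU z hz]; exact hks z) (fun z hz => by rw [one_smul]) hfU]
    have a2 := hG.linCoordScal_add hz hLs hfU hψs
    rw [hL, hψ, lin_lieMetric hG hU hη.smooth hfU hz, ← hL, ← hψ] at a2
    rw [a1, ← Finset.mul_sum, ← Finset.mul_sum,
      ← hG.sqrt_det_mul_divg (fun z hz => h.pos z (hUt hz)) hz hgψ]
    simp only [lap] at a2
    linear_combination -(v z * √(G z).det) * a2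
  have e2 : ∀ z ∈ U, (√(G z).det * (v z * Perelman.pd S m (coordScal S G f) z) +
      2 * ∑ k, (√(G z).det * Y k z) * Perelman.pd S k (Perelman.pd S m f) z) * η z +
      ∑ k, 2 * ((√(G z).det * Y k z) * Perelman.pd S m f z) * Perelman.pd S k η z =
      √(G z).det * v z * (η z * Perelman.pd S m (coordScal S G f) z +
        2 * ∑ i, grad S G f i z * Perelman.pd S i ψ z) +
      ∑ i, 2 * (Perelman.pd S i v z * (√(G z).det * grad S G ψ i z)) := fun z hz => by
    have a1 : ∑ i, Perelman.pd S i v z * grad S G ψ i z =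
        ∑ i, grad S G v i z * Perelman.pd S i ψ z := by
      simp only [grad, Finset.mul_sum, Finset.sum_mul]
      rw [Finset.sum_comm]
      exact Finset.sum_congr rfl fun i _ => Finset.sum_congr rfl fun j _ => by
        rw [hG.inv_symm hz j i]
        ring
    have a2 : ∑ i, 2 * (Perelman.pd S i v z * (√(G z).det * grad S G ψ i z)) =
        2 * √(G z).det * ∑ i, grad S G v i z * Perelman.pd S i ψ z := by
      rw [← a1, Finset.mul_sum]
      exact Finset.sum_congr rfl fun i _ => by ring
    rw [a2]
    simp only [hpψ z hz, hY]
    simp only [Finset.mul_sum, Finset.sum_mul, mul_add, add_mul, Finset.sum_add_distrib]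
    have a3 : ∀ F F' : Fin n → ℝ, (∀ i, F i = F' i) → ∑ i, F i = ∑ i, F' i := fun F F' hF =>
      Finset.sum_congr rfl fun i _ => hF i
    have b1 := a3 (fun i => 2 * (√(G z).det * grad S G v i z *
      Perelman.pd S i (Perelman.pd S m f) z) * η z) (fun i => 2 * √(G z).det *
      (grad S G v i z * (η z * Perelman.pd S i (Perelman.pd S m f) z))) fun i => by ring
    have b2 := a3 (fun i => 2 * (√(G z).det * (v z * grad S G f i z) *
      Perelman.pd S i (Perelman.pd S m f) z) * η z) (fun i => √(G z).det * v z * (2 *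
      (grad S G f i z * (η z * Perelman.pd S i (Perelman.pd S m f) z)))) fun i => by ring
    have b3 := a3 (fun i => 2 * (√(G z).det * grad S G v i z * Perelman.pd S m f z) *
      Perelman.pd S i η z) (fun i => 2 * √(G z).det *
      (grad S G v i z * (Perelman.pd S i η z * Perelman.pd S m f z))) fun i => by ring
    have b4 := a3 (fun i => 2 * (√(G z).det * (v z * grad S G f i z) * Perelman.pd S m f z) *
      Perelman.pd S i η z) (fun i => √(G z).det * v z * (2 *
      (grad S G f i z * (Perelman.pd S i η z * Perelman.pd S m f z)))) fun i => by ring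
    rw [b1, b2, b3, b4]
    ring
  have e3 : ∀ i, ∫ z in U, -2 * (v z * Perelman.pd S i (fun z => √(G z).det * grad S G ψ i z) z) =
      ∫ z in U, 2 * (Perelman.pd S i v z * (√(G z).det * grad S G ψ i z)) := fun i => by
    rw [integral_const_mul, integral_const_mul, integral_mul_pd hU hη.compact hη.sub h.uniq hUS hvU
      (hdet.mul (hgψ i)) (fun z hzU hz => by simp only [hgψ0 i z hzU hz, mul_zero]) i]
    ring
  have i1 : ∀ i, IntegrableOn (fun z =>
      -2 * (v z * Perelman.pd S i (fun z => √(G z).det * grad S G ψ i z) z)) U :=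
    fun i => integrableOn_of_vanish hU hη.compact hη.sub
      (contDiffOn_const.mul (hvU.mul (hG.pd (hdet.mul (hgψ i)) i))).continuousOn
      fun z hzU hz => by rw [hdgψ0 i z hzU hz, mul_zero, mul_zero]
  have i2 : ∀ i, IntegrableOn (fun z =>
      2 * (Perelman.pd S i v z * (√(G z).det * grad S G ψ i z))) U :=
    fun i => integrableOn_of_vanish hU hη.compact hη.sub
      (contDiffOn_const.mul ((hG.pd hvU i).mul (hdet.mul (hgψ i)))).continuousOn
      fun z hzU hz => by rw [hgψ0 i z hzU hz, mul_zero, mul_zero, mul_zero]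
  have i3 : IntegrableOn (fun z => √(G z).det * v z * (η z * Perelman.pd S m (coordScal S G f) z +
        2 * ∑ i, grad S G f i z * Perelman.pd S i ψ z)) U :=
    integrableOn_of_vanish hU hη.compact hη.sub
      ((hdet.mul hvU).mul ((hηU.mul (hG.pd hRU m)).add (contDiffOn_const.mul (ContDiffOn.sum
        fun i _ => (hgf i).mul (hG.pd hψs i))))).continuousOn
      fun z hzU hz => by simp [hη0 z hz, hdψ0 z hzU hz]
  rw [setIntegral_congr_fun hU.measurableSet e2, ← h1, setIntegral_congr_fun hU.measurableSet e1,
    integral_add i3 (integrable_finsetSum _ fun i _ => i2 i),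
    integral_add i3 (integrable_finsetSum _ fun i _ => i1 i),
    integral_finsetSum _ fun i _ => i1 i, integral_finsetSum _ fun i _ => i2 i]
  simp only [e3]

end IsKer

end

section

/-! ### Smooth division by a linear function -/

section Hadamard

theorem continuousOn_slice {E : Type} [TopologicalSpace E] {K : Set E} {F : Type} [TopologicalSpace F] {Φ : ℝ × E → F}
    (hΦ : ContinuousOn Φ (Icc 0 1 ×ˢ K)) {y : E} (hy : y ∈ K) :
    ContinuousOn (fun τ => Φ (τ, y)) (uIcc (0 : ℝ) 1) := by
  rw [uIcc_of_le zero_le_one]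
  exact hΦ.comp (f := fun τ => (τ, y)) (Continuous.prodMk_left y).continuousOn
    fun τ hτ => ⟨hτ, hy⟩

variable {E : Type} [NormedAddCommGroup E] [NormedSpace ℝ E] {K : Set E}

/-- Differentiation under the integral sign on a compact convex set. -/
theorem hasFDerivWithinAt_integral_of_continuousOn {F : Type} [NormedAddCommGroup F]
    [NormedSpace ℝ F] [CompleteSpace F] (hK : IsCompact K) (hKc : Convex ℝ K) {Φ : ℝ → E → F}
    {Φ' : ℝ → E → E →L[ℝ] F}
    (hΦ : ContinuousOn (fun p : ℝ × E => Φ p.1 p.2) (Icc 0 1 ×ˢ K))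
    (hΦ' : ContinuousOn (fun p : ℝ × E => Φ' p.1 p.2) (Icc 0 1 ×ˢ K))
    (hd : ∀ τ ∈ Icc (0 : ℝ) 1, ∀ x ∈ K, HasFDerivWithinAt (Φ τ) (Φ' τ x) K x) {y : E}
    (hy : y ∈ K) :
    HasFDerivWithinAt (fun x => ∫ τ in (0 : ℝ)..1, Φ τ x) (∫ τ in (0 : ℝ)..1, Φ' τ y) K y := by
  have hi : ∀ x ∈ K, IntervalIntegrable (fun τ => Φ τ x) volume 0 1 := fun x hx =>
    (continuousOn_slice hΦ hx).intervalIntegrable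
  have hi' : IntervalIntegrable (fun τ => Φ' τ y) volume 0 1 :=
    (continuousOn_slice hΦ' hy).intervalIntegrable
  have huc := (isCompact_Icc.prod hK).uniformContinuousOn_of_continuous hΦ'
  rw [Metric.uniformContinuousOn_iff] at huc
  rw [hasFDerivWithinAt_iff_isLittleO, Asymptotics.isLittleO_iff]
  intro ε hε
  obtain ⟨δ, hδ, h⟩ := huc ε hε
  have hball : Metric.ball y δ ∈ nhdsWithin y K := mem_nhdsWithin_of_mem_nhds
    (Metric.ball_mem_nhds y hδ)
  filter_upwards [hball, self_mem_nhdsWithin] with x hx hxK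
  -- The mean value inequality on the convex set `K ∩ ball y δ`. Uniform continuity of `Φ'` on the
  -- compact product makes the estimate uniform in `τ`, so it can be integrated.
  have key : ∀ τ ∈ Icc (0 : ℝ) 1, ‖Φ τ x - Φ τ y - Φ' τ y (x - y)‖ ≤ ε * ‖x - y‖ := fun τ hτ =>
    (hKc.inter (convex_ball y δ)).norm_image_sub_le_of_norm_hasFDerivWithin_le'
      (fun z hz => (hd τ hτ z hz.1).mono inter_subset_left)
      (fun z hz => by
        rw [← dist_eq_norm]
        exact (h (τ, z) ⟨hτ, hz.1⟩ (τ, y) ⟨hτ, hy⟩ (by simpa [Prod.dist_eq] using hz.2)).le)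
      ⟨hy, Metric.mem_ball_self hδ⟩ ⟨hxK, hx⟩
  have h1 : (∫ τ in (0 : ℝ)..1, Φ τ x) - (∫ τ in (0 : ℝ)..1, Φ τ y) -
      (∫ τ in (0 : ℝ)..1, Φ' τ y) (x - y) =
      ∫ τ in (0 : ℝ)..1, (Φ τ x - Φ τ y - Φ' τ y (x - y)) := by
    rw [ContinuousLinearMap.intervalIntegral_apply hi', intervalIntegral.integral_sub
      ((hi x hxK).sub (hi y hy)) ?_, intervalIntegral.integral_sub (hi x hxK) (hi y hy)]
    exact ((continuousOn_slice hΦ' hy).clm_apply continuousOn_const).intervalIntegrable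
  rw [h1]
  have h2 := intervalIntegral.norm_integral_le_of_norm_le_const (a := (0 : ℝ)) (b := 1)
    (f := fun τ => Φ τ x - Φ τ y - Φ' τ y (x - y)) (C := ε * ‖x - y‖) fun τ hτ => by
      rw [uIoc_of_le zero_le_one] at hτ
      exact key τ ⟨hτ.1.le, hτ.2⟩
  simpa using h2

/-- The contraction `y - τ ℓ(y) ν` towards the kernel of `ℓ`. -/
def contraction (ℓ : E →L[ℝ] ℝ) (ν : E) (τ : ℝ) : E →L[ℝ] E :=
  ContinuousLinearMap.id ℝ E - τ • ℓ.smulRight ν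

variable {ℓ : E →L[ℝ] ℝ} {ν : E}

theorem contraction_apply (τ : ℝ) (y : E) : contraction ℓ ν τ y = y - (τ * ℓ y) • ν := by
  simp [contraction, mul_smul]

theorem continuous_contraction :
    Continuous fun p : ℝ × E => contraction ℓ ν p.1 p.2 := by
  simp only [contraction_apply]
  fun_prop

variable (hK : IsCompact K) (hKc : Convex ℝ K) (hu : UniqueDiffOn ℝ K)
  (hπ : ∀ τ ∈ Icc (0 : ℝ) 1, MapsTo (contraction ℓ ν τ) K K)

include hK hKc hu hπ

/-- Differentiating the integrand gives `c Dg - c τ (Dg ν) ⊗ ℓ` at the contracted point, which is a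
difference of two integrands of the same kind. The weight `c` and the arbitrary target space `F` are
there so that this induction closes. -/
theorem contDiffOn_integral_contraction (m : ℕ) : ∀ {F : Type} [NormedAddCommGroup F]
    [NormedSpace ℝ F] [CompleteSpace F] {c : ℝ → ℝ} {g : E → F}, Continuous c →
    ContDiffOn ℝ ∞ g K →
    ContDiffOn ℝ m (fun y => ∫ τ in (0 : ℝ)..1, c τ • g (contraction ℓ ν τ y)) K := by
  have hmt : MapsTo (fun p : ℝ × E => contraction ℓ ν p.1 p.2) (Icc 0 1 ×ˢ K) K :=
    fun p hp => hπ p.1 hp.1 hp.2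
  have hcont : ∀ {F : Type} [NormedAddCommGroup F] [NormedSpace ℝ F] {c : ℝ → ℝ} {g : E → F},
      Continuous c → ContinuousOn g K →
      ContinuousOn (fun p : ℝ × E => c p.1 • g (contraction ℓ ν p.1 p.2)) (Icc 0 1 ×ˢ K) :=
    fun hc hg => (hc.comp continuous_fst).continuousOn.smul
      (hg.comp continuous_contraction.continuousOn hmt)
  induction m with
  | zero =>
    intro F _ _ _ c g hc hg
    have hg' : ContinuousOn (fderivWithin ℝ g K) K := hg.continuousOn_fderivWithin hu (by simp)
    refine contDiffOn_zero.2 fun y hy => ?_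
    refine (hasFDerivWithinAt_integral_of_continuousOn hK hKc (hcont hc hg.continuousOn)
      (Φ' := fun τ y => c τ • (fderivWithin ℝ g K (contraction ℓ ν τ y)).comp (contraction ℓ ν τ))
      ?_ (fun τ hτ x hx => ?_) hy).continuousWithinAt
    · refine (hc.comp continuous_fst).continuousOn.smul
        ((hg'.comp continuous_contraction.continuousOn hmt).clm_comp ?_)
      exact (by unfold contraction; fun_prop : Continuous fun p : ℝ × E =>
        contraction ℓ ν p.1).continuousOn
    · exact (((hg.differentiableOn (by simp) _ (hπ τ hτ hx)).hasFDerivWithinAt.comp x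
        (contraction ℓ ν τ).hasFDerivWithinAt (hπ τ hτ)).const_smul (c τ))
  | succ m ih =>
    intro F _ _ _ c g hc hg
    have hg' : ContDiffOn ℝ ∞ (fderivWithin ℝ g K) K := hg.fderivWithin hu (by simp)
    -- `P L = (L ν) ⊗ ℓ`, the correction that comes from differentiating the contraction `id - τ ℓ ⊗
    -- ν`.
    let P : (E →L[ℝ] F) →L[ℝ] (E →L[ℝ] F) :=
      (ContinuousLinearMap.compL ℝ E E F).flip (ℓ.smulRight ν)
    have hPg' : ContDiffOn ℝ ∞ (fun y => P (fderivWithin ℝ g K y)) K := P.contDiff.comp_contDiffOn hg'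
    have hd : ∀ y ∈ K, HasFDerivWithinAt (fun y => ∫ τ in (0 : ℝ)..1, c τ • g (contraction ℓ ν τ y))
        ((∫ τ in (0 : ℝ)..1, c τ • fderivWithin ℝ g K (contraction ℓ ν τ y)) -
          ∫ τ in (0 : ℝ)..1, (c τ * τ) • P (fderivWithin ℝ g K (contraction ℓ ν τ y))) K y := by
      intro y hy
      have c1 := hcont hc hg'.continuousOn
      have c2 := hcont (hc.mul continuous_id) hPg'.continuousOn
      refine HasFDerivWithinAt.congr_fderiv ?_ (intervalIntegral.integral_sub
        (continuousOn_slice c1 hy).intervalIntegrable (continuousOn_slice c2 hy).intervalIntegrable)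
      refine hasFDerivWithinAt_integral_of_continuousOn hK hKc (hcont hc hg.continuousOn)
        (Φ' := fun τ y => c τ • fderivWithin ℝ g K (contraction ℓ ν τ y) -
          (c τ * τ) • P (fderivWithin ℝ g K (contraction ℓ ν τ y))) (c1.sub c2)
        (fun τ hτ x hx => ?_) hy
      have := (((hg.differentiableOn (by simp) _ (hπ τ hτ hx)).hasFDerivWithinAt.comp x
        (contraction ℓ ν τ).hasFDerivWithinAt (hπ τ hτ)).const_smul (c τ))
      refine this.congr_fderiv ?_
      ext w
      simp [P, contraction, smul_sub, mul_smul]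
    rw [Nat.cast_succ, contDiffOn_succ_iff_fderivWithin hu]
    refine ⟨fun y hy => (hd y hy).differentiableWithinAt, by simp, ?_⟩
    refine ((ih hc hg').sub (ih (hc.mul continuous_id) hPg')).congr fun y hy => ?_
    rw [(hd y hy).fderivWithin (hu y hy)]
    rfl

/-- Hadamard's lemma: a smooth function which vanishes where `ℓ` vanishes is divisible by `ℓ`. -/
theorem exists_eq_mul_of_eq_zero (hν : ℓ ν = 1) {g : E → ℝ} (hg : ContDiffOn ℝ ∞ g K)
    (h0 : ∀ y ∈ K, ℓ y = 0 → g y = 0) :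
    ∃ B : E → ℝ, ContDiffOn ℝ ∞ B K ∧ ∀ y ∈ K, g y = ℓ y * B y := by
  have hg' : ContDiffOn ℝ ∞ (fun y => fderivWithin ℝ g K y ν) K :=
    (hg.fderivWithin hu (by simp)).clm_apply contDiffOn_const
  -- The fundamental theorem of calculus along `τ ↦ y - τ ℓ(y) ν`: the derivative of `g` is `-ℓ(y)
  -- ∂_ν g`, and at `τ = 1` the path reaches the kernel of `ℓ`, where `g` vanishes.
  refine ⟨fun y => ∫ τ in (0 : ℝ)..1, (1 : ℝ) • fderivWithin ℝ g K (contraction ℓ ν τ y) ν,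
    contDiffOn_infty.2 fun m => contDiffOn_integral_contraction hK hKc hu hπ m continuous_const hg',
    fun y hy => ?_⟩
  have hline : ∀ τ, HasDerivAt (fun τ => contraction ℓ ν τ y) (-(ℓ y • ν)) τ := fun τ => by
    simp only [contraction_apply]
    have : HasDerivAt (fun τ : ℝ => (τ * ℓ y) • ν) (ℓ y • ν) τ := by
      simpa using ((hasDerivAt_id τ).mul_const (ℓ y)).smul_const ν
    exact this.const_sub y
  have hc : ContinuousOn (fun τ => contraction ℓ ν τ y) (Icc (0 : ℝ) 1) :=
    fun τ _ => (hline τ).continuousAt.continuousWithinAt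
  have hmt : MapsTo (fun τ => contraction ℓ ν τ y) (Icc (0 : ℝ) 1) K := fun τ hτ => hπ τ hτ hy
  have hd : ∀ τ ∈ Ioo (0 : ℝ) 1, HasDerivAt (fun τ => g (contraction ℓ ν τ y))
      (-ℓ y * fderivWithin ℝ g K (contraction ℓ ν τ y) ν) τ := fun τ hτ => by
    have := (hg.differentiableOn (by simp) _ (hmt ⟨hτ.1.le, hτ.2.le⟩)).hasFDerivWithinAt
      |>.comp_hasDerivWithinAt τ (hline τ).hasDerivWithinAt hmt
    exact (this.hasDerivAt (Icc_mem_nhds hτ.1 hτ.2)).congr_deriv (by simp)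
  have hi : IntervalIntegrable (fun τ => -ℓ y * fderivWithin ℝ g K (contraction ℓ ν τ y) ν)
      volume 0 1 := by
    refine ContinuousOn.intervalIntegrable ?_
    rw [uIcc_of_le zero_le_one]
    exact continuousOn_const.mul (hg'.continuousOn.comp hc hmt)
  have h1 := intervalIntegral.integral_eq_sub_of_hasDerivAt_of_le zero_le_one
    (hg.continuousOn.comp hc hmt) hd hi
  rw [intervalIntegral.integral_const_mul] at h1
  have h2 : g (contraction ℓ ν 1 y) = 0 := h0 _ (hmt ⟨zero_le_one, le_rfl⟩) (by
    simp [contraction_apply, hν])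
  have h3 : contraction ℓ ν 0 y = y := by simp [contraction_apply]
  simp only [Function.comp_apply, h2, h3] at h1
  simp only [one_smul]
  linarith

end Hadamard

end

section

variable {n : ℕ} {S t : Set (Eu n)} {p y : Eu n} {G : Eu n → Matrix (Fin n) (Fin n) ℝ}
  {f v u w : Eu n → ℝ}

/-! ### Unique continuation -/

theorem RelOpen.hasDerivWithinAt_segment (h : RelOpen S t) {F : Eu n → ℝ}
    (hF : ContDiffOn ℝ ∞ F t) {x : Eu n} {A : Set ℝ}
    (hm : ∀ τ ∈ A, y + τ • x ∈ t) {τ : ℝ} (hτ : τ ∈ A) :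
    HasDerivWithinAt (fun τ : ℝ => F (y + τ • x)) (∑ k, x k * Perelman.pd S k F (y + τ • x)) A
      τ := by
  have h1 : HasDerivAt (fun τ : ℝ => y + τ • x) x τ := by
    simpa using ((hasDerivAt_id τ).smul_const x).const_add y
  have h2 := (h.diff hF (hm τ hτ)).hasFDerivWithinAt.comp_hasDerivWithinAt τ h1.hasDerivWithinAt
    fun σ hσ => h.sub (hm σ hσ)
  have h3 : ∀ L : Eu n →L[ℝ] ℝ, L x = ∑ k, x k * L (EuclideanSpace.single k 1) := fun L => by
    conv_lhs => rw [← sum_smul_single x]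
    simp
  exact h2.congr_deriv (h3 _)

/-- Since the Hessian of `v` is linear in `v` and `dv` with locally bounded coefficients, the 1-jet
of `v` solves a linear differential inequality along each segment from `y`, and Grönwall keeps it
zero. Convexity of `S` keeps the segments inside `S`, also at boundary points. -/
theorem IsKer.eventually_eq_zero (h : IsKer S t G f v) (hn : 2 ≤ n) (hS : Convex ℝ S) (hy : y ∈ t)
    (hv : v y = 0) (hdv : ∀ i, Perelman.pd S i v y = 0) :
    ∀ᶠ z in nhdsWithin y S, v z = 0 := by
  choose a b ha hb hab using fun i j => h.isFirstOrder_hess hn i j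
  have hbd : ∀ {F : Eu n → ℝ}, ContinuousOn F t → ∃ C : ℝ, ∀ᶠ z in nhdsWithin y S, |F z| ≤ C :=
    fun {F} hF => ⟨|F y| + 1, by
      have h1 : ContinuousWithinAt F S y := (hF y hy).mono_of_mem_nhdsWithin (h.nhds y hy)
      filter_upwards [h1.abs.eventually (gt_mem_nhds (lt_add_one |F y|))] with z hz using hz.le⟩
  choose A hA using fun i j k => hbd (ha i j k)
  choose B hB using fun i j => hbd (hb i j)
  -- A crude common bound near `y` for all coefficients of the Hessian expressions; absolute values
  -- also make it nonnegative.
  set C := (∑ i, ∑ j, ∑ k, |A i j k|) + ∑ i, ∑ j, |B i j| with hC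
  have hAC : ∀ i j k, A i j k ≤ C := fun i j k => by
    have h1 : |A i j k| ≤ ∑ i, ∑ j, ∑ k, |A i j k| :=
      (Finset.single_le_sum (f := fun k => |A i j k|) (fun _ _ => abs_nonneg _)
        (Finset.mem_univ k)).trans <|
      (Finset.single_le_sum (f := fun j => ∑ k, |A i j k|) (fun _ _ => by positivity)
        (Finset.mem_univ j)).trans <|
      Finset.single_le_sum (f := fun i => ∑ j, ∑ k, |A i j k|) (fun _ _ => by positivity)
        (Finset.mem_univ i)
    have h2 : 0 ≤ ∑ i, ∑ j, |B i j| := by positivity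
    linarith [le_abs_self (A i j k)]
  have hBC : ∀ i j, B i j ≤ C := fun i j => by
    have h1 : |B i j| ≤ ∑ i, ∑ j, |B i j| :=
      (Finset.single_le_sum (f := fun j => |B i j|) (fun _ _ => abs_nonneg _)
        (Finset.mem_univ j)).trans <|
      Finset.single_le_sum (f := fun i => ∑ j, |B i j|) (fun _ _ => by positivity)
        (Finset.mem_univ i)
    have h2 : 0 ≤ ∑ i, ∑ j, ∑ k, |A i j k| := by positivity
    linarith [le_abs_self (B i j)]
  have hC0 : 0 ≤ C := by positivity
  have hev : ∀ᶠ z in nhdsWithin y S, z ∈ t ∧ (∀ i j k, |a i j k z| ≤ C) ∧ ∀ i j, |b i j z| ≤ C :=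
    (show ∀ᶠ z in nhdsWithin y S, z ∈ t from h.nhds y hy).and ((Filter.eventually_all.2 fun i => Filter.eventually_all.2 fun j =>
      Filter.eventually_all.2 fun k => (hA i j k).mono fun z hz => hz.trans (hAC i j k)).and
      (Filter.eventually_all.2 fun i => Filter.eventually_all.2 fun j =>
        (hB i j).mono fun z hz => hz.trans (hBC i j)))
  obtain ⟨r, hr, hball⟩ := Metric.mem_nhdsWithin_iff.1 hev
  filter_upwards [self_mem_nhdsWithin, mem_nhdsWithin_of_mem_nhds (Metric.ball_mem_nhds y hr)]
    with z hzS hz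
  set x := z - y with hx
  have hyB : y ∈ Metric.ball y r ∩ S := ⟨Metric.mem_ball_self hr, h.sub hy⟩
  have hseg : ∀ τ ∈ Icc (0 : ℝ) 1, y + τ • x ∈ Metric.ball y r ∩ S := fun τ hτ => by
    refine (((convex_ball y r).inter hS).segment_subset hyB ⟨hz, hzS⟩) ?_
    rw [segment_eq_image']
    exact ⟨τ, hτ, rfl⟩
  have hmt : ∀ τ ∈ Icc (0 : ℝ) 1, y + τ • x ∈ t := fun τ hτ => (hball (hseg τ hτ)).1
  set R := ‖x‖ with hR
  have hxk : ∀ k, |x k| ≤ R := fun k => by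
    simpa using PiLp.norm_apply_le x k
  set Φ : ℝ → ℝ × (Fin n → ℝ) := fun τ => (v (y + τ • x), fun i => Perelman.pd S i v (y + τ • x))
    with hΦ
  set Φ' : ℝ → ℝ × (Fin n → ℝ) := fun τ => (∑ k, x k * Perelman.pd S k v (y + τ • x),
    fun i => ∑ k, x k * Perelman.pd S k (Perelman.pd S i v) (y + τ • x)) with hΦ'
  have hd : ∀ τ ∈ Icc (0 : ℝ) 1, HasDerivWithinAt Φ (Φ' τ) (Icc 0 1) τ := fun τ hτ =>
    (h.hasDerivWithinAt_segment h.smooth_v hmt hτ).prodMk (hasDerivWithinAt_pi.2 fun i =>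
      h.hasDerivWithinAt_segment (h.pd h.smooth_v i) hmt hτ)
  -- In the Grönwall constant, `n * R` bounds the contraction with the direction `x`. The `1`
  -- accounts for the derivative of `v`, and `C * (n + 1)` for the derivatives of the partials of
  -- `v`.
  have key := eq_zero_of_abs_deriv_le_mul_abs_self_of_eq_zero_right (f := Φ) (f' := Φ')
    (K := n * R * (1 + C * (n + 1))) (a := 0) (b := 1)
    (fun τ hτ => (hd τ hτ).continuousWithinAt)
    (fun τ hτ => (hd τ ⟨hτ.1, hτ.2.le⟩).mono_of_mem_nhdsWithin (Icc_mem_nhdsGE_of_mem hτ))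
    (by simp [hΦ, hv, hdv]; rfl) (fun τ hτ => ?_) 1 ⟨zero_le_one, le_rfl⟩
  · have h1 : v (y + (1 : ℝ) • x) = 0 := congrArg Prod.fst key
    simpa [hx] using h1
  · have hτ' : τ ∈ Icc (0 : ℝ) 1 := ⟨hτ.1, hτ.2.le⟩
    obtain ⟨-, b1, b2⟩ := hball (hseg τ hτ')
    set q := y + τ • x with hq
    have n1 : |v q| ≤ ‖Φ τ‖ := norm_fst_le (Φ τ)
    have n2 : ∀ i, |Perelman.pd S i v q| ≤ ‖Φ τ‖ := fun i =>
      (norm_le_pi_norm (Φ τ).2 i).trans (norm_snd_le (Φ τ))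
    have hH : ∀ i j, |Perelman.pd S i (Perelman.pd S j v) q| ≤ C * (n + 1) * ‖Φ τ‖ := fun i j => by
      rw [hab i j q (hmt τ hτ')]
      have c1 : |∑ k, a i j k q * Perelman.pd S k v q| ≤ n * (C * ‖Φ τ‖) := by
        refine (Finset.abs_sum_le_sum_abs _ _).trans ((Finset.sum_le_card_nsmul _ _ (C * ‖Φ τ‖)
          fun k _ => ?_).trans_eq (by simp))
        rw [abs_mul]
        exact mul_le_mul (b1 i j k) (n2 k) (abs_nonneg _) hC0
      have c2 : |b i j q * v q| ≤ C * ‖Φ τ‖ := by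
        rw [abs_mul]
        exact mul_le_mul (b2 i j) n1 (abs_nonneg _) hC0
      calc _ ≤ _ := abs_add_le _ _
        _ ≤ n * (C * ‖Φ τ‖) + C * ‖Φ τ‖ := add_le_add c1 c2
        _ = _ := by ring
    have hsum : ∀ (F : Fin n → ℝ) (D : ℝ), (∀ k, |F k| ≤ D) → |∑ k, x k * F k| ≤ n * R * D :=
      fun F D hF => by
        refine (Finset.abs_sum_le_sum_abs _ _).trans ((Finset.sum_le_card_nsmul _ _ (R * D)
          fun k _ => ?_).trans_eq (by simp [mul_assoc]))
        rw [abs_mul]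
        exact mul_le_mul (hxk k) (hF k) (abs_nonneg _) (norm_nonneg _)
    have hN := norm_nonneg (Φ τ)
    have hR0 : 0 ≤ R := norm_nonneg x
    refine max_le ?_ ((pi_norm_le_iff_of_nonneg (by positivity)).2 fun i => ?_)
    · refine (hsum _ _ n2).trans ?_
      rw [mul_assoc _ (1 + _)]
      refine mul_le_mul_of_nonneg_left ?_ (by positivity)
      have : 0 ≤ C * (n + 1) * ‖Φ τ‖ := by positivity
      linarith
    · refine (hsum _ _ fun k => hH k i).trans ?_
      rw [mul_assoc _ (1 + _)]
      refine mul_le_mul_of_nonneg_left ?_ (by positivity)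
      linarith

end

section

variable {n : ℕ} {S t : Set (Eu n)} {p : Eu n} {u w : Eu n → ℝ}

/-! ### Local division by a function with nonvanishing differential on its zero set -/

/-- Compact convex neighbourhoods which are stable under the contraction. -/
theorem exists_stable_nhds {E : Type} [NormedAddCommGroup E] [NormedSpace ℝ E]
    [FiniteDimensional ℝ E] {S t : Set E} {p : E} {ℓ : E →L[ℝ] ℝ} {ν : E} (hν : ℓ ν = 1)
    (hS : Convex ℝ S) (hSc : IsClosed S) (hSd : S ⊆ closure (interior S))
    (hπ : ∀ τ ∈ Icc (0 : ℝ) 1, MapsTo (contraction ℓ ν τ) S S) (hp : p ∈ S) (hℓ : ℓ p = 0)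
    (ht : t ∈ nhdsWithin p S) :
    ∃ K ⊆ t, K ∈ nhdsWithin p S ∧ IsCompact K ∧ Convex ℝ K ∧ UniqueDiffOn ℝ K ∧
      ∀ τ ∈ Icc (0 : ℝ) 1, MapsTo (contraction ℓ ν τ) K K := by
  obtain ⟨r, hr, hball⟩ := Metric.mem_nhdsWithin_iff.1 ht
  have hν0 : 0 ≤ ‖ν‖ := norm_nonneg ν
  -- Every point satisfies `y = P y + ℓ(y) ν`. Bounding both parts by `δ` therefore keeps `y` within
  -- `δ (1 + ‖ν‖) = r / 2` of `p`.
  set δ := r / (2 * (1 + ‖ν‖)) with hδ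
  have hδ0 : 0 < δ := by positivity
  have hδr : δ + δ * ‖ν‖ < r := by
    have : δ + δ * ‖ν‖ = r / 2 := by
      rw [hδ]
      field_simp
    linarith
  let P : E →L[ℝ] E := contraction ℓ ν 1
  have hPp : P p = p := by simp [P, contraction_apply, hℓ]
  -- A box in the splitting of the space into the kernel of `ℓ` and the line of `ν`. The contraction
  -- fixes the `P`-part and shrinks the `ℓ`-part, so it preserves the box.
  set K := S ∩ (ℓ ⁻¹' Metric.closedBall 0 δ ∩ P ⁻¹' Metric.closedBall p δ) with hK
  have hKr : K ⊆ Metric.ball p r := fun y hy => by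
    have h1 : ‖ℓ y‖ ≤ δ := by simpa using hy.2.1
    have h2 : ‖P y - p‖ ≤ δ := by simpa [dist_eq_norm] using hy.2.2
    have h3 : y - p = (P y - p) + ℓ y • ν := by
      simp only [P, contraction_apply, one_mul]
      abel
    rw [Metric.mem_ball, dist_eq_norm, h3]
    refine (norm_add_le _ _).trans_lt (lt_of_le_of_lt (add_le_add h2 ?_) hδr)
    rw [norm_smul]
    exact mul_le_mul_of_nonneg_right h1 hν0
  have hKc : IsClosed K := hSc.inter ((Metric.isClosed_closedBall.preimage ℓ.continuous).inter
    (Metric.isClosed_closedBall.preimage P.continuous))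
  set V := ℓ ⁻¹' Metric.ball 0 δ ∩ P ⁻¹' Metric.ball p δ with hV
  have hVo : IsOpen V := (Metric.isOpen_ball.preimage ℓ.continuous).inter
    (Metric.isOpen_ball.preimage P.continuous)
  have hpV : p ∈ V := by
    refine ⟨?_, ?_⟩
    · simpa [hℓ] using hδ0
    · simpa [hPp] using hδ0
  have hVK : S ∩ V ⊆ K := inter_subset_inter_right _ (inter_subset_inter
    (preimage_mono Metric.ball_subset_closedBall) (preimage_mono Metric.ball_subset_closedBall))
  have hKconv : Convex ℝ K := hS.inter (((convex_closedBall 0 δ).is_linear_preimage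
    ℓ.toLinearMap.isLinear).inter ((convex_closedBall p δ).is_linear_preimage
    P.toLinearMap.isLinear))
  refine ⟨K, fun y hy => hball ⟨hKr hy, hy.1⟩, ?_, ?_, hKconv, ?_, fun τ hτ y hy => ⟨hπ τ hτ hy.1, ?_, ?_⟩⟩
  · exact Filter.mem_of_superset (Filter.inter_mem self_mem_nhdsWithin
      (mem_nhdsWithin_of_mem_nhds (hVo.mem_nhds hpV))) hVK
  · exact (isCompact_closedBall p r).of_isClosed_subset hKc
      (hKr.trans Metric.ball_subset_closedBall)
  · refine uniqueDiffOn_convex hKconv ?_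
    obtain ⟨z, hzV, hzS⟩ := mem_closure_iff.1 (hSd hp) V hVo hpV
    exact ⟨z, mem_interior.2 ⟨interior S ∩ V, fun x hx => hVK ⟨interior_subset hx.1, hx.2⟩,
      isOpen_interior.inter hVo, hzS, hzV⟩⟩
  · have h1 : |ℓ y| ≤ δ := by simpa using hy.2.1
    have h2 : ℓ (contraction ℓ ν τ y) = (1 - τ) * ℓ y := by
      simp [contraction_apply, hν]
      ring
    simp only [mem_preimage, Metric.mem_closedBall, dist_zero_right, Real.norm_eq_abs, h2, abs_mul]
    rw [abs_of_nonneg (by linarith [hτ.2])]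
    exact (mul_le_of_le_one_left (abs_nonneg _) (by linarith [hτ.1])).trans h1
  · have h2 : P (contraction ℓ ν τ y) = P y := by
      simp only [P, contraction_apply, map_sub, map_smul, hν, mul_one, one_mul]
      module
    rw [mem_preimage, h2]
    exact hy.2.2

/-- Division near an interior zero. -/
theorem exists_local_quotient_of_isOpen {U : Set (Eu n)} (hU : IsOpen U)
    (hu : ContDiffOn ℝ ∞ u U) (hw : ContDiffOn ℝ ∞ w U) (h0 : ∀ z ∈ U, u z = 0 → w z = 0)
    (hp : p ∈ U) (hup : u p = 0) (hdu : fderiv ℝ u p ≠ 0) :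
    ∃ (b : Eu n → ℝ) (O : Set (Eu n)), IsOpen O ∧ p ∈ O ∧ O ⊆ U ∧ ContDiffOn ℝ ∞ b O ∧
      ∀ z ∈ O, w z = b z * u z := by
  set ℓ := fderiv ℝ u p with hℓ
  obtain ⟨ν₀, hν₀⟩ : ∃ x, ℓ x ≠ 0 := by
    by_contra! h
    exact hdu (ContinuousLinearMap.ext h)
  set ν := (ℓ ν₀)⁻¹ • ν₀ with hνdef
  have hν : ℓ ν = 1 := by simp [hνdef, hν₀]
  -- A change of coordinates with `ℓ ∘ Ψ = u` and derivative the identity at `p`; it makes `u` a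
  -- linear function.
  set Ψ : Eu n → Eu n := fun y => y + (u y - ℓ y) • ν with hΨ
  have hΨs : ContDiffOn ℝ ∞ Ψ U := contDiffOn_id.add
    ((hu.sub ℓ.contDiff.contDiffOn).smul contDiffOn_const)
  have hℓΨ : ∀ y, ℓ (Ψ y) = u y := fun y => by simp [hΨ, hν]
  have hΨp : HasFDerivAt Ψ ((ContinuousLinearEquiv.refl ℝ (Eu n) : Eu n ≃L[ℝ] Eu n) :
      Eu n →L[ℝ] Eu n) p := by
    have hd : HasFDerivAt u ℓ p :=
      ((hu.contDiffAt (hU.mem_nhds hp)).differentiableAt (by simp)).hasFDerivAt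
    refine ((hasFDerivAt_id p).add ((hd.sub ℓ.hasFDerivAt).smul_const ν)).congr_fderiv ?_
    ext x
    simp
  set e := (hΨs.contDiffAt (hU.mem_nhds hp)).toOpenPartialHomeomorph Ψ hΨp (by simp) with he
  have hpe : p ∈ e.source := ContDiffAt.mem_toOpenPartialHomeomorph_source _ hΨp (by simp)
  have heΨ : ∀ y, e y = Ψ y := fun y => rfl
  have hc : ContinuousAt (fderiv ℝ Ψ) p :=
    (hΨs.continuousOn_fderiv_of_isOpen hU (by simp)).continuousAt (hU.mem_nhds hp)
  -- The inverse is smooth only at points where the derivative of `Ψ` is invertible, and this is an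
  -- open condition holding at `p`.
  have hev : ∀ᶠ y in nhds p, y ∈ U ∧ fderiv ℝ Ψ y ∈
      range ((↑) : (Eu n ≃L[ℝ] Eu n) → (Eu n →L[ℝ] Eu n)) :=
    (hU.eventually_mem hp).and (hc.eventually (by
      rw [hΨp.fderiv]
      exact ContinuousLinearEquiv.nhds _))
  obtain ⟨U', hU'sub, hU', hpU'⟩ := mem_nhds_iff.1 hev
  set V := e.target ∩ e.symm ⁻¹' U' with hV
  have hVo : IsOpen V := e.symm.isOpen_inter_preimage hU'
  have hq : e p ∈ V := ⟨e.map_source hpe, by rw [mem_preimage, e.left_inv hpe]; exact hpU'⟩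
  have hinv : ContDiffOn ℝ ∞ e.symm V := fun q hq => by
    obtain ⟨hy, L, hL⟩ := hU'sub hq.2
    have hs := hΨs.contDiffAt (hU.mem_nhds hy)
    refine (e.contDiffAt_symm (f₀' := L) hq.1 ?_ hs).contDiffWithinAt
    rw [hL]
    exact (hs.differentiableAt (by simp)).hasFDerivAt
  have hg : ContDiffOn ℝ ∞ (w ∘ e.symm) V := hw.comp hinv fun q hq => (hU'sub hq.2).1
  obtain ⟨K, hKV, hKn, hKc, hKconv, hKu, hKπ⟩ := exists_stable_nhds (S := univ) (t := V) hν
    convex_univ isClosed_univ (by simp) (fun _ _ _ _ => mem_univ _) (mem_univ (e p))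
    (by rw [heΨ, hℓΨ, hup]) (mem_nhdsWithin_of_mem_nhds (hVo.mem_nhds hq))
  rw [nhdsWithin_univ] at hKn
  obtain ⟨B, hB, hgB⟩ := exists_eq_mul_of_eq_zero hKc hKconv hKu hKπ hν (hg.mono hKV)
    fun q hq hq0 => h0 _ (hU'sub (hKV hq).2).1 (by
      rw [← hℓΨ, ← heΨ, e.right_inv (hKV hq).1, hq0])
  refine ⟨B ∘ Ψ, U ∩ (e.source ∩ e ⁻¹' interior K),
    hU.inter (e.isOpen_inter_preimage isOpen_interior), ⟨hp, hpe, mem_interior_iff_mem_nhds.2 hKn⟩,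
    inter_subset_left, hB.comp (hΨs.mono inter_subset_left) fun y hy => interior_subset hy.2.2,
    fun z hz => ?_⟩
  have h1 := hgB (e z) (interior_subset hz.2.2)
  rw [Function.comp_apply, e.left_inv hz.2.1, heΨ, hℓΨ] at h1
  rw [h1, Function.comp_apply, mul_comm]

theorem exists_isOpen_of_mem_nhdsWithin {E : Type} [TopologicalSpace E] {S A : Set E} {p : E}
    (hA : A ∈ nhdsWithin p S) : ∃ O, IsOpen O ∧ p ∈ O ∧ S ∩ O ⊆ A := by
  obtain ⟨O, hO, hp, h⟩ := mem_nhdsWithin.1 hA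
  exact ⟨O, hO, hp, fun z hz => h ⟨hz.2, hz.1⟩⟩

/-- Division near a boundary zero. -/
theorem RelOpen.exists_local_quotient_of_boundary (h : RelOpen S t) (hu : ContDiffOn ℝ ∞ u t)
    (hw : ContDiffOn ℝ ∞ w t) (h0 : ∀ z ∈ t, u z = 0 → w z = 0) (hp : p ∈ t)
    (hdu : ∃ i, Perelman.pd S i u p ≠ 0) (hSd : S ⊆ closure (interior S))
    {ℓ : Eu n →L[ℝ] ℝ} (hℓ : ℓ ≠ 0) (hS : S = {y | 0 ≤ ℓ y}) (hℓp : ℓ p = 0)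
    (hb : ∀ z ∈ t, ℓ z = 0 → u z = 0) :
    ∃ (b : Eu n → ℝ) (O : Set (Eu n)), IsOpen O ∧ p ∈ O ∧ S ∩ O ⊆ t ∧ ContDiffOn ℝ ∞ b (S ∩ O) ∧
      ∀ z ∈ S ∩ O, w z = b z * u z := by
  obtain ⟨ν₀, hν₀⟩ : ∃ x, ℓ x ≠ 0 := by
    by_contra! h
    exact hℓ (ContinuousLinearMap.ext h)
  set ν := (ℓ ν₀)⁻¹ • ν₀ with hνdef
  have hν : ℓ ν = 1 := by simp [hνdef, hν₀]
  obtain ⟨K, hKt, hKn, hKc, hKconv, hKu, hKπ⟩ := exists_stable_nhds (S := S) (t := t) hν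
    (by rw [hS]; exact convex_halfSpace_ge ℓ.toLinearMap.isLinear 0)
    (by rw [hS]; exact isClosed_le continuous_const ℓ.continuous) hSd (fun τ hτ y hy => by
      rw [hS, mem_ofPred_eq] at hy ⊢
      rw [contraction_apply, map_sub, map_smul, hν, smul_eq_mul, mul_one]
      nlinarith [hτ.1, hτ.2]) (h.sub hp) hℓp (h.nhds p hp)
  have hpK : p ∈ K := mem_of_mem_nhdsWithin (h.sub hp) hKn
  obtain ⟨A, hA, huA⟩ := exists_eq_mul_of_eq_zero hKc hKconv hKu hKπ hν (hu.mono hKt)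
    fun z hz hz0 => hb z (hKt hz) hz0
  obtain ⟨B, hB, hwB⟩ := exists_eq_mul_of_eq_zero hKc hKconv hKu hKπ hν (hw.mono hKt)
    fun z hz hz0 => h0 z (hKt hz) (hb z (hKt hz) hz0)
  -- From `u = ℓ A` and `ℓ p = 0`, the differential of `u` at `p` is `A(p) ℓ`, so it would vanish
  -- together with `A(p)`.
  have hAp : A p ≠ 0 := fun hA0 => by
    obtain ⟨i, hi⟩ := hdu
    refine hi ?_
    have hd : DifferentiableWithinAt ℝ A S p :=
      (hA.differentiableOn (by simp) p hpK).mono_of_mem_nhdsWithin hKn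
    rw [pd_congr_of_eventuallyEq (F' := fun z => ℓ z * A z) (Filter.mem_of_superset hKn huA)
      (h.sub hp), pd_mul (h.uniqueDiffWithinAt hp) ℓ.differentiableAt.differentiableWithinAt hd,
      hA0, hℓp, mul_zero, zero_mul, add_zero]
  have hn : K ∩ {z | A z ≠ 0} ∈ nhdsWithin p S := by
    refine Filter.inter_mem hKn ?_
    have : ContinuousWithinAt A S p := (hA.continuousOn p hpK).mono_of_mem_nhdsWithin hKn
    exact this.eventually_ne hAp
  obtain ⟨O, hO, hpO, hOK⟩ := exists_isOpen_of_mem_nhdsWithin hn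
  refine ⟨fun z => B z / A z, O, hO, hpO, fun z hz => hKt (hOK hz).1,
    (hB.mono fun z hz => (hOK hz).1).div (hA.mono fun z hz => (hOK hz).1) fun z hz => (hOK hz).2,
    fun z hz => ?_⟩
  rw [hwB z (hOK hz).1, huA z (hOK hz).1]
  have := (hOK hz).2
  simp only [mem_ofPred_eq] at this
  field_simp

/-- Three regimes: ordinary division where `u ≠ 0`, straightening `u` at an interior zero, and
division of both functions by `ℓ` at a boundary zero. -/
theorem RelOpen.exists_local_quotient (h : RelOpen S t) (hu : ContDiffOn ℝ ∞ u t)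
    (hw : ContDiffOn ℝ ∞ w t) (h0 : ∀ z ∈ t, u z = 0 → w z = 0) (hp : p ∈ t)
    (hdu : u p = 0 → ∃ i, Perelman.pd S i u p ≠ 0) (hSd : S ⊆ closure (interior S))
    (hS : S = univ ∨ ∃ ℓ : Eu n →L[ℝ] ℝ, ℓ ≠ 0 ∧ S = {y | 0 ≤ ℓ y})
    (hb : ∀ z ∈ t, z ∉ interior S → u z = 0) :
    ∃ (b : Eu n → ℝ) (O : Set (Eu n)), IsOpen O ∧ p ∈ O ∧ S ∩ O ⊆ t ∧ ContDiffOn ℝ ∞ b (S ∩ O) ∧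
      ∀ z ∈ S ∩ O, w z = b z * u z := by
  by_cases hup : u p = 0
  swap
  · have hn : t ∩ {z | u z ≠ 0} ∈ nhdsWithin p S := by
      refine Filter.inter_mem (h.nhds p hp) ?_
      have : ContinuousWithinAt u S p :=
        (hu.continuousOn p hp).mono_of_mem_nhdsWithin (h.nhds p hp)
      exact this.eventually_ne hup
    obtain ⟨O, hO, hpO, hOt⟩ := exists_isOpen_of_mem_nhdsWithin hn
    refine ⟨fun z => w z / u z, O, hO, hpO, fun z hz => (hOt hz).1,
      (hw.mono fun z hz => (hOt hz).1).div (hu.mono fun z hz => (hOt hz).1) fun z hz => (hOt hz).2,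
      fun z hz => ?_⟩
    have := (hOt hz).2
    simp only [mem_ofPred_eq] at this
    field_simp
  by_cases hpi : p ∈ interior S
  · have hU := h.isOpen_inter_interior
    obtain ⟨i, hi⟩ := hdu hup
    rw [pd_eq_fderiv (mem_interior_iff_mem_nhds.1 hpi)] at hi
    obtain ⟨b, O, hO, hpO, hOU, hbs, hbw⟩ := exists_local_quotient_of_isOpen hU
      (hu.mono inter_subset_left) (hw.mono inter_subset_left) (fun z hz => h0 z hz.1) ⟨hp, hpi⟩ hup
      fun h => hi (by rw [h]; rfl)
    exact ⟨b, O, hO, hpO, fun z hz => (hOU hz.2).1, hbs.mono inter_subset_right,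
      fun z hz => hbw z hz.2⟩
  · rcases hS with hS | ⟨ℓ, hℓ, hS⟩
    · simp [hS] at hpi
    have hint : ∀ z, 0 < ℓ z → z ∈ interior S := fun z hz => by
      rw [hS]
      exact mem_interior.2 ⟨{y | 0 < ℓ y}, fun y hy => (show 0 < ℓ y from hy).le,
        isOpen_lt continuous_const ℓ.continuous, hz⟩
    -- Moving from `z` in the direction `-ℓ(x) x` makes `ℓ` negative at once, so no neighbourhood of
    -- `z` lies in the half-space.
    have hint' : ∀ z, ℓ z = 0 → z ∉ interior S := fun z hz hzi => by
      obtain ⟨x, hx⟩ : ∃ x, ℓ x ≠ 0 := by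
        by_contra! h
        exact hℓ (ContinuousLinearMap.ext h)
      have hm : Filter.Tendsto (fun s : ℝ => z - s • ℓ x • x) (_root_.nhds 0) (_root_.nhds z) := by
        have : Continuous fun s : ℝ => z - s • ℓ x • x := by fun_prop
        simpa using this.tendsto 0
      have hev := (hm.eventually (show ∀ᶠ w in _root_.nhds z, w ∈ S from mem_interior_iff_mem_nhds.1 hzi)).filter_mono
        (nhdsWithin_le_nhds (s := Ioi (0 : ℝ)))
      obtain ⟨s, hs, hs0⟩ := (hev.and self_mem_nhdsWithin).exists
      rw [hS, mem_ofPred_eq, map_sub, map_smul, map_smul, hz, smul_eq_mul, smul_eq_mul] at hs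
      have : 0 < s * (ℓ x * ℓ x) := mul_pos hs0 (mul_self_pos.2 hx)
      linarith
    have hℓp : ℓ p = 0 := by
      have h1 : 0 ≤ ℓ p := by
        have := h.sub hp
        rwa [hS] at this
      exact h1.antisymm' (not_lt.1 fun h2 => hpi (hint p h2))
    exact h.exists_local_quotient_of_boundary hu hw h0 hp (hdu hup) hSd hℓ hS hℓp
      fun z hz hz0 => hb z hz (hint' z hz0)

end

/-! ### The two identities in coordinates -/

section

variable {n : ℕ} {S t : Set (Eu n)} {p : Eu n} {G : Eu n → Matrix (Fin n) (Fin n) ℝ}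
  {f v : Eu n → ℝ}

namespace IsKer

theorem driftLap_smooth' (h : IsKer S t G f v) :
    ContDiffOn ℝ ∞ (driftLap S G f fun z => Real.exp (f z) * v z) t :=
  h.driftLap_smooth h.smooth_f (h.smooth_f.exp.mul h.smooth_v)

/-- The first identity in coordinates. -/
theorem mul_pd_coordScal_eq (h : IsKer S t G f v) (m : Fin n) (hp : p ∈ t) :
    Real.exp (f p) * v p * Perelman.pd S m (coordScal S G f) p =
      2 * driftLap S G f (fun z => Real.exp (f z) * v z) p * Perelman.pd S m f p := by
  rw [h.driftLap_exp_mul hp h.smooth_f h.smooth_v]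
  have := h.mul_pd_coordScal m hp
  simp only at this
  linear_combination Real.exp (f p) * this

/-- If the drift Laplacian were nonzero at a zero of `v`, the first identity would force `df = 0`
there. Then the traced adjoint equation gives `Δv = 0`, which makes the drift Laplacian vanish after
all. -/
theorem driftLap_eq_zero (h : IsKer S t G f v) (hn : 2 ≤ n) (hp : p ∈ t) (hv : v p = 0) :
    driftLap S G f (fun z => Real.exp (f z) * v z) p = 0 := by
  by_contra hne
  have h1 : ∀ m, Perelman.pd S m f p = 0 := fun m => by
    have := h.mul_pd_coordScal_eq m hp
    rw [hv, mul_zero, zero_mul] at this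
    exact ((mul_eq_zero.1 this.symm).resolve_left (mul_ne_zero two_ne_zero hne))
  refine hne ?_
  rw [h.driftLap_exp_mul hp h.smooth_f h.smooth_v, h.lap_eq_zero hn hp hv h1, hv]
  simp [grad, h1]

/-- The drift Laplacian is locally a smooth multiple of the function. -/
theorem exists_local_quotient' (h : IsKer S t G f v) (hn : 2 ≤ n)
    (hS : S = univ ∨ ∃ ℓ : Eu n →L[ℝ] ℝ, ℓ ≠ 0 ∧ S = {y | 0 ≤ ℓ y}) (hp : p ∈ t)
    (hb : ∀ z ∈ t, z ∉ interior S → v z = 0) (hne : ¬∀ᶠ z in nhdsWithin p S, v z = 0) :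
    ∃ (b : Eu n → ℝ) (O : Set (Eu n)), IsOpen O ∧ p ∈ O ∧ S ∩ O ⊆ t ∧ ContDiffOn ℝ ∞ b (S ∩ O) ∧
      ∀ z ∈ S ∩ O, driftLap S G f (fun z => Real.exp (f z) * v z) z =
        b z * (Real.exp (f z) * v z) := by
  have hconv : Convex ℝ S := by
    rcases hS with hS | ⟨ℓ, -, hS⟩
    · rw [hS]; exact convex_univ
    · rw [hS]; exact convex_halfSpace_ge ℓ.toLinearMap.isLinear 0
  have he : ∀ z, Real.exp (f z) * v z = 0 → v z = 0 := fun z hz =>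
    (mul_eq_zero.1 hz).resolve_left (Real.exp_ne_zero _)
  refine h.toRelOpen.exists_local_quotient (h.smooth_f.exp.mul h.smooth_v) h.driftLap_smooth'
    (fun z hz hz0 => h.driftLap_eq_zero hn hz (he z hz0)) hp (fun hp0 => ?_) h.dense hS
    fun z hz hzi => by rw [hb z hz hzi, mul_zero]
  -- At a zero of `v` the differentials of `e^f v` and of `v` are proportional. A zero of the first
  -- is therefore a vanishing 1-jet of `v`, which unique continuation excludes.
  by_contra! hd
  refine hne (h.eventually_eq_zero hn hconv hp (he p hp0) fun i => ?_)
  have h1 := hd i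
  rw [pd_mul (h.uniqueDiffWithinAt hp) (h.diff h.smooth_f.exp hp) (h.diff h.smooth_v hp),
    he p hp0, mul_zero, zero_add] at h1
  exact (mul_eq_zero.1 h1).resolve_left (Real.exp_ne_zero _)

/-- The second identity in coordinates, on the closure of the complement of the zero set. -/
theorem pd_coordScal_eq (h : IsKer S t G f v) {b : Eu n → ℝ} {O : Set (Eu n)} (hO : IsOpen O)
    (hp : p ∈ S ∩ O) (hOt : S ∩ O ⊆ t) (hb : ContinuousOn b (S ∩ O))
    (hbv : ∀ z ∈ S ∩ O, driftLap S G f (fun z => Real.exp (f z) * v z) z =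
        b z * (Real.exp (f z) * v z))
    (hne : ¬∀ᶠ z in nhdsWithin p S, v z = 0) (m : Fin n) :
    Perelman.pd S m (coordScal S G f) p = 2 * b p * Perelman.pd S m f p := by
  -- `p` is a limit of points where `v ≠ 0`. There the factor `e^f v` can be cancelled from the
  -- first identity, and continuity carries the result to `p`.
  have hcl : p ∈ closure (S ∩ O ∩ {z | v z ≠ 0}) := by
    rw [mem_closure_iff_frequently]
    have h1 := frequently_nhdsWithin_iff.1 (Filter.not_eventually.1 hne)
    exact (h1.and_eventually (hO.eventually_mem hp.2)).mono fun z hz => ⟨⟨hz.1.2, hz.2⟩, hz.1.1⟩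
  have hR := ((h.pd (h.coordScal_smooth h.smooth_f) m).continuousOn.mono hOt)
  have hf := ((h.pd h.smooth_f m).continuousOn.mono hOt)
  have heq : EqOn (Perelman.pd S m (coordScal S G f)) (fun z => 2 * b z * Perelman.pd S m f z)
      (S ∩ O ∩ {z | v z ≠ 0}) := fun z hz => by
    have h1 := h.mul_pd_coordScal_eq m (hOt hz.1)
    rw [hbv z hz.1] at h1
    have h2 : Real.exp (f z) * v z ≠ 0 := mul_ne_zero (Real.exp_ne_zero _) hz.2
    refine mul_left_cancel₀ h2 ?_
    rw [h1]
    ring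
  exact heq.of_subset_closure (t := insert p (S ∩ O ∩ {z | v z ≠ 0}))
    (hR.mono (insert_subset hp fun z hz => hz.1))
    ((continuousOn_const.mul hb).mul hf |>.mono (insert_subset hp fun z hz => hz.1))
    (subset_insert _ _) (insert_subset hcl subset_closure) (mem_insert _ _)

end IsKer

end

section

set_option synthInstance.maxHeartbeats 400000

variable {n : ℕ} {H : Type*} [TopologicalSpace H]
  {I : ModelWithCorners ℝ (EuclideanSpace ℝ (Fin n)) H}
  {M : Type*} [TopologicalSpace M] [ChartedSpace H M]
  {B : ∀ p : M, TangentSpace I p →L[ℝ] TangentSpace I p →L[ℝ] ℝ}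
  {x q : M} {y : EuclideanSpace ℝ (Fin n)}

/-! ### Tensors in charts -/

/-- Bilinear forms on the model space. -/
abbrev Bil (n : ℕ) : Type := EuclideanSpace ℝ (Fin n) →L[ℝ] EuclideanSpace ℝ (Fin n) →L[ℝ] ℝ

theorem Bil.apply_eq (L : Bil n) (v w : EuclideanSpace ℝ (Fin n)) :
    L v w = ∑ i, ∑ j, L (EuclideanSpace.single i 1) (EuclideanSpace.single j 1) * (v i * w j) := by
  conv_lhs => rw [← sum_smul_single v, ← sum_smul_single w]
  simp only [map_sum, map_smul, sum_apply, smul_apply, smul_eq_mul,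
    Finset.mul_sum]
  rw [Finset.sum_comm]
  exact Finset.sum_congr rfl fun i _ => Finset.sum_congr rfl fun j _ => by ring

theorem relOpen_target (x : M) : RelOpen (range I) (extChartAt I x).target where
  uniq := I.uniqueDiffOn
  sub := extChartAt_target_subset_range x
  nhds _ hy := extChartAt_target_mem_nhdsWithin_of_mem hy

theorem contDiff_metL {k : Eu n → Matrix (Fin n) (Fin n) ℝ}
    (hk : ∀ i j, ContDiff ℝ ∞ fun z => k z i j) : ContDiff ℝ ∞ (metL k) :=
  ContDiff.sum fun i _ => ContDiff.sum fun j _ =>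
    contDiffOn_univ.1 (contDiffOn_smul_const' (hk i j).contDiffOn _)

theorem symm_mem_source (hy : y ∈ (extChartAt I x).target) :
    (extChartAt I x).symm y ∈ (chartAt H x).source := by
  rw [← extChartAt_source I]
  exact (extChartAt I x).map_target hy

theorem gram_add_smul (B h : ∀ p : M, TangentSpace I p →L[ℝ] TangentSpace I p →L[ℝ] ℝ) (s : ℝ)
    (x : M) (y : EuclideanSpace ℝ (Fin n)) :
    gram I (fun q => B q + s • h q) x y = gram I B x y + s • gram I h x y := by
  ext i j
  rfl

variable [IsManifold I ∞ M]

/-- The trivialization of the bundle of bilinear forms. -/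
abbrev bilTriv (I : ModelWithCorners ℝ (EuclideanSpace ℝ (Fin n)) H) {M : Type*}
    [TopologicalSpace M] [ChartedSpace H M] [IsManifold I ∞ M] (x : M) :=
  trivializationAt (Bil n) (fun p : M => TangentSpace I p →L[ℝ] TangentSpace I p →L[ℝ] ℝ) x

/-- The bundle of bilinear forms is an iterated hom-bundle. Unfolding its trivialization twice shows
that it evaluates the form on vectors transported by the tangent trivialization, which links `gram`
to the bundle notion of smoothness. -/
theorem bilTriv_apply (hq : q ∈ (chartAt H x).source)
    (b : TangentSpace I q →L[ℝ] TangentSpace I q →L[ℝ] ℝ) (v w : EuclideanSpace ℝ (Fin n)) :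
    (bilTriv I x (Bundle.TotalSpace.mk' (Bil n) q b)).2 v w =
      b ((trivializationAt (EuclideanSpace ℝ (Fin n)) (TangentSpace I) x).symmL ℝ q v)
        ((trivializationAt (EuclideanSpace ℝ (Fin n)) (TangentSpace I) x).symmL ℝ q w) := by
  rw [hom_trivializationAt_apply]
  rw [ContinuousLinearMap.inCoordinates]
  simp only [ContinuousLinearMap.comp_apply]
  rw [Bundle.Trivialization.continuousLinearMapAt_apply,
    Bundle.Trivialization.coe_linearMapAt_of_mem]
  · set L := b ((trivializationAt (EuclideanSpace ℝ (Fin n)) (TangentSpace I) x).symmL ℝ q v)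
    have h1 := hom_trivializationAt_apply (RingHom.id ℝ) (F₁ := EuclideanSpace ℝ (Fin n))
      (E₁ := (TangentSpace I : M → Type _)) (F₂ := ℝ) (E₂ := Bundle.Trivial M ℝ) x
      (Bundle.TotalSpace.mk' (EuclideanSpace ℝ (Fin n) →L[ℝ] ℝ) q L)
    refine (congrArg (fun z => z.2 w) h1).trans ?_
    simp [ContinuousLinearMap.inCoordinates]
  · simp [hq]

theorem mem_baseSet_bilTriv : q ∈ (bilTriv I x).baseSet ↔ q ∈ (chartAt H x).source := by
  simp

theorem gram_apply (hy : y ∈ (extChartAt I x).target) (i j : Fin n) :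
    gram I B x y i j = (bilTriv I x (Bundle.TotalSpace.mk' (Bil n) ((extChartAt I x).symm y)
      (B ((extChartAt I x).symm y)))).2 (EuclideanSpace.single i 1) (EuclideanSpace.single j 1) := by
  rw [bilTriv_apply (symm_mem_source hy), TangentBundle.symmL_trivializationAt (symm_mem_source hy),
    (extChartAt I x).right_inv hy]
  rfl

theorem metL_gram (hy : y ∈ (extChartAt I x).target) (v w : EuclideanSpace ℝ (Fin n)) :
    metL (gram I B x) y v w = B ((extChartAt I x).symm y)
      (mfderivWithin 𝓘(ℝ, EuclideanSpace ℝ (Fin n)) I (extChartAt I x).symm (range I) y v)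
      (mfderivWithin 𝓘(ℝ, EuclideanSpace ℝ (Fin n)) I (extChartAt I x).symm (range I) y w) := by
  have h1 := bilTriv_apply (symm_mem_source hy) (B ((extChartAt I x).symm y)) v w
  rw [TangentBundle.symmL_trivializationAt (symm_mem_source hy),
    (extChartAt I x).right_inv hy] at h1
  rw [metL_apply]
  simp only [gram_apply hy]
  exact (Bil.apply_eq _ v w).symm.trans h1

theorem IsSymTensor.gram_smooth (hB : IsSymTensor I B) (x : M) (i j : Fin n) :
    ContDiffOn ℝ ∞ (fun z => gram I B x z i j) (extChartAt I x).target := by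
  have h1 : ContMDiffOn I 𝓘(ℝ, Bil n) ∞
      (fun q => (bilTriv I x (Bundle.TotalSpace.mk' (Bil n) q (B q))).2) (chartAt H x).source :=
    ((bilTriv I x).contMDiffOn_section_iff (chartAt H x).open_source
      (fun q hq => mem_baseSet_bilTriv.2 hq)).1 hB.smooth.contMDiffOn
  have h2 := h1.comp (contMDiffOn_extChartAt_symm x) fun y hy => symm_mem_source hy
  rw [contMDiffOn_iff_contDiffOn] at h2
  have h3 := (h2.clm_apply (contDiffOn_const (c := EuclideanSpace.single i (1 : ℝ)))).clm_apply
    (contDiffOn_const (c := EuclideanSpace.single j (1 : ℝ)))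
  exact h3.congr fun y hy => gram_apply hy i j

theorem IsSymTensor.gram_symm (hB : IsSymTensor I B) (x : M) (y : EuclideanSpace ℝ (Fin n)) :
    (gram I B x y).IsSymm := by
  ext i j
  exact hB.symm _ _ _

/-- The tensor field with components `k` in the chart around `x`. -/
def chartTensor (I : ModelWithCorners ℝ (EuclideanSpace ℝ (Fin n)) H) {M : Type*}
    [TopologicalSpace M] [ChartedSpace H M] [IsManifold I ∞ M] (x : M)
    (k : Eu n → Matrix (Fin n) (Fin n) ℝ) (q : M) :
    TangentSpace I q →L[ℝ] TangentSpace I q →L[ℝ] ℝ :=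
  (bilTriv I x).symmL ℝ q (metL k (extChartAt I x q))

variable {k : Eu n → Matrix (Fin n) (Fin n) ℝ}

theorem bilTriv_chartTensor (hq : q ∈ (chartAt H x).source) :
    (bilTriv I x (Bundle.TotalSpace.mk' (Bil n) q (chartTensor I x k q))).2 =
      metL k (extChartAt I x q) := by
  rw [chartTensor, Bundle.Trivialization.symmL_apply _ (mem_baseSet_bilTriv.2 hq),
    Bundle.Trivialization.apply_mk_symm _ (mem_baseSet_bilTriv.2 hq)]

theorem chartTensor_apply (hq : q ∈ (chartAt H x).source) (v w : TangentSpace I q) :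
    chartTensor I x k q v w = metL k (extChartAt I x q)
      ((trivializationAt (EuclideanSpace ℝ (Fin n)) (TangentSpace I) x).continuousLinearMapAt ℝ q v)
      ((trivializationAt (EuclideanSpace ℝ (Fin n)) (TangentSpace I) x).continuousLinearMapAt ℝ q
        w) := by
  rw [← bilTriv_chartTensor hq, bilTriv_apply hq, Bundle.Trivialization.symmL_continuousLinearMapAt,
    Bundle.Trivialization.symmL_continuousLinearMapAt] <;> simpa using hq

theorem gram_chartTensor (hy : y ∈ (extChartAt I x).target) :
    gram I (chartTensor I x k) x y = k y := by
  ext i j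
  rw [gram_apply hy, bilTriv_chartTensor (symm_mem_source hy), (extChartAt I x).right_inv hy,
    metL_single]

theorem chartTensor_eq_zero (hk : q ∈ (chartAt H x).source → k (extChartAt I x q) = 0) :
    chartTensor I x k q = 0 := by
  by_cases hq : q ∈ (chartAt H x).source
  · ext v w
    rw [chartTensor_apply hq, metL_apply, hk hq]
    simp
  · exact Bundle.Trivialization.symmL_apply_of_notMem _
      (fun h => hq (mem_baseSet_bilTriv.1 h)) _

/-- Makes compactly supported coordinate variations into admissible global tensors, so that the
kernel condition can be tested in a chart. -/
theorem isSymTensor_chartTensor [T2Space M] (hk : ∀ i j, ContDiff ℝ ∞ fun z => k z i j)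
    (hs : ∀ z, (k z).IsSymm) {K : Set (Eu n)} (hK : IsCompact K) (hKt : K ⊆ (extChartAt I x).target)
    (h0 : ∀ z, z ∉ K → k z = 0) : IsSymTensor I (chartTensor I x k) where
  symm q v w := by
    by_cases hq : q ∈ (chartAt H x).source
    · rw [chartTensor_apply hq, chartTensor_apply hq, metL_apply, metL_apply, Finset.sum_comm]
      exact Finset.sum_congr rfl fun i _ => Finset.sum_congr rfl fun j _ => by
        rw [(hs _).apply i j, mul_comm (_ : ℝ) (((_ : EuclideanSpace ℝ (Fin n)) j : ℝ))]
    · rw [chartTensor_eq_zero fun h => absurd h hq]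
      rfl
  smooth q := by
    by_cases hq : q ∈ (chartAt H x).source
    · rw [(bilTriv I x).contMDiffAt_section_iff (mem_baseSet_bilTriv.2 hq)]
      have h1 : ContMDiffAt I 𝓘(ℝ, Bil n) ∞ (fun q => metL k (extChartAt I x q)) q :=
        (contDiff_metL hk).contMDiff.contMDiffAt.comp q (contMDiffAt_extChartAt' hq)
      refine h1.congr_of_eventuallyEq ?_
      filter_upwards [(chartAt H x).open_source.mem_nhds hq] with q' hq'
        using bilTriv_chartTensor hq'
    -- Outside the chart the tensor is zero near `q`: the image of the compact set `K` is closed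
    -- because the manifold is Hausdorff, and it does not contain `q`.
    · have hKM : IsCompact ((extChartAt I x).symm '' K) :=
        hK.image_of_continuousOn ((continuousOn_extChartAt_symm x).mono hKt)
      have hqK : q ∉ (extChartAt I x).symm '' K := by
        rintro ⟨z, hz, rfl⟩
        exact hq (symm_mem_source (hKt hz))
      refine (Bundle.contMDiff_zeroSection ℝ _ q).congr_of_eventuallyEq ?_
      filter_upwards [hKM.isClosed.isOpen_compl.mem_nhds hqK] with q' hq'
      rw [chartTensor_eq_zero fun hs => h0 _ fun hz => hq' ⟨_, hz, ?_⟩]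
      · rfl
      · exact (extChartAt I x).left_inv (by rwa [extChartAt_source])

end

section

set_option synthInstance.maxHeartbeats 400000

variable {n : ℕ} {H : Type*} [TopologicalSpace H]
  {I : ModelWithCorners ℝ (EuclideanSpace ℝ (Fin n)) H}
  {M : Type*} [TopologicalSpace M] [ChartedSpace H M]
  {B : ∀ p : M, TangentSpace I p →L[ℝ] TangentSpace I p →L[ℝ] ℝ}
  {x x' q : M} {y z : EuclideanSpace ℝ (Fin n)}

/-! ### Change of charts -/

/-- The domain, in the chart around `x`, of the coordinate change to the chart around `x'`. -/
def overlap (I : ModelWithCorners ℝ (EuclideanSpace ℝ (Fin n)) H) {M : Type*}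
    [TopologicalSpace M] [ChartedSpace H M] (x x' : M) : Set (Eu n) :=
  {z | z ∈ (extChartAt I x).target ∧ (extChartAt I x).symm z ∈ (extChartAt I x').source}

/-- The coordinate change from the chart around `x` to the chart around `x'`. -/
def coordChange (I : ModelWithCorners ℝ (EuclideanSpace ℝ (Fin n)) H) {M : Type*}
    [TopologicalSpace M] [ChartedSpace H M] (x x' : M) (z : Eu n) : Eu n :=
  extChartAt I x' ((extChartAt I x).symm z)

theorem relOpen_overlap (x x' : M) : RelOpen (range I) (overlap I x x') where
  uniq := I.uniqueDiffOn
  sub z hz := extChartAt_target_subset_range x hz.1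
  nhds z hz := by
    refine Filter.inter_mem (extChartAt_target_mem_nhdsWithin_of_mem hz.1) ?_
    exact mem_nhdsWithin_of_mem_nhds ((continuousAt_extChartAt_symm'' hz.1).preimage_mem_nhds
      ((isOpen_extChartAt_source x').mem_nhds hz.2))

theorem mem_overlap (hq : q ∈ (extChartAt I x).source) (hq' : q ∈ (extChartAt I x').source) :
    extChartAt I x q ∈ overlap I x x' :=
  ⟨(extChartAt I x).map_source hq, by rwa [(extChartAt I x).left_inv hq]⟩

theorem coordChange_apply (hq : q ∈ (extChartAt I x).source) :
    coordChange I x x' (extChartAt I x q) = extChartAt I x' q := by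
  rw [coordChange, (extChartAt I x).left_inv hq]

theorem coordChange_mem (hz : z ∈ overlap I x x') :
    coordChange I x x' z ∈ (extChartAt I x').target := (extChartAt I x').map_source hz.2

theorem symm_coordChange (hz : z ∈ overlap I x x') :
    (extChartAt I x').symm (coordChange I x x' z) = (extChartAt I x).symm z :=
  (extChartAt I x').left_inv hz.2

theorem mem_interior_target_iff (hz : z ∈ (extChartAt I x).target) :
    z ∈ interior (extChartAt I x).target ↔ z ∈ interior (range I) := by
  refine ⟨fun h => interior_mono (extChartAt_target_subset_range x) h, fun h => ?_⟩
  exact interior_maximal inter_subset_left (relOpen_target x).isOpen_inter_interior ⟨hz, h⟩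

theorem overlap_self (x : M) : overlap I x x = (extChartAt I x).target := by
  ext z
  exact ⟨fun h => h.1, fun h => ⟨h, (extChartAt I x).map_target h⟩⟩

variable [IsManifold I ∞ M]

theorem isInteriorPoint_iff_extChartAt (hq : q ∈ (extChartAt I x).source) :
    I.IsInteriorPoint q ↔ extChartAt I x q ∈ interior (range I) := by
  rw [← mem_interior_target_iff ((extChartAt I x).map_source hq)]
  exact I.isInteriorPoint_iff_of_mem_atlas (n := ∞) (by simp) (chart_mem_atlas H x)
    (by rwa [extChartAt_source] at hq)

theorem coordChange_mem_interior (hz : z ∈ overlap I x x') (hi : z ∈ interior (range I)) :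
    coordChange I x x' z ∈ interior (range I) := by
  rw [coordChange, ← isInteriorPoint_iff_extChartAt hz.2,
    isInteriorPoint_iff_extChartAt ((extChartAt I x).map_target hz.1),
    (extChartAt I x).right_inv hz.1]
  exact hi

theorem contMDiffOn_coordChange (x x' : M) :
    ContMDiffOn 𝓘(ℝ, Eu n) 𝓘(ℝ, Eu n) ∞ (coordChange I x x') (overlap I x x') := by
  have h1 : ContMDiffOn I 𝓘(ℝ, Eu n) ∞ (extChartAt I x') (extChartAt I x').source := by
    rw [extChartAt_source]
    exact contMDiffOn_extChartAt
  exact h1.comp ((contMDiffOn_extChartAt_symm x).mono fun z hz => hz.1) fun z hz => hz.2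

theorem contDiffOn_coordChange (x x' : M) :
    ContDiffOn ℝ ∞ (coordChange I x x') (overlap I x x') :=
  contMDiffOn_iff_contDiffOn.1 (contMDiffOn_coordChange x x')

/-- The chain rule for the inverse charts. At interior points all derivatives are two-sided, which
is what the isometry formalism requires. -/
theorem metL_gram_coordChange (hz : z ∈ overlap I x x') (hi : z ∈ interior (range I))
    (v w : Eu n) : metL (gram I B x) z v w = metL (gram I B x') (coordChange I x x' z)
      (fderiv ℝ (coordChange I x x') z v) (fderiv ℝ (coordChange I x x') z w) := by
  have hi' := coordChange_mem_interior hz hi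
  have hU := (relOpen_overlap (I := I) x x').isOpen_inter_interior.mem_nhds ⟨hz, hi⟩
  rw [metL_gram hz.1, metL_gram (coordChange_mem hz),
    mfderivWithin_of_mem_nhds (mem_interior_iff_mem_nhds.1 hi),
    mfderivWithin_of_mem_nhds (mem_interior_iff_mem_nhds.1 hi')]
  have h1 : MDifferentiableAt 𝓘(ℝ, Eu n) 𝓘(ℝ, Eu n) (coordChange I x x') z :=
    ((contMDiffOn_coordChange x x').contMDiffAt
      (Filter.mem_of_superset hU inter_subset_left)).mdifferentiableAt (by simp)
  have h2 : MDifferentiableAt 𝓘(ℝ, Eu n) I (extChartAt I x').symm (coordChange I x x' z) :=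
    ((contMDiffOn_extChartAt_symm x').contMDiffAt (mem_interior_iff_mem_nhds.1
      ((mem_interior_target_iff (coordChange_mem hz)).2 hi'))).mdifferentiableAt
        (n := ∞) (by simp)
  have h3 : (extChartAt I x).symm =ᶠ[nhds z] (extChartAt I x').symm ∘ coordChange I x x' := by
    filter_upwards [hU] with z' hz' using (symm_coordChange hz'.1).symm
  have h4 : ∀ v : Eu n, (mfderiv 𝓘(ℝ, Eu n) I (extChartAt I x).symm z v : Eu n) =
      (mfderiv 𝓘(ℝ, Eu n) I (extChartAt I x').symm (coordChange I x x' z)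
        (fderiv ℝ (coordChange I x x') z v) : Eu n) := fun v => by
    rw [h3.mfderiv_eq]
    have := mfderiv_comp_apply z h2 h1 v
    rw [mfderiv_eq_fderiv] at this
    exact this
  have h5 : ∀ a b : M, a = b → ∀ v v' w w' : Eu n, v = v' → w = w' →
      (B a : Bil n) v w = (B b : Bil n) v' w' := by
    rintro a _ rfl v _ w _ rfl rfl
    rfl
  exact h5 _ _ (symm_coordChange hz).symm _ _ _ _ (h4 v) (h4 w)

/-- The two Gram matrices are congruent through the Jacobian, so a nonzero determinant on one side
forces the other to be nonzero. Invertibility of the coordinate change is not needed. -/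
theorem det_gram_coordChange (hz : z ∈ overlap I x x') (hi : z ∈ interior (range I))
    (hd : (gram I B x z).det ≠ 0) : (gram I B x' (coordChange I x x' z)).det ≠ 0 := by
  set L := fderiv ℝ (coordChange I x x') z
  have h1 : gram I B x z = Matrix.of (fun i j => L (EuclideanSpace.single i 1) j) *
      gram I B x' (coordChange I x x' z) *
      Matrix.of (fun i j => L (EuclideanSpace.single j 1) i) := by
    ext i j
    rw [← metL_single (G := gram I B x), metL_gram_coordChange hz hi, metL_apply,
      Matrix.mul_apply, Finset.sum_comm]
    refine Finset.sum_congr rfl fun b _ => ?_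
    rw [Matrix.mul_apply, Finset.sum_mul]
    refine Finset.sum_congr rfl fun a _ => ?_
    simp only [Matrix.of_apply]
    ring
  rw [h1, Matrix.det_mul, Matrix.det_mul] at hd
  exact right_ne_zero_of_mul (left_ne_zero_of_mul hd)

/-- The part of a chart in the interior of the manifold where a field of bilinear forms is
nondegenerate. -/
def nondegSet (I : ModelWithCorners ℝ (EuclideanSpace ℝ (Fin n)) H) {M : Type*}
    [TopologicalSpace M] [ChartedSpace H M]
    (B : ∀ p : M, TangentSpace I p →L[ℝ] TangentSpace I p →L[ℝ] ℝ) (x x' : M) : Set (Eu n) :=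
  {z | z ∈ overlap I x x' ∩ interior (range I) ∧ (gram I B x z).det ≠ 0}

theorem IsSymTensor.isOpen_nondegSet (hB : IsSymTensor I B) (x x' : M) :
    IsOpen (nondegSet I B x x') := by
  have h1 : ContinuousOn (fun z => (gram I B x z).det) (overlap I x x' ∩ interior (range I)) :=
    ContDiffOn.continuousOn (n := ∞) (contDiffOn_det fun i j =>
      (hB.gram_smooth x i j).mono fun z hz => hz.1.1)
  exact h1.isOpen_inter_preimage (relOpen_overlap x x').isOpen_inter_interior
    isOpen_compl_singleton

theorem IsSymTensor.isMetric_nondegSet (hB : IsSymTensor I B) (x x' : M) :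
    IsMetric (range I) (nondegSet I B x x') (gram I B x) where
  toRelOpen := .of_isOpen I.uniqueDiffOn (hB.isOpen_nondegSet x x') fun _ hz =>
    interior_subset hz.1.2
  smooth i j := (hB.gram_smooth x i j).mono fun _ hz => hz.1.1.1
  symm z _ := hB.gram_symm x z
  det_ne _ hz := hz.2

theorem IsSymTensor.isIsom_coordChange (hB : IsSymTensor I B) (x x' : M) :
    IsIsom (range I) (nondegSet I B x x') (nondegSet I B x' x') (gram I B x) (gram I B x')
      (coordChange I x x') where
  metric := hB.isMetric_nondegSet x x'
  metric' := hB.isMetric_nondegSet x' x'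
  isOpen := hB.isOpen_nondegSet x x'
  isOpen' := hB.isOpen_nondegSet x' x'
  smooth := (contDiffOn_coordChange x x').mono fun z hz => hz.1.1
  mapsTo z hz := ⟨⟨by rw [overlap_self]; exact coordChange_mem hz.1.1,
    coordChange_mem_interior hz.1.1 hz.1.2⟩, det_gram_coordChange hz.1.1 hz.1.2 hz.2⟩
  iso z hz v w := metL_gram_coordChange hz.1.1 hz.1.2 v w

variable {f u : M → ℝ}

theorem contDiffOn_comp_symm (hf : ContMDiff I 𝓘(ℝ, ℝ) ∞ f) (x : M) :
    ContDiffOn ℝ ∞ (f ∘ (extChartAt I x).symm) (extChartAt I x).target :=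
  contMDiffOn_iff_contDiffOn.1 (hf.comp_contMDiffOn (contMDiffOn_extChartAt_symm x))

/-- `perelmanScal` is evaluated at each point in that point's own chart; isometry invariance of the
coordinate change moves it to one fixed chart. Only nondegeneracy is asked of `B`, so that it
applies to `g + t h` for small `t`. -/
theorem IsSymTensor.perelmanScal_eq (hB : IsSymTensor I B) (hf : ContMDiff I 𝓘(ℝ, ℝ) ∞ f)
    (hq : q ∈ (extChartAt I x).source) (hi : extChartAt I x q ∈ interior (range I))
    (hd : (gram I B x (extChartAt I x q)).det ≠ 0) :
    perelmanScal I B f q =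
      coordScal (range I) (gram I B x) (f ∘ (extChartAt I x).symm) (extChartAt I x q) := by
  have hm : extChartAt I x q ∈ nondegSet I B x q :=
    ⟨⟨mem_overlap hq (mem_extChartAt_source q), hi⟩, hd⟩
  rw [(hB.isIsom_coordChange x q).coordScal_eq
    ((contDiffOn_comp_symm hf q).mono fun z hz => hz.1.1.1) (fun z hz => ?_) hm,
    coordChange_apply hq]
  · rfl
  · exact congrArg f (symm_coordChange hz.1.1).symm

end

/-! ### Curvature, linearization and the kernel condition read in one chart -/

section

set_option synthInstance.maxHeartbeats 400000

variable {n : ℕ} {H : Type*} [TopologicalSpace H]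
  {I : ModelWithCorners ℝ (EuclideanSpace ℝ (Fin n)) H}
  {M : Type*} [TopologicalSpace M] [ChartedSpace H M] [IsManifold I ∞ M]
  {B h : ∀ p : M, TangentSpace I p →L[ℝ] TangentSpace I p →L[ℝ] ℝ}
  {x q : M} {z : EuclideanSpace ℝ (Fin n)} {f u : M → ℝ}

theorem IsSymTensor.add_smul (hB : IsSymTensor I B) (hh : IsSymTensor I h) (s : ℝ) :
    IsSymTensor I (fun q => B q + s • h q) where
  symm p v w := congrArg₂ (fun a b : ℝ => a + s * b) (hB.symm p v w) (hh.symm p v w)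
  smooth := hB.smooth.add_section (contMDiff_const.smul_section hh.smooth)

theorem IsSymTensor.linPerelmanScal_eq (hB : IsSymTensor I B) (hh : IsSymTensor I h)
    (hf : ContMDiff I 𝓘(ℝ, ℝ) ∞ f)
    (hq : q ∈ (extChartAt I x).source) (hi : extChartAt I x q ∈ interior (range I))
    (hd : (gram I B x (extChartAt I x q)).det ≠ 0) {k : Eu n → Matrix (Fin n) (Fin n) ℝ}
    (hk : ∀ z ∈ (extChartAt I x).target, gram I h x z = k z) :
    linPerelmanScal I B h f q = linCoordScal (range I) (gram I B x) k
      (f ∘ (extChartAt I x).symm) (fun _ => 0) (extChartAt I x q) := by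
  set z₀ := extChartAt I x q with hz₀
  have hU := (relOpen_target (I := I) x).isOpen_inter_interior
  set U := (extChartAt I x).target ∩ interior (range I)
  have hz₀U : z₀ ∈ U := ⟨(extChartAt I x).map_source hq, hi⟩
  set G : ℝ → Eu n → Matrix (Fin n) (Fin n) ℝ := fun s z => gram I B x z + s • gram I h x z with hG
  have hGs : ∀ i j, ContDiffOn ℝ ∞ (fun p : ℝ × Eu n => G p.1 p.2 i j) (univ ×ˢ U) := fun i j =>
    ((hB.gram_smooth x i j).comp contDiffOn_snd fun p hp => hp.2.1).add
      (contDiffOn_fst.mul ((hh.gram_smooth x i j).comp contDiffOn_snd fun p hp => hp.2.1))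
  have hdc : ContinuousOn (fun p : ℝ × Eu n => (G p.1 p.2).det) (univ ×ˢ U) :=
    ContDiffOn.continuousOn (n := ∞) (contDiffOn_det hGs)
  -- Nondegeneracy is open in `(s, z)`. For small `s` the perturbed tensor is thus a valid input of
  -- `perelmanScal_eq`, and the two functions of `s` have the same germ at zero.
  set W : Set (ℝ × Eu n) := (univ ×ˢ U) ∩ {p | (G p.1 p.2).det ≠ 0}
  have hW : IsOpen W := hdc.isOpen_inter_preimage (isOpen_univ.prod hU) isOpen_compl_singleton
  have hG0 : G 0 = gram I B x := by
    funext z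
    simp [hG]
  have hz₀W : ((0 : ℝ), z₀) ∈ W := ⟨⟨mem_univ _, hz₀U⟩, by
    rw [mem_ofPred_eq, hG0]
    exact hd⟩
  have hv := IsVar.coordScal (S := range I) (W := W) (G := G) (h := k)
    (f := fun _ => f ∘ (extChartAt I x).symm) (ψ := fun _ => 0)
    (fun i j => ((IsVar.of_contDiffOn (hB.gram_smooth x i j) fun p hp => hp.1.2.1).add
      (IsVar.param.mul (IsVar.of_contDiffOn (hh.gram_smooth x i j) fun p hp => hp.1.2.1))).congr
        hW (fun _ _ => rfl) fun z hz => by simp [hk z hz.1.2.1])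
    hW (fun p hp => mem_interior_iff_mem_nhds.1 hp.1.2.2) (fun p hp => hp.2)
    (IsVar.of_contDiffOn (contDiffOn_comp_symm hf x) fun p hp => hp.1.2.1)
  have h1 := (hv.deriv z₀ hz₀W).deriv
  rw [hG0] at h1
  rw [linPerelmanScal, ← h1]
  refine Filter.EventuallyEq.deriv_eq ?_
  have h2 : ∀ᶠ s : ℝ in nhds 0, (s, z₀) ∈ W :=
    (Continuous.prodMk_left z₀).continuousAt.preimage_mem_nhds (hW.mem_nhds hz₀W)
  filter_upwards [h2] with s hs
  rw [(hB.add_smul hh s).perelmanScal_eq hf hq hi]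
  · rfl
  · rw [gram_add_smul]
    exact hs.2

omit [IsManifold I ∞ M] in
theorem measurableSet_target (x : M) : MeasurableSet (extChartAt I x).target := by
  rw [extChartAt_target]
  exact ((chartAt H x).open_target.preimage I.continuous_symm).measurableSet.inter
    I.isClosed_range.measurableSet

section Riemannian

variable {g : Bundle.ContMDiffRiemannianMetric I ∞ (EuclideanSpace ℝ (Fin n))
      (fun p : M => TangentSpace I p)}

theorem isSymTensor_inner (g : Bundle.ContMDiffRiemannianMetric I ∞ (EuclideanSpace ℝ (Fin n))
      (fun p : M => TangentSpace I p)) : IsSymTensor I g.inner where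
  symm := g.symm
  smooth := g.contMDiff

theorem det_gram_pos (g : Bundle.ContMDiffRiemannianMetric I ∞ (EuclideanSpace ℝ (Fin n))
      (fun p : M => TangentSpace I p)) (hz : z ∈ (extChartAt I x).target) :
    0 < (gram I g.inner x z).det := by
  refine Matrix.PosDef.det_pos ?_
  refine Matrix.PosDef.of_dotProduct_mulVec_pos ?_ fun v hv => ?_
  · exact (isSymTensor_inner g).gram_symm x z
  · have h1 : star v ⬝ᵥ (gram I g.inner x z).mulVec v =
        metL (gram I g.inner x) z (WithLp.toLp 2 v) (WithLp.toLp 2 v) := by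
      rw [metL_apply]
      simp only [dotProduct, Matrix.mulVec, Finset.mul_sum]
      refine Finset.sum_congr rfl fun i _ => Finset.sum_congr rfl fun j _ => ?_
      simp only [Pi.star_apply, star_trivial]
      ring
    rw [h1, metL_gram hz]
    refine g.pos _ _ fun h0 => hv ?_
    have h2 := (isInvertible_mfderivWithin_extChartAt_symm hz).injective
      (h0.trans (map_zero _).symm)
    exact congrArg WithLp.ofLp h2

theorem isMetric_gram (g : Bundle.ContMDiffRiemannianMetric I ∞ (EuclideanSpace ℝ (Fin n))
      (fun p : M => TangentSpace I p)) (x : M) :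
    IsMetric (range I) (extChartAt I x).target (gram I g.inner x) where
  toRelOpen := relOpen_target x
  smooth := (isSymTensor_inner g).gram_smooth x
  symm z _ := (isSymTensor_inner g).gram_symm x z
  det_ne _ hz := (det_gram_pos g hz).ne'

/-- At interior points this is invariance under the coordinate change. Boundary points follow
because both sides are continuous and interior points are dense. -/
theorem perelmanScal_eq_coordScal (g : Bundle.ContMDiffRiemannianMetric I ∞
      (EuclideanSpace ℝ (Fin n)) (fun p : M => TangentSpace I p))
    (hf : ContMDiff I 𝓘(ℝ, ℝ) ∞ f) (hq : q ∈ (extChartAt I x).source) :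
    perelmanScal I g.inner f q =
      coordScal (range I) (gram I g.inner x) (f ∘ (extChartAt I x).symm) (extChartAt I x q) := by
  have hW := relOpen_overlap (I := I) x q
  have h1 := ((isMetric_gram g x).coordScal_smooth (contDiffOn_comp_symm hf x)).continuousOn
  have h2 := ((isMetric_gram g q).coordScal_smooth (contDiffOn_comp_symm hf q)).continuousOn
  have h3 := hW.eqOn I.range_subset_closure_interior (h1.mono fun z hz => hz.1)
    (h2.comp (contDiffOn_coordChange x q).continuousOn fun z hz => coordChange_mem hz)
    fun z hz => by
      refine ((isSymTensor_inner g).isIsom_coordChange x q).coordScal_eq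
        ((contDiffOn_comp_symm hf q).mono fun z hz => hz.1.1.1) (fun z hz => ?_)
        ⟨hz, (det_gram_pos g hz.1.1).ne'⟩
      exact congrArg f (symm_coordChange hz.1.1).symm
  rw [h3 (mem_overlap hq (mem_extChartAt_source q)), Function.comp_apply, coordChange_apply hq]
  rfl

theorem driftLaplacian_eq_driftLap (g : Bundle.ContMDiffRiemannianMetric I ∞
      (EuclideanSpace ℝ (Fin n)) (fun p : M => TangentSpace I p))
    (hf : ContMDiff I 𝓘(ℝ, ℝ) ∞ f) (hu : ContMDiff I 𝓘(ℝ, ℝ) ∞ u)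
    (hq : q ∈ (extChartAt I x).source) :
    driftLaplacian I g.inner f u q = driftLap (range I) (gram I g.inner x)
      (f ∘ (extChartAt I x).symm) (u ∘ (extChartAt I x).symm) (extChartAt I x q) := by
  have hW := relOpen_overlap (I := I) x q
  have h1 := ((isMetric_gram g x).driftLap_smooth (contDiffOn_comp_symm hf x)
    (contDiffOn_comp_symm hu x)).continuousOn
  have h2 := ((isMetric_gram g q).driftLap_smooth (contDiffOn_comp_symm hf q)
    (contDiffOn_comp_symm hu q)).continuousOn
  have h3 := hW.eqOn I.range_subset_closure_interior (h1.mono fun z hz => hz.1)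
    (h2.comp (contDiffOn_coordChange x q).continuousOn fun z hz => coordChange_mem hz)
    fun z hz => by
      refine ((isSymTensor_inner g).isIsom_coordChange x q).driftLap_eq
        ((contDiffOn_comp_symm hf q).mono fun z hz => hz.1.1.1) (fun z hz => ?_)
        ((contDiffOn_comp_symm hu q).mono fun z hz => hz.1.1.1) (fun z hz => ?_)
        ⟨hz, (det_gram_pos g hz.1.1).ne'⟩
      · exact congrArg f (symm_coordChange hz.1.1).symm
      · exact congrArg u (symm_coordChange hz.1.1).symm
  rw [h3 (mem_overlap hq (mem_extChartAt_source q)), Function.comp_apply, coordChange_apply hq]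
  rfl

/-- Passing from `u` to `v = e^{-f} u` absorbs the weight of `dVol_f`, leaving only `√det g`. The
chart tensors provide the test variations. -/
theorem IsInKerAdjoint.isKer [T2Space M] (hf : ContMDiff I 𝓘(ℝ, ℝ) ∞ f)
    (hu : IsInKerAdjoint I g f u) (x : M) :
    IsKer (range I) (extChartAt I x).target (gram I g.inner x) (f ∘ (extChartAt I x).symm)
      (fun z => Real.exp (-f ((extChartAt I x).symm z)) * u ((extChartAt I x).symm z)) where
  toIsMetric := isMetric_gram g x
  pos _ hz := det_gram_pos g hz
  dense := I.range_subset_closure_interior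
  smooth_f := contDiffOn_comp_symm hf x
  smooth_v := (contDiffOn_comp_symm hf x).neg.exp.mul (contDiffOn_comp_symm hu.smooth x)
  weak k hk hs := by
    rintro ⟨K, hK, hKt, hK0⟩
    have hh := isSymTensor_chartTensor (I := I) (x := x) hk hs hK
      (hKt.trans inter_subset_left) hK0
    have h1 := hu.adjoint x (chartTensor I x k) hh ⟨(extChartAt I x).symm '' K,
      hK.image_of_continuousOn ((continuousOn_extChartAt_symm x).mono
        (hKt.trans inter_subset_left)), ?_, fun p hp => ?_⟩
    · rw [chartIntegral] at h1
      refine Eq.trans (Eq.symm ?_) h1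
      rw [setIntegral_eq_of_subset_of_forall_sdiff_eq_zero 
        (s := (extChartAt I x).target ∩ interior (range I))
        (measurableSet_target x) inter_subset_left]
      · refine setIntegral_congr_fun
          (relOpen_target (I := I) x).isOpen_inter_interior.measurableSet fun z hz => ?_
        have h2 := (isSymTensor_inner g).linPerelmanScal_eq hh hf
          (q := (extChartAt I x).symm z) (x := x) ((extChartAt I x).map_target hz.1)
        simp only [(extChartAt I x).right_inv hz.1] at h2
        rw [h2 hz.2 (det_gram_pos g hz.1).ne' fun z hz => gram_chartTensor hz]
        ring
      -- On the boundary part of the chart the integrand vanishes because `u` does, so the integral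
      -- over the interior part is the whole integral.
      · intro z hz
        have h2 : u ((extChartAt I x).symm z) = 0 := by
          refine hu.boundary _ ?_
          rw [← I.compl_interior]
          intro h3
          refine hz.2 ⟨hz.1, ?_⟩
          have := (isInteriorPoint_iff_extChartAt ((extChartAt I x).map_target hz.1)).1 h3
          rwa [(extChartAt I x).right_inv hz.1] at this
        rw [h2]
        simp
    · rintro _ ⟨z, hz, rfl⟩
      refine ⟨symm_mem_source (hKt hz).1, ?_⟩
      refine (isInteriorPoint_iff_extChartAt ((extChartAt I x).map_target (hKt hz).1)).2 ?_
      rw [(extChartAt I x).right_inv (hKt hz).1]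
      exact (hKt hz).2
    · refine chartTensor_eq_zero fun hp' => hK0 _ fun hz => hp ⟨_, hz, ?_⟩
      exact (extChartAt I x).left_inv (by rwa [extChartAt_source])

end Riemannian

end

section

set_option synthInstance.maxHeartbeats 400000

variable {n : ℕ} {H : Type*} [TopologicalSpace H]
  {I : ModelWithCorners ℝ (EuclideanSpace ℝ (Fin n)) H}
  {M : Type*} [TopologicalSpace M] [ChartedSpace H M]
  {x p q : M} {f u : M → ℝ}

/-! ### From charts to the manifold -/

theorem eventually_nhdsWithin_extChartAt (hq : q ∈ (extChartAt I x).source) {P : Eu n → Prop} :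
    (∀ᶠ z in nhdsWithin (extChartAt I x q) (range I), P z) ↔
      ∀ᶠ q' in nhds q, P (extChartAt I x q') := by
  rw [← map_extChartAt_nhds' hq, Filter.eventually_map]

theorem extChartAt_mem_range (x q : M) : extChartAt I x q ∈ range I := mem_range_self _

theorem eq_zero_of_frequently {X : Type*} [TopologicalSpace X] {F : X → ℝ} {a : X}
    (hF : ContinuousAt F a) (h : ∃ᶠ b in nhds a, F b = 0) : F a = 0 := by
  by_contra hne
  exact h (hF.eventually_ne hne)

/-- A function which is locally a smooth multiple of another one, not vanishing on any open set, is
globally a smooth multiple. -/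
theorem exists_smooth_quotient [IsManifold I ∞ M] {w : M → ℝ} {c : M → M → ℝ}
    (hc : ∀ p, ∀ᶠ q in nhds p, ContMDiffAt I 𝓘(ℝ, ℝ) ∞ (c p) q)
    (hw : ∀ p, ∀ᶠ q in nhds p, w q = c p q * u q)
    (hu : ∀ p, ∃ᶠ q in nhds p, u q ≠ 0) : ContMDiff I 𝓘(ℝ, ℝ) ∞ fun p => c p p := by
  intro p
  -- The diagonal `q ↦ c q q` agrees near `p` with the smooth function `c p`: near `q` both `c q`
  -- and `c p` are quotients of `w` by `u`, so they coincide at points with `u ≠ 0` accumulating at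
  -- `q`, and hence at `q`.
  refine (hc p).self_of_nhds.congr_of_eventuallyEq ?_
  filter_upwards [hc p, (hw p).eventually_nhds] with q hq hwq
  have h1 : ∃ᶠ q' in nhds q, c q q' - c p q' = 0 := by
    refine ((hu q).and_eventually (hwq.and (hw q))).mono fun q' h => ?_
    refine (mul_eq_zero.1 ?_).resolve_right h.1
    rw [sub_mul, ← h.2.1, ← h.2.2, sub_self]
  exact sub_eq_zero.1 (eq_zero_of_frequently (F := fun q' => c q q' - c p q')
    ((hc q).self_of_nhds.continuousAt.sub hq.continuousAt) h1)

theorem eventually_eq_zero_iff (hq : q ∈ (extChartAt I x).source) :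
    (∀ᶠ z in nhdsWithin (extChartAt I x q) (range I),
      Real.exp (-f ((extChartAt I x).symm z)) * u ((extChartAt I x).symm z) = 0) ↔
      ∀ᶠ q' in nhds q, u q' = 0 := by
  rw [eventually_nhdsWithin_extChartAt hq]
  refine Filter.eventually_congr ?_
  filter_upwards [(isOpen_extChartAt_source x).mem_nhds hq] with q' hq'
  rw [(extChartAt I x).left_inv hq', mul_eq_zero, or_iff_right (Real.exp_ne_zero _)]

theorem exp_mul_exp_neg_mul (f u : M → ℝ) (x : M) :
    (fun z => Real.exp ((f ∘ (extChartAt I x).symm) z) *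
    (Real.exp (-f ((extChartAt I x).symm z)) * u ((extChartAt I x).symm z))) =
    u ∘ (extChartAt I x).symm := by
  funext z
  rw [← mul_assoc, Function.comp_apply, ← Real.exp_add, add_neg_cancel, Real.exp_zero, one_mul,
    Function.comp_apply]

theorem mvfderiv_apply_eq_sum {F : M → ℝ} (hF : ContMDiff I 𝓘(ℝ, ℝ) ∞ F) (p : M)
    (v : Eu n) : mvfderiv I F p v =
      ∑ m, v m * pd (range I) m (F ∘ (extChartAt I p).symm) (extChartAt I p p) := by
  have h1 := (hF.mdifferentiable (by simp) p).mfderiv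
  have h2 : (mvfderiv I F p v : ℝ) =
      fderivWithin ℝ (F ∘ (extChartAt I p).symm) (range I) (extChartAt I p p) v := by
    rw [mvfderiv, h1]
    rfl
  rw [h2]
  conv_lhs => rw [← sum_smul_single v]
  rw [map_sum]
  exact Finset.sum_congr rfl fun m _ => by rw [map_smul]; rfl

theorem smul_mvfderiv_eq {F F' : M → ℝ} (hF : ContMDiff I 𝓘(ℝ, ℝ) ∞ F)
    (hF' : ContMDiff I 𝓘(ℝ, ℝ) ∞ F') {a b : ℝ}
    (h : ∀ m, a * pd (range I) m (F ∘ (extChartAt I p).symm) (extChartAt I p p) =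
      b * pd (range I) m (F' ∘ (extChartAt I p).symm) (extChartAt I p p)) :
    a • mvfderiv I F p = b • mvfderiv I F' p := by
  ext v
  rw [smul_apply, smul_apply, mvfderiv_apply_eq_sum hF p v, mvfderiv_apply_eq_sum hF' p v,
    smul_eq_mul, smul_eq_mul, Finset.mul_sum, Finset.mul_sum]
  exact Finset.sum_congr rfl fun m _ => by
    rw [mul_left_comm, h m, mul_left_comm]

variable [IsManifold I ∞ M]

theorem contMDiffAt_comp_extChartAt {A : Eu n → ℝ} (hq : q ∈ (extChartAt I x).source)
    (hA : ContDiffWithinAt ℝ ∞ A (range I) (extChartAt I x q)) :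
    ContMDiffAt I 𝓘(ℝ, ℝ) ∞ (fun q' => A (extChartAt I x q')) q := by
  rw [extChartAt_source] at hq
  rw [← contMDiffWithinAt_univ]
  exact hA.contMDiffWithinAt.comp q (contMDiffAt_extChartAt' hq).contMDiffWithinAt
    fun q' _ => extChartAt_mem_range x q'

variable {g : Bundle.ContMDiffRiemannianMetric I ∞ (EuclideanSpace ℝ (Fin n))
      (fun p : M => TangentSpace I p)}

theorem contMDiff_perelmanScal (hf : ContMDiff I 𝓘(ℝ, ℝ) ∞ f) :
    ContMDiff I 𝓘(ℝ, ℝ) ∞ (perelmanScal I g.inner f) := by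
  intro x
  have hx := mem_extChartAt_source (I := I) x
  have h1 := (isMetric_gram g x).coordScal_smooth (contDiffOn_comp_symm hf x) _
    (mem_extChartAt_target x)
  refine (contMDiffAt_comp_extChartAt hx (h1.mono_of_mem_nhdsWithin
    (extChartAt_target_mem_nhdsWithin x))).congr_of_eventuallyEq ?_
  filter_upwards [extChartAt_source_mem_nhds (I := I) x] with q hq
    using perelmanScal_eq_coordScal g hf hq

theorem pd_perelmanScal (hf : ContMDiff I 𝓘(ℝ, ℝ) ∞ f) (m : Fin n) (p : M) :
    pd (range I) m (perelmanScal I g.inner f ∘ (extChartAt I p).symm) (extChartAt I p p) =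
      pd (range I) m (coordScal (range I) (gram I g.inner p) (f ∘ (extChartAt I p).symm))
        (extChartAt I p p) := by
  refine (relOpen_target p).pd_congr (fun z hz => ?_) (mem_extChartAt_target p) m
  rw [Function.comp_apply, perelmanScal_eq_coordScal g hf ((extChartAt I p).map_target hz),
    (extChartAt I p).right_inv hz]

/-! ### The identities and the quotient on the manifold -/

namespace IsInKerAdjoint

theorem mul_mvfderiv_eq [T2Space M] (hu : IsInKerAdjoint I g f u) (hf : ContMDiff I 𝓘(ℝ, ℝ) ∞ f)
    (p : M) : (1 / 2 * u p) • mvfderiv I (perelmanScal I g.inner f) p =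
      driftLaplacian I g.inner f u p • mvfderiv I f p := by
  refine smul_mvfderiv_eq (contMDiff_perelmanScal hf) hf fun m => ?_
  have h1 := (hu.isKer hf p).mul_pd_coordScal_eq m (mem_extChartAt_target p)
  rw [exp_mul_exp_neg_mul, congrFun (exp_mul_exp_neg_mul (I := I) f u p) (extChartAt I p p),
    Function.comp_apply, extChartAt_to_inv] at h1
  rw [pd_perelmanScal hf, driftLaplacian]
  linear_combination 1 / 2 * h1

/-- At a limit of points near which `u` vanishes, the 1-jet of `v` is zero by continuity. Unique
continuation then gives vanishing in a neighbourhood. -/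
theorem isClosed_eventually_eq_zero [T2Space M] (hu : IsInKerAdjoint I g f u)
    (hf : ContMDiff I 𝓘(ℝ, ℝ) ∞ f) (hn : 2 ≤ n) (hI : IsBoundaryModel I) :
    IsClosed {p | ∀ᶠ q in nhds p, u q = 0} := by
  refine isClosed_of_closure_subset fun p hp => ?_
  have h := hu.isKer hf p
  have hps := mem_extChartAt_source (I := I) p
  have hpt := mem_extChartAt_target (I := I) p
  have hconv : Convex ℝ (range I) := by
    rcases hI with hS | ⟨ℓ, -, hS⟩
    · rw [hS]; exact convex_univ
    · rw [hS]; exact convex_halfSpace_ge ℓ.toLinearMap.isLinear 0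
  have key : ∀ F : Eu n → ℝ, ContinuousOn F (extChartAt I p).target →
      (∀ q ∈ (extChartAt I p).source, (∀ᶠ q' in nhds q, u q' = 0) → F (extChartAt I p q) = 0) →
      F (extChartAt I p p) = 0 := fun F hF h0 => by
    have h1 : ContinuousAt (fun q => F (extChartAt I p q)) p :=
      (hF.comp (continuousOn_extChartAt p) (extChartAt I p).mapsTo).continuousAt
        (extChartAt_source_mem_nhds p)
    exact eq_zero_of_frequently (F := fun q => F (extChartAt I p q)) h1 (((mem_closure_iff_frequently.1 hp).and_eventually
      (extChartAt_source_mem_nhds (I := I) p)).mono fun q hq => h0 q hq.2 hq.1)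
  refine (eventually_eq_zero_iff (f := f) hps).1 (h.eventually_eq_zero hn hconv hpt ?_ fun i => ?_)
  · refine key _ h.smooth_v.continuousOn fun q hq h0 => ?_
    exact ((eventually_eq_zero_iff (f := f) hq).2 h0).self_of_nhdsWithin (mem_range_self _)
  · refine key _ (h.pd h.smooth_v i).continuousOn fun q hq h0 => ?_
    rw [pd_congr_of_eventuallyEq ((eventually_eq_zero_iff (f := f) hq).2 h0) (mem_range_self _)]
    simp [pd]

/-- The set of points near which `u` vanishes is open by definition and closed by unique
continuation. If it were nonempty, it would contain an entire connected component. -/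
theorem not_eventually_eq_zero [T2Space M] (hu : IsInKerAdjoint I g f u)
    (hf : ContMDiff I 𝓘(ℝ, ℝ) ∞ f) (hn : 2 ≤ n) (hI : IsBoundaryModel I)
    (hne : ∀ p : M, ∃ q ∈ connectedComponent p, u q ≠ 0) (p : M) :
    ¬∀ᶠ q in nhds p, u q = 0 := fun h0 => by
  have hclopen : IsClopen {p | ∀ᶠ q in nhds p, u q = 0} :=
    ⟨hu.isClosed_eventually_eq_zero hf hn hI, isOpen_setOfPred_eventually_nhds⟩
  obtain ⟨q, hq, huq⟩ := hne p
  have h1 : ∀ᶠ q' in nhds q, u q' = 0 := hclopen.connectedComponent_subset h0 hq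
  exact huq h1.self_of_nhds

/-- The smoothness and the division are stated on a whole neighbourhood of `p`, as the gluing
requires. The formula for the differential is needed only at `p` itself. -/
theorem exists_quotient [T2Space M] (hu : IsInKerAdjoint I g f u)
    (hf : ContMDiff I 𝓘(ℝ, ℝ) ∞ f) (hn : 2 ≤ n) (hI : IsBoundaryModel I)
    (hne : ∀ p : M, ∃ q ∈ connectedComponent p, u q ≠ 0) (p : M) :
    ∃ c : M → ℝ, (∀ᶠ q in nhds p, ContMDiffAt I 𝓘(ℝ, ℝ) ∞ c q) ∧
      (∀ᶠ q in nhds p, driftLaplacian I g.inner f u q = c q * u q) ∧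
      mvfderiv I (perelmanScal I g.inner f) p = (2 * c p) • mvfderiv I f p := by
  have h := hu.isKer hf p
  have hps := mem_extChartAt_source (I := I) p
  have hne' := mt (eventually_eq_zero_iff (f := f) hps).1
    (hu.not_eventually_eq_zero hf hn hI hne p)
  obtain ⟨b, O, hO, hpO, hOt, hb, hbu⟩ := h.exists_local_quotient' hn hI (mem_extChartAt_target p)
    (fun z hz hzi => by
      rw [hu.boundary _, mul_zero]
      rw [← I.compl_interior]
      intro h3
      have := (isInteriorPoint_iff_extChartAt ((extChartAt I p).map_target hz)).1 h3
      rw [(extChartAt I p).right_inv hz] at this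
      exact hzi this) hne'
  have hpn : ∀ᶠ q in nhds p, q ∈ (extChartAt I p).source ∧ extChartAt I p q ∈ O :=
    Filter.Eventually.and (extChartAt_source_mem_nhds p) ((continuousAt_extChartAt p).preimage_mem_nhds
      (hO.mem_nhds hpO))
  refine ⟨fun q => b (extChartAt I p q), ?_, ?_, ?_⟩
  · filter_upwards [hpn] with q hq
    refine contMDiffAt_comp_extChartAt hq.1 ((hb _ ⟨extChartAt_mem_range p _, hq.2⟩).mono_of_mem_nhdsWithin
      (Filter.inter_mem self_mem_nhdsWithin (mem_nhdsWithin_of_mem_nhds (hO.mem_nhds hq.2))))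
  · filter_upwards [hpn] with q hq
    have h1 := hbu _ ⟨extChartAt_mem_range p _, hq.2⟩
    rw [exp_mul_exp_neg_mul, congrFun (exp_mul_exp_neg_mul (I := I) f u p) (extChartAt I p q),
      Function.comp_apply, (extChartAt I p).left_inv hq.1] at h1
    rw [driftLaplacian_eq_driftLap g hf hu.smooth hq.1, h1]
  · rw [← one_smul ℝ (mvfderiv I (perelmanScal I g.inner f) p)]
    refine smul_mvfderiv_eq (contMDiff_perelmanScal hf) hf fun m => ?_
    rw [pd_perelmanScal hf, one_mul,
      h.pd_coordScal_eq hO ⟨extChartAt_mem_range p _, hpO⟩ hOt hb.continuousOn hbu hne' m]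

end IsInKerAdjoint

end

end Perelman

end

theorem mainTheorem5 {n : ℕ} {H : Type*} [TopologicalSpace H]
    (I : ModelWithCorners ℝ (EuclideanSpace ℝ (Fin n)) H) (hI : Perelman.IsBoundaryModel I)
    {M : Type*} [TopologicalSpace M] [T2Space M] [SecondCountableTopology M]
    [ChartedSpace H M] [IsManifold I ∞ M]
    (g : Bundle.ContMDiffRiemannianMetric I ∞ (EuclideanSpace ℝ (Fin n))
      (fun p : M => TangentSpace I p))
    (f : M → ℝ) (hf : ContMDiff I 𝓘(ℝ, ℝ) ∞ f)
    (u : M → ℝ) (hu : Perelman.IsInKerAdjoint I g f u) :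
    ContMDiff I 𝓘(ℝ, ℝ) ∞ (Perelman.perelmanScal I g.inner f) ∧
    (∀ p : M, (1 / 2 * u p) • mvfderiv I (Perelman.perelmanScal I g.inner f) p =
      Perelman.driftLaplacian I g.inner f u p • mvfderiv I f p) ∧
    (2 ≤ n → (∀ p : M, ∃ q ∈ connectedComponent p, u q ≠ 0) →
      ∃ σ : M → ℝ, ContMDiff I 𝓘(ℝ, ℝ) ∞ σ ∧
        (∀ p : M, mvfderiv I (Perelman.perelmanScal I g.inner f) p =
          (-2 * σ p) • mvfderiv I f p) ∧
        (∀ p : M, Perelman.driftLaplacian I g.inner f u p = -σ p * u p)) := by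
  refine ⟨Perelman.contMDiff_perelmanScal hf, hu.mul_mvfderiv_eq hf, fun hn hne => ?_⟩
  choose c hc hcu hcR using hu.exists_quotient hf hn hI hne
  -- `σ` is minus the diagonal of the local quotients. Gluing applies because `u` is nonzero
  -- arbitrarily close to every point.
  refine ⟨fun p => -c p p, (Perelman.exists_smooth_quotient hc hcu fun p =>
    Filter.not_eventually.1 (hu.not_eventually_eq_zero hf hn hI hne p)).neg, fun p => ?_,
    fun p => ?_⟩
  · rw [hcR p, neg_mul_neg]
  · rw [neg_neg, (hcu p).self_of_nhds]
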